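/- Let $A:\mathbb R^2\to\mathbb C$ be continuous with $\limsup_{p\to\infty}|A(p)|/|p|^2<1$. Put $\lambda_-(p)=|p|^2-|A(p)|$, $\kappa=\inf_{p}\lambda_-(p)$ and $S=\{p\in\mathbb R^2:\lambda_-(p)=\kappa\}$, and assume that $|A|$ is of class $C^2$ in a neighbourhood of $S$. In $\mathcal H=L^2(\mathbb R^2)\otimes\mathbb C^2$ let $H_0$ be the operator which the Fourier transform turns into multiplication by the matrix $\widehat H_0(p)=\begin{pmatrix}|p|^2&A(p)\\ \overline{A(p)}&|p|^2\end{pmatrix}$, and let $q_0$ be its quadratic form, with domain $H^1(\mathbb R^2)\otimes\mathbb C^2$. Let $m$ be a finite positive Radon measure on $\mathbb R^2$ and $h:\mathbb R^2\to\mathbb R$ a bounded Borel function, and assume that for some $a\in(0,1)$ and $b>0$ $$\int_{\mathbb R^2}(1+|h|^2)|f|^2\,dm\le a\int_{\mathbb R^2}|\nabla f|^2\,dx+b\int_{\mathbb R^2}|f|^2\,dx\qquad\text{for all } f\in\mathcal S(\mathbb R^2).$$ Let $J_2:H^1(\mathbb R^2)\otimes\mathbb C^2\to L^2(\mathbb R^2,m)\otimes\mathbb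 C^2$ be the continuous extension of the map $f\mapsto f$ on Schwartz spinors, put $\nu=hm$, $\nu(f,g)=\int\langle J_2f,J_2g\rangle_{\mathbb C^2}\,h\,dm$ and $q=q_0+\nu$ on $H^1(\mathbb R^2)\otimes\mathbb C^2$. Assume that the perturbation is form-bounded relative to $H_0$ with relative bound less than one: there are $a'<1$ and $b'\in\mathbb R$ with $|\nu(f,f)|\le a'\,q_0(f,f)+b'\|f\|^2$ for all $f\in H^1(\mathbb R^2)\otimes\mathbb C^2$. Then $q$ is closed and semibounded below; let $H=H_0+\nu$ be the operator associated with $q$. If $\nu\le0$ and the intersection of $\operatorname{supp}\nu$ with some circle is an infinite set, then $H$ has at least $\#S$ eigenvalues below $\kappa$: counted with multiplicity, their number is at least the number of points of $S$ if $S$ is finite; if $S$ is infinite, $H$ has infinitely many distinct eigenvalues below $\kappa$. In particular, the same conclusion holds if $m\neq0$ is spherically symmetric (invariant under all linear isometries of $\mathbb R^2$) and $h<0$ $m$-almost everywhere. -/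

import Mathlib

open MeasureTheory Filter SchwartzMap FourierTransform
open scoped ENNReal

noncomputable section

namespace SpinOrbit

/-- The Euclidean plane. -/
abbrev Plane : Type := EuclideanSpace ℝ (Fin 2)

/-- The Hermitian space of spinor values. -/
abbrev C2 : Type := EuclideanSpace ℂ (Fin 2)

/-- The Hilbert space of square-integrable two-dimensional spinors on the plane. -/
abbrev Spinors : Type := Lp C2 2 (volume : Measure Plane)

/-! ### The symbol of the unperturbed operator -/

/-- The symbol of the unperturbed Hamiltonian at the momentum `p`, as a matrix. -/
def symbol (A : Plane → ℂ) (p : Plane) : Matrix (Fin 2) (Fin 2) ℂ :=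
  !![((‖p‖ ^ 2 : ℝ) : ℂ), A p; (starRingEnd ℂ) (A p), ((‖p‖ ^ 2 : ℝ) : ℂ)]

/-- The lower dispersion law. -/
def lowerBand (A : Plane → ℂ) (p : Plane) : ℝ := ‖p‖ ^ 2 - ‖A p‖

/-- The bottom of the spectrum of the unperturbed Hamiltonian. -/
def threshold (A : Plane → ℂ) : ℝ := ⨅ p : Plane, lowerBand A p

/-- The set where the lower dispersion law attains its infimum. -/
def minimumSet (A : Plane → ℂ) : Set Plane := {p | lowerBand A p = threshold A}

/-- The standing assumptions on the symbol `A`, the measure `m` and the density `h`. -/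
structure System where
  /-- the off-diagonal entry of the symbol -/
  A : Plane → ℂ
  /-- the underlying measure; a finite Borel measure on the plane is a Radon measure -/
  m : Measure Plane
  /-- the density of the perturbation with respect to `m` -/
  h : Plane → ℝ
  continuous_A : Continuous A
  limsup_A : limsup (fun p : Plane => ENNReal.ofReal (‖A p‖ / ‖p‖ ^ 2)) (cocompact Plane) < 1
  contDiff_norm_A : ∃ U : Set Plane, IsOpen U ∧ minimumSet A ⊆ U ∧
    ContDiffOn ℝ 2 (fun p => ‖A p‖) U
  finite_m : IsFiniteMeasure m
  measurable_h : Measurable h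
  bounded_h : ∃ C : ℝ, ∀ x, |h x| ≤ C
  formBound : ∃ a : ℝ, 0 < a ∧ a < 1 ∧ ∃ b : ℝ, 0 < b ∧ ∀ f : 𝓢(Plane, ℂ),
    ∫ x, (1 + |h x| ^ 2) * ‖f x‖ ^ 2 ∂m ≤
      a * (∫ x, ∑ i : Fin 2, ‖fderiv ℝ f x (EuclideanSpace.single i 1)‖ ^ 2) +
      b * ∫ x, ‖f x‖ ^ 2

/-! ### The Sobolev space of spinors and the trace operator -/

/-- The Sobolev space of order one of spinors, as the space of the pairs `(f, v)` of
square-integrable spinors with `v(ξ) = |2πξ| (𝓕 f)(ξ)`. Here `𝓕` is the unitary Fourier transform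
with the kernel `exp (-2πi⟨x, ξ⟩)`, so that the momentum is `p = 2πξ`, and `‖v‖` is the
`L²`-norm of the gradient of `f`. The norm is `max ‖f‖ ‖v‖`, a norm of the usual topology. -/
def H1 : Submodule ℂ (Spinors × Spinors) where
  carrier := {z | (z.2 : Plane → C2) =ᵐ[volume]
    fun ξ => ((2 * Real.pi * ‖ξ‖ : ℝ) : ℂ) • (𝓕 z.1 : Spinors) ξ}
  zero_mem' := by
    have h0 : (𝓕 (0 : Spinors) : Spinors) = 0 := (Lp.fourierTransformₗᵢ Plane C2).map_zero
    simp only [Set.mem_ofPred_eq, Prod.fst_zero, Prod.snd_zero, h0]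
    filter_upwards [Lp.coeFn_zero C2 2 (volume : Measure Plane)] with ξ hξ
    exact hξ.trans (by rw [hξ]; exact (smul_zero _).symm)
  add_mem' := by
    intro z w hz hw
    simp only [Set.mem_ofPred_eq, Prod.fst_add, Prod.snd_add] at hz hw ⊢
    have h1 : (𝓕 (z.1 + w.1) : Spinors) = 𝓕 z.1 + 𝓕 w.1 :=
      (Lp.fourierTransformₗᵢ Plane C2).map_add z.1 w.1
    rw [h1]
    filter_upwards [hz, hw, Lp.coeFn_add z.2 w.2,
      Lp.coeFn_add (𝓕 z.1 : Spinors) (𝓕 w.1)] with ξ a b c d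
    rw [c, d, Pi.add_apply, Pi.add_apply, a, b, smul_add]
  smul_mem' := by
    intro k z hz
    simp only [Set.mem_ofPred_eq, Prod.smul_fst, Prod.smul_snd] at hz ⊢
    have h1 : (𝓕 (k • z.1) : Spinors) = k • 𝓕 z.1 :=
      (Lp.fourierTransformₗᵢ Plane C2).map_smul k z.1
    rw [h1]
    filter_upwards [hz, Lp.coeFn_smul k z.2, Lp.coeFn_smul k (𝓕 z.1 : Spinors)] with ξ a b c
    rw [b, c, Pi.smul_apply, Pi.smul_apply, a, smul_comm]

/-- The Fourier transform of an element of the Sobolev space, in the variable `ξ = p / 2π`. -/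
def hat (F : H1) : Spinors := 𝓕 F.1.1

theorem hat_add (F G : H1) : hat (F + G) = hat F + hat G :=
  (Lp.fourierTransformₗᵢ Plane C2).map_add F.1.1 G.1.1

theorem hat_smul (k : ℂ) (F : H1) : hat (k • F) = k • hat F :=
  (Lp.fourierTransformₗᵢ Plane C2).map_smul k F.1.1

theorem memLp_norm_smul (φ : 𝓢(Plane, C2)) :
    MemLp (fun ξ : Plane => ((2 * Real.pi * ‖ξ‖ : ℝ) : ℂ) • φ ξ) 2 volume := by
  have hg : Function.HasTemperateGrowth (fun ξ : Plane => 2 * Real.pi * (1 + ‖ξ‖ ^ 2)) := by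
    fun_prop
  refine ((smulLeftCLM C2 (fun ξ : Plane => 2 * Real.pi * (1 + ‖ξ‖ ^ 2)) φ).memLp 2
    volume).mono ?_ ?_
  · exact (by fun_prop : Continuous fun ξ : Plane =>
      ((2 * Real.pi * ‖ξ‖ : ℝ) : ℂ) • φ ξ).aestronglyMeasurable
  · refine Eventually.of_forall fun ξ => ?_
    rw [smulLeftCLM_apply_apply hg, norm_smul, norm_smul, Complex.norm_real]
    refine mul_le_mul_of_nonneg_right ?_ (norm_nonneg _)
    rw [Real.norm_of_nonneg (by positivity), Real.norm_of_nonneg (by positivity)]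
    have : ‖ξ‖ ≤ 1 + ‖ξ‖ ^ 2 := by nlinarith [sq_nonneg (‖ξ‖ - 1), norm_nonneg ξ]
    gcongr

/-- Schwartz spinors as elements of the Sobolev space. -/
def schwartzToH1 : 𝓢(Plane, C2) →ₗ[ℂ] H1 where
  toFun φ := ⟨(φ.toLp 2 volume, (memLp_norm_smul (𝓕 φ)).toLp), by
    change (_ : Plane → C2) =ᵐ[volume] _
    rw [SchwartzMap.toLp_fourier_eq]
    filter_upwards [(memLp_norm_smul (𝓕 φ)).coeFn_toLp, (𝓕 φ).coeFn_toLp 2 volume] with ξ a b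
    rw [a, b]⟩
  map_add' φ ψ := by
    refine Subtype.ext (Prod.ext rfl ?_)
    refine (MemLp.toLp_congr (memLp_norm_smul (𝓕 (φ + ψ)))
      ((memLp_norm_smul (𝓕 φ)).add (memLp_norm_smul (𝓕 ψ))) ?_).trans
      (MemLp.toLp_add (memLp_norm_smul (𝓕 φ)) (memLp_norm_smul (𝓕 ψ)))
    refine Eventually.of_forall fun ξ => ?_
    simp [FourierTransform.fourier_add, smul_add]
  map_smul' k φ := by
    refine Subtype.ext (Prod.ext rfl ?_)
    refine (MemLp.toLp_congr (memLp_norm_smul (𝓕 (k • φ)))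
      ((memLp_norm_smul (𝓕 φ)).const_smul k) ?_).trans
      (MemLp.toLp_const_smul k (memLp_norm_smul (𝓕 φ)))
    refine Eventually.of_forall fun ξ => ?_
    simp only [FourierTransform.fourier_smul, smul_apply, Pi.smul_apply]
    rw [smul_comm]

namespace System

variable (D : System)

instance instFinite : IsFiniteMeasure D.m := D.finite_m

/-- The threshold of the system. -/
abbrev kappa : ℝ := threshold D.A

/-- The trace operator from the Sobolev space to the square-integrable spinors with respect to
`m`: the continuous extension of the restriction map on Schwartz spinors. -/
def trace : H1 →L[ℂ] Lp C2 2 D.m :=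
  ((SchwartzMap.toLpCLM ℂ C2 2 D.m : 𝓢(Plane, C2) →L[ℂ] Lp C2 2 D.m) :
    𝓢(Plane, C2) →ₗ[ℂ] Lp C2 2 D.m).extendOfNorm schwartzToH1

/-! ### The sesquilinear forms, linear in the second argument -/

/-- The integrand of the unperturbed form at `ξ`. -/
def freeIntegrand (G F : H1) (ξ : Plane) : ℂ :=
  inner ℂ (hat G ξ) (WithLp.toLp 2
    ((symbol D.A ((2 * Real.pi) • ξ)).mulVec (WithLp.ofLp (hat F ξ))) : C2)

/-- The form of the unperturbed operator. -/
def freeForm (G F : H1) : ℂ := ∫ ξ, D.freeIntegrand G F ξ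

/-- The perturbation as a signed measure. -/
def nu : SignedMeasure Plane := D.m.withDensityᵥ D.h

/-- The form of the perturbation. -/
def nuForm (G F : H1) : ℂ :=
  ∫ x, (D.h x : ℂ) * inner ℂ (D.trace G x) (D.trace F x) ∂D.m

/-- The perturbed form. -/
def form (G F : H1) : ℂ := D.freeForm G F + D.nuForm G F

/-- The form of the perturbation is bounded with respect to the form of the unperturbed operator,
with a relative bound less than one. -/
def RelativelyFormBounded : Prop :=
  ∃ a : ℝ, a < 1 ∧ ∃ b : ℝ, ∀ F : H1,
    ‖D.nuForm F F‖ ≤ a * (D.freeForm F F).re + b * ‖F.1.1‖ ^ 2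

theorem exists_norm_A_le : ∃ C : ℝ, ∀ p, ‖D.A p‖ ≤ C + ‖p‖ ^ 2 := by
  have h1 := eventually_lt_of_limsup_lt D.limsup_A
  rw [Filter.Eventually, mem_cocompact] at h1
  obtain ⟨K, hK, hs⟩ := h1
  obtain ⟨C, hC⟩ := (hK.union (isCompact_singleton (x := (0 : Plane)))).exists_bound_of_continuousOn
    D.continuous_A.continuousOn
  refine ⟨max C 0, fun p => ?_⟩
  by_cases hp : p ∈ K ∪ {0}
  · have := hC p hp
    nlinarith [le_max_left C 0, sq_nonneg ‖p‖]
  · rw [Set.mem_union, not_or] at hp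
    have h2 : ENNReal.ofReal (‖D.A p‖ / ‖p‖ ^ 2) < 1 := hs hp.1
    have hp0 : 0 < ‖p‖ := norm_pos_iff.2 hp.2
    rw [ENNReal.ofReal_lt_one, div_lt_one (by positivity)] at h2
    linarith [le_max_right C 0]

theorem norm_symbol_le {C : ℝ} {p : Plane} (hC : ‖D.A p‖ ≤ C + ‖p‖ ^ 2) (u v : C2) :
    ‖(inner ℂ u (WithLp.toLp 2 ((symbol D.A p).mulVec (WithLp.ofLp v)) : C2) : ℂ)‖ ≤
      4 * (|C| + 2 * ‖p‖ ^ 2) * (‖u‖ * ‖v‖) := by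
  have hu : ∀ i, ‖u i‖ ≤ ‖u‖ := fun i => PiLp.norm_apply_le u i
  have hv : ∀ i, ‖v i‖ ≤ ‖v‖ := fun i => PiLp.norm_apply_le v i
  have hs : ∀ i j, ‖symbol D.A p i j‖ ≤ |C| + 2 * ‖p‖ ^ 2 := by
    have h1 : ‖D.A p‖ ≤ |C| + 2 * ‖p‖ ^ 2 := by
      nlinarith [le_abs_self C, sq_nonneg ‖p‖]
    have h2 : ‖(((‖p‖ ^ 2 : ℝ)) : ℂ)‖ ≤ |C| + 2 * ‖p‖ ^ 2 := by
      rw [Complex.norm_real, Real.norm_of_nonneg (by positivity)]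
      nlinarith [abs_nonneg C, sq_nonneg ‖p‖]
    intro i j
    fin_cases i <;> fin_cases j
    · exact h2
    · exact h1
    · change ‖(starRingEnd ℂ) (D.A p)‖ ≤ _
      rw [RCLike.norm_conj]; exact h1
    · exact h2
  rw [EuclideanSpace.inner_eq_star_dotProduct]
  simp only [dotProduct, Matrix.mulVec, Fin.sum_univ_two, Pi.star_apply]
  have key : ∀ i j, ‖symbol D.A p i j * v j * star (u i)‖ ≤
      (|C| + 2 * ‖p‖ ^ 2) * (‖u‖ * ‖v‖) := by
    intro i j
    rw [norm_mul, norm_mul, norm_star]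
    calc _ ≤ (|C| + 2 * ‖p‖ ^ 2) * ‖v‖ * ‖u‖ := by
          gcongr
          · exact hs i j
          · exact hv j
          · exact hu i
      _ = _ := by ring
  calc _ = ‖(symbol D.A p 0 0 * v 0 * star (u 0) + symbol D.A p 0 1 * v 1 * star (u 0)) +
        (symbol D.A p 1 0 * v 0 * star (u 1) + symbol D.A p 1 1 * v 1 * star (u 1))‖ := by
        congr 1; ring
    _ ≤ _ := by
        refine (norm_add_le _ _).trans ((add_le_add (norm_add_le _ _) (norm_add_le _ _)).trans ?_)
        linarith [key 0 0, key 0 1, key 1 0, key 1 1]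

theorem aestronglyMeasurable_freeIntegrand (G F : H1) :
    AEStronglyMeasurable (D.freeIntegrand G F) volume := by
  have hA := D.continuous_A
  have hG : ∀ i, AEStronglyMeasurable (fun ξ => (hat G ξ) i) volume := fun i =>
    (EuclideanSpace.proj (𝕜 := ℂ) i).continuous.comp_aestronglyMeasurable
      (Lp.aestronglyMeasurable (hat G))
  have hF : ∀ i, AEStronglyMeasurable (fun ξ => (hat F ξ) i) volume := fun i =>
    (EuclideanSpace.proj (𝕜 := ℂ) i).continuous.comp_aestronglyMeasurable
      (Lp.aestronglyMeasurable (hat F))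
  have hs : ∀ i j, AEStronglyMeasurable
      (fun ξ : Plane => symbol D.A ((2 * Real.pi) • ξ) i j) volume := by
    have h1 : Continuous (fun ξ : Plane => D.A ((2 * Real.pi) • ξ)) := by fun_prop
    intro i j
    refine Continuous.aestronglyMeasurable ?_
    fin_cases i <;> fin_cases j
    · change Continuous fun ξ : Plane => (((‖(2 * Real.pi) • ξ‖ ^ 2 : ℝ)) : ℂ)
      fun_prop
    · exact h1
    · exact Complex.continuous_conj.comp h1
    · change Continuous fun ξ : Plane => (((‖(2 * Real.pi) • ξ‖ ^ 2 : ℝ)) : ℂ)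
      fun_prop
  have : D.freeIntegrand G F = fun ξ =>
      (symbol D.A ((2 * Real.pi) • ξ) 0 0 * hat F ξ 0 +
        symbol D.A ((2 * Real.pi) • ξ) 0 1 * hat F ξ 1) * star (hat G ξ 0) +
      (symbol D.A ((2 * Real.pi) • ξ) 1 0 * hat F ξ 0 +
        symbol D.A ((2 * Real.pi) • ξ) 1 1 * hat F ξ 1) * star (hat G ξ 1) := by
    funext ξ
    rw [freeIntegrand, EuclideanSpace.inner_eq_star_dotProduct]
    simp only [dotProduct, Matrix.mulVec, Fin.sum_univ_two, Pi.star_apply]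
  rw [this]
  exact ((((hs 0 0).mul (hF 0)).add ((hs 0 1).mul (hF 1))).mul (hG 0).star).add
    ((((hs 1 0).mul (hF 0)).add ((hs 1 1).mul (hF 1))).mul (hG 1).star)

theorem integrable_freeIntegrand (G F : H1) : Integrable (D.freeIntegrand G F) := by
  obtain ⟨C, hC⟩ := D.exists_norm_A_le
  have i1 : Integrable (fun ξ => ‖hat G ξ‖ * ‖hat F ξ‖) :=
    (Lp.memLp (hat G)).norm.integrable_mul (Lp.memLp (hat F)).norm
  have i2 : Integrable (fun ξ => ‖G.1.2 ξ‖ * ‖F.1.2 ξ‖) :=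
    (Lp.memLp G.1.2).norm.integrable_mul (Lp.memLp F.1.2).norm
  refine Integrable.mono ((i1.const_mul (4 * |C|)).add (i2.const_mul 8))
    (D.aestronglyMeasurable_freeIntegrand G F) ?_
  have hG : (G.1.2 : Plane → C2) =ᵐ[volume]
    fun ξ => ((2 * Real.pi * ‖ξ‖ : ℝ) : ℂ) • hat G ξ := G.2
  have hF : (F.1.2 : Plane → C2) =ᵐ[volume]
    fun ξ => ((2 * Real.pi * ‖ξ‖ : ℝ) : ℂ) • hat F ξ := F.2
  filter_upwards [hG, hF] with ξ a b
  have hk : ‖(2 * Real.pi) • ξ‖ = 2 * Real.pi * ‖ξ‖ := by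
    rw [norm_smul, Real.norm_of_nonneg (by positivity)]
  have hk2 : ‖((2 * Real.pi * ‖ξ‖ : ℝ) : ℂ)‖ = 2 * Real.pi * ‖ξ‖ := by
    rw [Complex.norm_real, Real.norm_of_nonneg (by positivity)]
  refine (D.norm_symbol_le (hC _) _ _).trans ?_
  refine le_trans (le_of_eq ?_) (le_abs_self _)
  rw [Pi.add_apply, a, b, hk, norm_smul _ (hat G ξ), norm_smul _ (hat F ξ), hk2]
  ring

theorem freeForm_add (G F F' : H1) :
    D.freeForm G (F + F') = D.freeForm G F + D.freeForm G F' := by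
  rw [freeForm, freeForm, freeForm,
    ← integral_add (D.integrable_freeIntegrand G F) (D.integrable_freeIntegrand G F')]
  refine integral_congr_ae ?_
  filter_upwards [Lp.coeFn_add (hat F) (hat F')] with ξ hξ
  simp only [freeIntegrand]
  rw [hat_add, hξ, Pi.add_apply, ← inner_add_right, WithLp.ofLp_add, Matrix.mulVec_add,
    WithLp.toLp_add]

theorem freeForm_smul (k : ℂ) (G F : H1) : D.freeForm G (k • F) = k * D.freeForm G F := by
  rw [freeForm, freeForm, ← integral_const_mul]
  refine integral_congr_ae ?_
  filter_upwards [Lp.coeFn_smul k (hat F)] with ξ hξ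
  simp only [freeIntegrand]
  rw [hat_smul, hξ, Pi.smul_apply, WithLp.ofLp_smul, Matrix.mulVec_smul, WithLp.toLp_smul,
    inner_smul_right]

theorem integrable_nuForm (G F : H1) :
    Integrable (fun x => (D.h x : ℂ) * inner ℂ (D.trace G x) (D.trace F x)) D.m := by
  obtain ⟨C, hC⟩ := D.bounded_h
  refine Integrable.bdd_mul (c := C) (L2.integrable_inner (𝕜 := ℂ) (D.trace G) (D.trace F)) ?_ ?_
  · exact (Complex.measurable_ofReal.comp D.measurable_h).aestronglyMeasurable
  · exact Eventually.of_forall fun x => by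
      rw [Complex.norm_real, Real.norm_eq_abs]; exact hC x

theorem nuForm_add (G F F' : H1) :
    D.nuForm G (F + F') = D.nuForm G F + D.nuForm G F' := by
  rw [nuForm, nuForm, nuForm,
    ← integral_add (D.integrable_nuForm G F) (D.integrable_nuForm G F')]
  refine integral_congr_ae ?_
  filter_upwards [Lp.coeFn_add (D.trace F) (D.trace F')] with x hx
  rw [map_add, hx, Pi.add_apply, inner_add_right, mul_add]

theorem nuForm_smul (k : ℂ) (G F : H1) : D.nuForm G (k • F) = k * D.nuForm G F := by
  rw [nuForm, nuForm, ← integral_const_mul]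
  refine integral_congr_ae ?_
  filter_upwards [Lp.coeFn_smul k (D.trace F)] with x hx
  rw [map_smul, hx, Pi.smul_apply, inner_smul_right]
  ring

theorem form_add (G F F' : H1) : D.form G (F + F') = D.form G F + D.form G F' := by
  simp only [form, freeForm_add, nuForm_add]; ring

theorem form_smul (k : ℂ) (G F : H1) : D.form G (k • F) = k * D.form G F := by
  simp only [form, freeForm_smul, nuForm_smul]; ring

/-! ### The operator associated with the form -/

/-- The graph of the operator associated with the form: the pairs `(f, u)` with `f` in the form
domain and `q(g, f) = ⟪g, u⟫` for all `g` in the form domain. -/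
def hamiltonianGraph : Submodule ℂ (Spinors × Spinors) where
  carrier := {z | ∃ F : H1, F.1.1 = z.1 ∧ ∀ G : H1, D.form G F = inner ℂ G.1.1 z.2}
  zero_mem' := ⟨0, rfl, fun G => by simpa using D.form_smul 0 G 0⟩
  add_mem' := by
    rintro z w ⟨F, hF, hz⟩ ⟨F', hF', hw⟩
    refine ⟨F + F', by simp [hF, hF'], fun G => ?_⟩
    rw [form_add, hz, hw, Prod.snd_add, inner_add_right]
  smul_mem' := by
    rintro k z ⟨F, hF, hz⟩
    refine ⟨k • F, by simp [hF], fun G => ?_⟩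
    rw [form_smul, hz, Prod.smul_snd, inner_smul_right]

/-- The Hamiltonian, as an unbounded operator. -/
def hamiltonian : Spinors →ₗ.[ℂ] Spinors := D.hamiltonianGraph.toLinearPMap

/-- The Sobolev space is dense, so that the Hamiltonian is well defined. -/
theorem dense_fst_H1 : Dense {f : Spinors | ∃ F : H1, F.1.1 = f} := by
  have h1 : DenseRange (SchwartzMap.toLpCLM ℝ C2 2 (volume : Measure Plane)) :=
    SchwartzMap.denseRange_toLpCLM ENNReal.ofNat_ne_top
  refine Dense.mono ?_ h1
  rintro _ ⟨φ, rfl⟩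
  exact ⟨schwartzToH1 φ, rfl⟩

theorem hamiltonian_graph : D.hamiltonian.graph = D.hamiltonianGraph := by
  refine Submodule.toLinearPMap_graph_eq _ ?_
  rintro ⟨f, u⟩ ⟨F, hF, hu⟩ hf
  simp only at hF hu hf ⊢
  have hF0 : F = 0 := by
    have h1 : F.1.1 = 0 := hF.trans hf
    have h2 : (𝓕 (0 : Spinors) : Spinors) = 0 := (Lp.fourierTransformₗᵢ Plane C2).map_zero
    refine Subtype.ext (Prod.ext h1 (Lp.ext ?_))
    have h3 : (F.1.2 : Plane → C2) =ᵐ[volume]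
      fun ξ => ((2 * Real.pi * ‖ξ‖ : ℝ) : ℂ) • (𝓕 F.1.1 : Spinors) ξ := F.2
    rw [h1, h2] at h3
    filter_upwards [h3, Lp.coeFn_zero C2 2 (volume : Measure Plane)] with ξ a b
    rw [a, b]
    exact (smul_zero _).trans b.symm
  refine dense_fst_H1.eq_zero_of_inner_right ℂ ?_
  rintro _ ⟨G, rfl⟩
  rw [← hu G, hF0]
  simpa using D.form_smul 0 G 0

end System

/-! ### Eigenvalues of an unbounded operator -/

/-- The eigenspace of an unbounded operator for a real number. -/
def eigenspace (T : Spinors →ₗ.[ℂ] Spinors) (E : ℝ) : Submodule ℂ Spinors where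
  carrier := {f | (f, (E : ℂ) • f) ∈ T.graph}
  zero_mem' := by
    have := T.graph.zero_mem
    simp only [Set.mem_ofPred_eq, smul_zero]
    exact this
  add_mem' := by
    intro f g hf hg
    have := T.graph.add_mem hf hg
    rw [Prod.mk_add_mk, ← smul_add] at this
    exact this
  smul_mem' := by
    intro k f hf
    have := T.graph.smul_mem k hf
    rw [Prod.smul_mk, smul_comm] at this
    exact this

/-- The real eigenvalues below `c`. -/
def eigenvaluesBelow (T : Spinors →ₗ.[ℂ] Spinors) (c : ℝ) : Set ℝ :=
  {E | E < c ∧ eigenspace T E ≠ ⊥}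

/-- The number of the eigenvalues below `c`, counted with multiplicity: the dimension of the span
of the corresponding eigenspaces. -/
def countBelow (T : Spinors →ₗ.[ℂ] Spinors) (c : ℝ) : ℕ∞ :=
  Cardinal.toENat (Module.rank ℂ (⨆ E ∈ eigenvaluesBelow T c, eigenspace T E : Submodule ℂ Spinors))

/-- There are at least as many eigenvalues below the threshold, counted with multiplicity, as
there are points in the minimum set; and infinitely many distinct ones if that set is infinite. -/
def System.HasManyEigenvalues (D : System) : Prop :=
  (minimumSet D.A).encard ≤ countBelow D.hamiltonian D.kappa ∧
    ((minimumSet D.A).Infinite → (eigenvaluesBelow D.hamiltonian D.kappa).Infinite)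

end SpinOrbit

end

/-!
The form bound makes the compression of the form to high frequencies at least `κ`, while the trace
is compact on spinors with frequencies in a ball; so the part of the spectrum of `H` below `κ` is
discrete, and the min-max principle reduces the theorem to finding, for every finite `T ⊆ S`, a
space of dimension `#T` on which the form of `H - κ` is negative definite.

Such a space is spanned by wave packets, one for each `p₀ ∈ T`, with momenta concentrated near
`p₀` and polarized along the lower band. There `λ₋ - κ` is at most quadratic in the distance to
`p₀`, because `|A|` is of class `C²`, and points have zero capacity in the plane: with the profile
`‖ξ - ξ₀‖⁻²` on an annulus `e < ‖ξ - ξ₀‖ < d`, normalized in `L¹`, the free energy above `κ` tends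
to zero as `d → 0` and `d / e → ∞`, while the packet tends to the plane wave `x ↦ exp(i⟨p₀, x⟩)`
on the support of the measure. If the limiting perturbation form vanished at a linear combination,
this trigonometric polynomial would vanish on `supp ν`, hence at infinitely many points of a
circle, hence on the whole circle by the identity theorem. Its growth on the complexified circle
then forces all coefficients to be zero.

In the spherically symmetric case, the same capacity argument shows that `m` is not concentrated at
the origin, so that `supp m` contains a circle.
-/

noncomputable section

open MeasureTheory Filter Topology SchwartzMap FourierTransform
open scoped ENNReal InnerProductSpace LineDeriv ComplexConjugate

namespace SpinOrbit

/-! ### Weak convergence in Hilbert spaces -/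

section WeakConvergence

variable {𝕜 W L : Type*} [RCLike 𝕜] [NormedAddCommGroup W] [InnerProductSpace 𝕜 W]
  [NormedAddCommGroup L] [InnerProductSpace 𝕜 L]

variable (𝕜) in
/-- Weak convergence of a sequence in an inner product space, tested against inner products. -/
def WeaklyTendsto (w : ℕ → W) (x : W) : Prop :=
  ∀ u : W, Tendsto (fun n => ⟪u, w n⟫_𝕜) atTop (𝓝 ⟪u, x⟫_𝕜)

namespace WeaklyTendsto

theorem sub {w v : ℕ → W} {x y : W} (hw : WeaklyTendsto 𝕜 w x) (hv : WeaklyTendsto 𝕜 v y) :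
    WeaklyTendsto 𝕜 (fun n => w n - v n) (x - y) := fun u => by
  simpa only [inner_sub_right] using (hw u).sub (hv u)

theorem sub_const {w : ℕ → W} {x : W} (hw : WeaklyTendsto 𝕜 w x) (y : W) :
    WeaklyTendsto 𝕜 (fun n => w n - y) (x - y) :=
  hw.sub fun _ => tendsto_const_nhds

theorem mem_orthogonal {w : ℕ → W} {x : W} {S : Submodule 𝕜 W} (hw : WeaklyTendsto 𝕜 w x)
    (hS : ∀ n, w n ∈ Sᗮ) : x ∈ Sᗮ := fun u hu =>
  tendsto_nhds_unique (hw u) (tendsto_const_nhds.congr fun n => (hS n u hu).symm)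

theorem norm_le {w : ℕ → W} {x : W} {C : ℝ} (hw : WeaklyTendsto 𝕜 w x) (hC : ∀ n, ‖w n‖ ≤ C) :
    ‖x‖ ≤ C := by
  have hlim : Tendsto (fun n => RCLike.re ⟪x, w n⟫_𝕜) atTop (𝓝 (‖x‖ ^ 2)) := by
    rw [norm_sq_eq_re_inner (𝕜 := 𝕜)]
    exact (RCLike.continuous_re.tendsto _).comp (hw x)
  have hle : ‖x‖ ^ 2 ≤ ‖x‖ * C := le_of_tendsto' hlim fun n =>
    (re_inner_le_norm x (w n)).trans (by gcongr; exact hC n)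
  by_contra! hlt
  nlinarith [(norm_nonneg _).trans (hC 0)]

variable [CompleteSpace W]

theorem apply {w : ℕ → W} {x : W} (hw : WeaklyTendsto 𝕜 w x) (l : W →L[𝕜] 𝕜) :
    Tendsto (fun n => l (w n)) atTop (𝓝 (l x)) := by
  simpa only [InnerProductSpace.toDual_symm_apply] using
    hw ((InnerProductSpace.toDual 𝕜 W).symm l)

theorem map {w : ℕ → W} {x : W} (hw : WeaklyTendsto 𝕜 w x) (T : W →L[𝕜] L) :
    WeaklyTendsto 𝕜 (fun n => T (w n)) (T x) := fun u =>
  hw.apply ((innerSL 𝕜 u).comp T)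

theorem exists_norm_le {w : ℕ → W} {x : W} (hw : WeaklyTendsto 𝕜 w x) :
    ∃ C, ∀ n, ‖w n‖ ≤ C := by
  have hpointwise : ∀ u, ∃ C, ∀ n, ‖innerSL 𝕜 (w n) u‖ ≤ C := fun u => by
    obtain ⟨C, hC⟩ := (hw u).norm.bddAbove_range
    refine ⟨C, fun n => ?_⟩
    rw [innerSL_apply_apply, norm_inner_symm]
    exact hC ⟨n, rfl⟩
  simpa only [innerSL_apply_norm] using banach_steinhaus hpointwise

end WeaklyTendsto

theorem exists_subseq_weaklyTendsto [CompleteSpace W] [TopologicalSpace.SeparableSpace W]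
    {w : ℕ → W} {C : ℝ} (hw : ∀ n, ‖w n‖ ≤ C) :
    ∃ (x : W) (φ : ℕ → ℕ), StrictMono φ ∧ WeaklyTendsto 𝕜 (fun n => w (φ n)) x := by
  let e := InnerProductSpace.toDual 𝕜 W
  have hmem : ∀ n, StrongDual.toWeakDual (e (w n)) ∈
      WeakDual.toStrongDual ⁻¹' Metric.closedBall (0 : StrongDual 𝕜 W) C := fun n => by
    change e (w n) ∈ Metric.closedBall 0 C
    rw [mem_closedBall_zero_iff, LinearIsometryEquiv.norm_map]
    exact hw n
  obtain ⟨y, -, φ, hφ, hy⟩ := WeakDual.isSeqCompact_closedBall 𝕜 W 0 C hmem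
  refine ⟨e.symm (WeakDual.toStrongDual y), φ, hφ, fun u => ?_⟩
  have hlim : Tendsto (fun n => ⟪w (φ n), u⟫_𝕜) atTop
      (𝓝 ⟪e.symm (WeakDual.toStrongDual y), u⟫_𝕜) := by
    rw [InnerProductSpace.toDual_symm_apply]
    exact ((WeakBilin.eval_continuous (topDualPairing 𝕜 W) u).tendsto y).comp hy
  simpa only [Function.comp_def, inner_conj_symm] using
    (RCLike.continuous_conj.tendsto _).comp hlim

end WeakConvergence

/-! ### The variational principle below the essential spectrum -/

section Variational

variable {𝕜 W L : Type*} [RCLike 𝕜] [NormedAddCommGroup W] [InnerProductSpace 𝕜 W]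
  [NormedAddCommGroup L] [InnerProductSpace 𝕜 L]

/-- The form `q - E ⟪ι ·, ι ·⟫`: the form `q` is that of an operator in `L`, whose form domain is
parametrized by `ι`, and `shift q ι E` is the form of the operator minus `E`. -/
def shift (q : W →L⋆[𝕜] W →L[𝕜] 𝕜) (ι : W →L[𝕜] L) (E : ℝ) : W →L⋆[𝕜] W →L[𝕜] 𝕜 :=
  q - (E : 𝕜) • (innerSL 𝕜).bilinearComp ι ι

theorem shift_apply (q : W →L⋆[𝕜] W →L[𝕜] 𝕜) (ι : W →L[𝕜] L) (E : ℝ) (u v : W) :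
    shift q ι E u v = q u v - E * ⟪ι u, ι v⟫_𝕜 := rfl

theorem re_shift_self (q : W →L⋆[𝕜] W →L[𝕜] 𝕜) (ι : W →L[𝕜] L) (E : ℝ) (w : W) :
    RCLike.re (shift q ι E w w) = RCLike.re (q w w) - E * ‖ι w‖ ^ 2 := by
  rw [shift_apply, map_sub, RCLike.re_ofReal_mul, ← norm_sq_eq_re_inner]

theorem re_smul_smul (p : W →L⋆[𝕜] W →L[𝕜] 𝕜) (k : 𝕜) (w : W) :
    RCLike.re (p (k • w) (k • w)) = ‖k‖ ^ 2 * RCLike.re (p w w) := by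
  have hscale : p (k • w) (k • w) = ((‖k‖ ^ 2 : ℝ) : 𝕜) * p w w := by
    simp only [map_smulₛₗ, smul_apply, smul_eq_mul, RingHom.id_apply, ← mul_assoc,
      RCLike.mul_conj, RCLike.ofReal_pow]
  rw [hscale, RCLike.re_ofReal_mul]

-- The Cauchy-Schwarz inequality for the semi-inner product defined by the form.
theorem apply_eq_zero_of_nonneg {p : W →L⋆[𝕜] W →L[𝕜] 𝕜} (hp : ∀ u v, conj (p u v) = p v u)
    {S : Submodule 𝕜 W} (hS : ∀ w ∈ S, 0 ≤ RCLike.re (p w w)) {F G : W} (hF : F ∈ S)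
    (hFF : RCLike.re (p F F) = 0) (hG : G ∈ S) : p G F = 0 := by
  let core : PreInnerProductSpace.Core 𝕜 S :=
    { inner := fun u v => p u v
      conj_inner_symm := fun u v => hp v u
      re_inner_nonneg := fun u => hS u u.2
      add_left := fun u v w => by simp
      smul_left := fun u v k => by simp }
  have hCS : ‖p G F‖ * ‖p F G‖ ≤ RCLike.re (p G G) * RCLike.re (p F F) :=
    InnerProductSpace.Core.inner_mul_inner_self_le (c := core) ⟨G, hG⟩ ⟨F, hF⟩
  rw [hFF, mul_zero, ← hp G F, RCLike.norm_conj] at hCS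
  exact norm_eq_zero.1 (mul_self_eq_zero.1 (hCS.antisymm (mul_self_nonneg _)))

/-- The weak solutions, in the form domain, of the eigenvalue equation. -/
def weakEigenspace (q : W →L⋆[𝕜] W →L[𝕜] 𝕜) (ι : W →L[𝕜] L) (E : ℝ) : Submodule 𝕜 W :=
  (shift q ι E).flip.ker

theorem mem_weakEigenspace {q : W →L⋆[𝕜] W →L[𝕜] 𝕜} {ι : W →L[𝕜] L} {E : ℝ} {w : W} :
    w ∈ weakEigenspace q ι E ↔ ∀ g, shift q ι E g w = 0 :=
  ContinuousLinearMap.ext_iff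

/-- The span of the weak eigenvectors below `κ`. -/
def weakEigenspacesBelow (q : W →L⋆[𝕜] W →L[𝕜] 𝕜) (ι : W →L[𝕜] L) (κ : ℝ) : Submodule 𝕜 W :=
  ⨆ E ∈ Set.Iio κ, weakEigenspace q ι E

/-- A bounded Hermitian form, coercive with respect to the injection `ι`, whose operator has its
essential spectrum above `κ`. The latter is encoded by the nonnegativity, in the limit, of the form
shifted by `κ` along the weak null sequences. -/
structure EssentiallyBoundedBelow (q : W →L⋆[𝕜] W →L[𝕜] 𝕜) (ι : W →L[𝕜] L) (κ : ℝ) : Prop where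
  conj_symm : ∀ u v, conj (q u v) = q v u
  injective : Function.Injective ι
  coercive : ∃ c > 0, ∃ E : ℝ, ∀ w, c * ‖w‖ ^ 2 ≤ RCLike.re (shift q ι E w w)
  liminf_nonneg : ∀ w : ℕ → W, WeaklyTendsto 𝕜 w 0 → ∀ ε > 0, ∀ᶠ n in atTop,
    -ε ≤ RCLike.re (shift q ι κ (w n) (w n))

namespace EssentiallyBoundedBelow

variable {q : W →L⋆[𝕜] W →L[𝕜] 𝕜} {ι : W →L[𝕜] L} {κ : ℝ}

theorem conj_shift (h : EssentiallyBoundedBelow q ι κ) (E : ℝ) (u v : W) :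
    conj (shift q ι E u v) = shift q ι E v u := by
  rw [shift_apply, shift_apply, map_sub, map_mul, h.conj_symm, RCLike.conj_ofReal, inner_conj_symm]

theorem norm_pos (h : EssentiallyBoundedBelow q ι κ) {w : W} (hw : w ≠ 0) : 0 < ‖ι w‖ :=
  norm_pos_iff.2 ((map_ne_zero_iff ι h.injective).2 hw)

theorem exists_norm_le (h : EssentiallyBoundedBelow q ι κ) (E B C : ℝ) :
    ∃ R, ∀ w, ‖ι w‖ ≤ B → RCLike.re (shift q ι E w w) ≤ C → ‖w‖ ≤ R := by
  obtain ⟨c, hc, E', hE'⟩ := h.coercive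
  refine ⟨√((C + |E - E'| * B ^ 2) / c), fun w hB hC => Real.le_sqrt_of_sq_le ?_⟩
  have hsq : (E - E') * ‖ι w‖ ^ 2 ≤ |E - E'| * B ^ 2 := by
    gcongr
    exact le_abs_self _
  rw [le_div_iff₀' hc]
  have hcoer := hE' w
  rw [re_shift_self] at hcoer hC
  linarith

theorem eventually_le_of_weaklyTendsto [CompleteSpace W] (h : EssentiallyBoundedBelow q ι κ)
    {w : ℕ → W} {x : W} (hw : WeaklyTendsto 𝕜 w x) {ε : ℝ} (hε : 0 < ε) :
    ∀ᶠ n in atTop, RCLike.re (shift q ι κ x x) - ε ≤ RCLike.re (shift q ι κ (w n) (w n)) := by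
  set p := shift q ι κ
  have hnull : WeaklyTendsto 𝕜 (fun n => w n - x) 0 := by simpa using hw.sub_const x
  have hcross : Tendsto (fun n => RCLike.re (p x (w n - x))) atTop (𝓝 0) := by
    simpa only [Function.comp_def, map_zero] using
      (RCLike.continuous_re.tendsto _).comp (hnull.apply (p x))
  filter_upwards [h.liminf_nonneg _ hnull (ε / 2) (by positivity),
    hcross.eventually (lt_mem_nhds (show -(ε / 4) < 0 by linarith))] with n hn hn'
  have hexpand : p (w n) (w n) =
      p x x + p x (w n - x) + conj (p x (w n - x)) + p (w n - x) (w n - x) := by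
    rw [h.conj_shift]
    simp only [p, map_sub, sub_apply]
    ring
  rw [hexpand, map_add, map_add, map_add, RCLike.conj_re]
  linarith

theorem exists_minimizing_seq (h : EssentiallyBoundedBelow q ι κ) {S : Submodule 𝕜 W} {v : W}
    (hv : v ∈ S) (hneg : RCLike.re (shift q ι κ v v) < 0) :
    ∃ E < κ, (∀ w ∈ S, 0 ≤ RCLike.re (shift q ι E w w)) ∧
      ∀ ε > 0, ∃ w ∈ S, ‖ι w‖ = 1 ∧ RCLike.re (shift q ι E w w) ≤ ε := by
  set T : Set ℝ := {E | ∀ w ∈ S, 0 ≤ RCLike.re (shift q ι E w w)} with hT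
  have hTne : T.Nonempty := by
    obtain ⟨c, hc, E', hE'⟩ := h.coercive
    exact ⟨E', fun w _ => le_trans (by positivity) (hE' w)⟩
  have hιv : 0 < ‖ι v‖ := h.norm_pos (by rintro rfl; simp at hneg)
  have hTle : ∀ E ∈ T, E ≤ RCLike.re (q v v) / ‖ι v‖ ^ 2 := fun E hE => by
    rw [le_div_iff₀ (by positivity), ← sub_nonneg, ← re_shift_self]
    exact hE v hv
  have hbdd : BddAbove T := ⟨_, hTle⟩
  have hsup : sSup T ∈ T := by
    have hclosed : IsClosed T := by
      simp only [hT, re_shift_self, Set.ofPred_forall]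
      exact isClosed_iInter fun w => isClosed_iInter fun _ =>
        isClosed_le continuous_const (by fun_prop)
    exact hclosed.csSup_mem hTne hbdd
  refine ⟨sSup T, ?_, hsup, fun ε hε => ?_⟩
  · refine (csSup_le hTne hTle).trans_lt ?_
    rw [div_lt_iff₀ (by positivity), ← sub_neg, ← re_shift_self]
    exact hneg
  · have hnot : sSup T + ε ∉ T := fun hmem => by linarith [le_csSup hbdd hmem]
    simp only [hT, Set.mem_ofPred_eq, not_forall, not_le] at hnot
    obtain ⟨w, hw, hlt⟩ := hnot
    have hιw : 0 < ‖ι w‖ := h.norm_pos (by rintro rfl; simp at hlt)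
    refine ⟨((‖ι w‖⁻¹ : ℝ) : 𝕜) • w, S.smul_mem _ hw, ?_, ?_⟩
    · rw [map_smul, norm_smul, RCLike.norm_ofReal, abs_of_pos (by positivity),
        inv_mul_cancel₀ hιw.ne']
    · rw [re_smul_smul, RCLike.norm_ofReal, sq_abs, inv_pow, inv_mul_le_iff₀ (by positivity)]
      rw [re_shift_self] at hlt ⊢
      linarith

theorem shift_apply_eq_zero_of_mem (h : EssentiallyBoundedBelow q ι κ) (E : ℝ) {F e : W}
    (hF : ∀ e ∈ weakEigenspacesBelow q ι κ, ⟪ι e, ι F⟫_𝕜 = 0)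
    (he : e ∈ weakEigenspacesBelow q ι κ) : shift q ι E e F = 0 := by
  have hle : weakEigenspacesBelow q ι κ ≤ (shift q ι E F).ker := by
    refine iSup₂_le fun E' hE' e he' => ?_
    have horth : ⟪ι F, ι e⟫_𝕜 = 0 :=
      inner_eq_zero_symm.1 (hF e (Submodule.mem_iSup_of_mem E' (Submodule.mem_iSup_of_mem hE' he')))
    have heq := mem_weakEigenspace.1 he' F
    rw [shift_apply, horth, mul_zero] at heq
    change shift q ι E F e = 0
    rw [shift_apply, horth, mul_zero, heq]
  have hzero : shift q ι E F e = 0 := hle he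
  rw [← h.conj_shift, hzero, map_zero]

theorem mem_weakEigenspace_of_orthogonal (h : EssentiallyBoundedBelow q ι κ)
    [FiniteDimensional 𝕜 (weakEigenspacesBelow q ι κ)] {E : ℝ} {F : W}
    (hF : ∀ e ∈ weakEigenspacesBelow q ι κ, ⟪ι e, ι F⟫_𝕜 = 0)
    (hsol : ∀ G, (∀ e ∈ weakEigenspacesBelow q ι κ, ⟪ι e, ι G⟫_𝕜 = 0) → shift q ι E G F = 0) :
    F ∈ weakEigenspace q ι E := by
  set M := weakEigenspacesBelow q ι κ
  refine mem_weakEigenspace.2 fun G => ?_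
  obtain ⟨e, he, heG⟩ := ((M.map (ι : W →ₗ[𝕜] L)).orthogonalProjectionOnto (ι G)).2
  change ι e = (M.map (ι : W →ₗ[𝕜] L)).starProjection (ι G) at heG
  have horth : ∀ e' ∈ M, ⟪ι e', ι (G - e)⟫_𝕜 = 0 := fun e' he' => by
    rw [map_sub, heG]
    exact Submodule.inner_right_of_mem_orthogonal (Submodule.mem_map_of_mem he')
      (Submodule.sub_starProjection_mem_orthogonal _)
  rw [← sub_add_cancel G e, map_add, add_apply, hsol _ horth,
    h.shift_apply_eq_zero_of_mem E hF he, add_zero]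

variable [CompleteSpace W] [TopologicalSpace.SeparableSpace W]

theorem exists_minimizer (h : EssentiallyBoundedBelow q ι κ) {S : Submodule 𝕜 W} {v : W}
    (hv : v ∈ Sᗮ) (hneg : RCLike.re (shift q ι κ v v) < 0) :
    ∃ E < κ, ∃ F ∈ Sᗮ, F ≠ 0 ∧ ∀ G ∈ Sᗮ, shift q ι E G F = 0 := by
  obtain ⟨E, hE, hnonneg, hseq⟩ := h.exists_minimizing_seq hv hneg
  choose w hwS hw1 hwE using fun n : ℕ => hseq (1 / ((n : ℝ) + 1)) (by positivity)
  obtain ⟨R, hR⟩ := h.exists_norm_le E 1 1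
  have hbound : ∀ n, ‖w n‖ ≤ R := fun n => by
    refine hR _ (hw1 n).le ((hwE n).trans ?_)
    rw [div_le_one (by positivity)]
    linarith [(Nat.cast_nonneg n : (0 : ℝ) ≤ n)]
  obtain ⟨x, φ, hφ, hx⟩ := exists_subseq_weaklyTendsto (𝕜 := 𝕜) hbound
  have hxS : x ∈ Sᗮ := hx.mem_orthogonal fun n => hwS (φ n)
  have hιx : ‖ι x‖ ≤ 1 := (hx.map ι).norm_le fun n => (hw1 (φ n)).le
  have hxκ : RCLike.re (shift q ι κ x x) ≤ E - κ := by
    refine le_of_forall_pos_le_add fun ε hε => ?_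
    have hsmall := (tendsto_one_div_add_atTop_nhds_zero_nat.comp hφ.tendsto_atTop).eventually
      (gt_mem_nhds (half_pos hε))
    obtain ⟨n, hlsc, hn⟩ :=
      ((h.eventually_le_of_weaklyTendsto hx (half_pos hε)).and hsmall).exists
    have hle := (hwE (φ n)).trans hn.le
    rw [re_shift_self _ _ _ (w (φ n)), hw1] at hlsc hle
    linarith
  have hxE : RCLike.re (shift q ι E x x) = 0 := by
    refine le_antisymm ?_ (hnonneg x hxS)
    rw [re_shift_self] at hxκ ⊢
    nlinarith [pow_le_one₀ (n := 2) (norm_nonneg _) hιx]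
  refine ⟨E, hE, x, hxS, ?_, fun G hG =>
    apply_eq_zero_of_nonneg (h.conj_shift E) hnonneg hxS hxE hG⟩
  rintro rfl
  simp only [map_zero] at hxκ
  linarith

theorem finrank_le_rank_weakEigenspacesBelow [CompleteSpace L] (h : EssentiallyBoundedBelow q ι κ)
    {V : Submodule 𝕜 W} (hV : ∀ v ∈ V, v ≠ 0 → RCLike.re (shift q ι κ v v) < 0) :
    (Module.finrank 𝕜 V : Cardinal) ≤ Module.rank 𝕜 (weakEigenspacesBelow q ι κ) := by
  by_contra! hlt
  set M := weakEigenspacesBelow q ι κ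
  have : FiniteDimensional 𝕜 M :=
    Module.rank_lt_aleph0_iff.1 (hlt.trans Cardinal.natCast_lt_aleph0)
  rw [← Module.finrank_eq_rank, Nat.cast_lt] at hlt
  -- Orthogonality in `L` to the eigenvectors is orthogonality in `W` to their images under `ι† ι`.
  set S := M.map (ι.adjoint.comp ι : W →ₗ[𝕜] W)
  have hS : ∀ w, w ∈ Sᗮ ↔ ∀ e ∈ M, ⟪ι e, ι w⟫_𝕜 = 0 := fun w => by
    simp only [S, Submodule.mem_orthogonal, Submodule.mem_map, forall_exists_index, and_imp,
      forall_apply_eq_imp_iff₂, ContinuousLinearMap.coe_coe, ContinuousLinearMap.comp_apply,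
      ContinuousLinearMap.adjoint_inner_left]
  obtain ⟨v, hvS, hv0⟩ : ∃ v : V, (v : W) ∈ Sᗮ ∧ v ≠ 0 := by
    have hker : ((S.orthogonalProjectionOnto : W →ₗ[𝕜] S) ∘ₗ V.subtype).ker ≠ ⊥ := fun hbot =>
      (LinearMap.finrank_le_finrank_of_injective (LinearMap.ker_eq_bot.1 hbot)).not_gt
        ((Submodule.finrank_map_le _ M).trans_lt hlt)
    obtain ⟨v, hv, hv0⟩ := Submodule.exists_mem_ne_zero_of_ne_bot hker
    exact ⟨v, Submodule.orthogonalProjectionOnto_eq_zero_iff.1 hv, hv0⟩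
  obtain ⟨E, hE, F, hFS, hF0, hsol⟩ :=
    h.exists_minimizer hvS (hV v v.2 (Subtype.coe_ne_coe.2 hv0))
  have hFM := (hS F).1 hFS
  have hmem : F ∈ M := Submodule.mem_iSup_of_mem E (Submodule.mem_iSup_of_mem hE
    (h.mem_weakEigenspace_of_orthogonal hFM fun G hG => hsol G ((hS G).2 hG)))
  exact (h.norm_pos hF0).ne' (norm_eq_zero.2 (inner_self_eq_zero.1 (hFM F hmem)))

theorem finiteDimensional_weakEigenspace (h : EssentiallyBoundedBelow q ι κ) {E : ℝ}
    (hE : E < κ) : FiniteDimensional 𝕜 (weakEigenspace q ι E) := by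
  by_contra hinf
  obtain ⟨R, f, -, hfR, hsep⟩ := exists_seq_norm_le_one_le_norm_sub hinf
  obtain ⟨x, φ, hφ, hx⟩ := exists_subseq_weaklyTendsto (𝕜 := 𝕜) (w := fun n => (f n : W)) hfR
  obtain ⟨c, hc, E', hE'⟩ := h.coercive
  have hnull : WeaklyTendsto 𝕜 (fun n => (f (φ (n + 1)) : W) - f (φ n)) 0 := by
    have hsucc : WeaklyTendsto 𝕜 (fun n => (f (φ (n + 1)) : W)) x := fun u =>
      (hx u).comp (tendsto_add_atTop_nat 1)
    simpa only [sub_self] using hsucc.sub hx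
  set K := |E - E'| + 1
  have hK : 0 < K := by positivity
  obtain ⟨n, hn⟩ := (h.liminf_nonneg _ hnull ((κ - E) * (c / (2 * K)))
    (mul_pos (sub_pos.2 hE) (by positivity))).exists
  set d := f (φ (n + 1)) - f (φ n)
  have hd1 : 1 ≤ ‖(d : W)‖ ^ 2 := one_le_pow₀ (hsep (hφ.injective.ne n.succ_ne_self))
  have hdE : RCLike.re (q d d) = E * ‖ι d‖ ^ 2 := by
    rw [← sub_eq_zero, ← re_shift_self, mem_weakEigenspace.1 d.2, map_zero]
  have hsmall : ‖ι d‖ ^ 2 ≤ c / (2 * K) := by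
    refine le_of_mul_le_mul_left ?_ (sub_pos.2 hE)
    have hn' : -((κ - E) * (c / (2 * K))) ≤ RCLike.re (shift q ι κ (d : W) d) := hn
    rw [re_shift_self, hdE] at hn'
    linarith
  have hlarge : c ≤ K * ‖ι d‖ ^ 2 := by
    have hcoer := hE' d
    rw [re_shift_self, hdE, ← sub_mul] at hcoer
    nlinarith [mul_le_mul_of_nonneg_right (le_abs_self (E - E')) (sq_nonneg ‖ι d‖),
      sq_nonneg ‖ι d‖]
  have hKc : K * ‖ι d‖ ^ 2 ≤ c / 2 := by
    calc K * ‖ι d‖ ^ 2 ≤ K * (c / (2 * K)) := by gcongr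
      _ = c / 2 := by field_simp
  linarith

theorem infinite_of_aleph0_le_rank (h : EssentiallyBoundedBelow q ι κ)
    (hrank : Cardinal.aleph0 ≤ Module.rank 𝕜 (weakEigenspacesBelow q ι κ)) :
    {E | E < κ ∧ weakEigenspace q ι E ≠ ⊥}.Infinite := by
  intro hfin
  have hle : weakEigenspacesBelow q ι κ ≤
      ⨆ E : {E | E < κ ∧ weakEigenspace q ι E ≠ ⊥}, weakEigenspace q ι E := by
    refine iSup₂_le fun E hE => ?_
    by_cases hbot : weakEigenspace q ι E = ⊥
    · rw [hbot]
      exact bot_le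
    · exact le_iSup (fun E : {E | E < κ ∧ weakEigenspace q ι E ≠ ⊥} => weakEigenspace q ι (E : ℝ))
        ⟨E, hE, hbot⟩
  have := hfin.to_subtype
  have hfd (E : {E | E < κ ∧ weakEigenspace q ι E ≠ ⊥}) :
      FiniteDimensional 𝕜 (weakEigenspace q ι (E : ℝ)) :=
    h.finiteDimensional_weakEigenspace E.2.1
  have := Submodule.finiteDimensional_of_le hle
  exact hrank.not_gt (Module.rank_lt_aleph0 𝕜 _)

end EssentiallyBoundedBelow

end Variational

/-! ### Trigonometric polynomials on a circle -/

section TrigonometricPolynomials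

open scoped ComplexOrder in
theorem tendsto_exp_mul_add_mul_inv_sub {a u : ℂ} {M : ℝ} (b : ℂ) (h : ‖a * u‖ ≤ M) :
    Tendsto (fun t : ℝ => Complex.exp (a * (t * u) + b * (t * u)⁻¹ - t * M)) atTop
      (𝓝 (if a * u = M then 1 else 0)) := by
  have hinv : Tendsto (fun t : ℝ => Complex.exp (b * (t * u)⁻¹)) atTop (𝓝 1) := by
    have hofReal : Tendsto (fun t : ℝ => ((t⁻¹ : ℝ) : ℂ)) atTop (𝓝 0) :=
      (Complex.continuous_ofReal.tendsto' 0 0 Complex.ofReal_zero).comp tendsto_inv_atTop_zero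
    refine (Complex.continuous_exp.tendsto' 0 1 Complex.exp_zero).comp ?_
    simpa only [mul_inv, Complex.ofReal_inv, zero_mul, mul_zero] using
      (hofReal.mul_const u⁻¹).const_mul b
  have hsplit (t : ℝ) : Complex.exp (a * (t * u) + b * (t * u)⁻¹ - t * M) =
      Complex.exp (t * (a * u - M)) * Complex.exp (b * (t * u)⁻¹) := by
    rw [← Complex.exp_add]
    ring_nf
  simp only [hsplit]
  split_ifs with heq
  · simpa only [heq, sub_self, mul_zero, Complex.exp_zero, one_mul] using hinv
  · have hre : (a * u - M).re < 0 := by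
      rw [Complex.sub_re, Complex.ofReal_re, sub_neg]
      refine lt_of_le_of_ne ((Complex.re_le_norm _).trans h) fun hre => heq ?_
      have hnonneg : 0 ≤ a * u :=
        Complex.re_eq_norm.1 (le_antisymm (Complex.re_le_norm _) (h.trans hre.ge))
      exact Complex.ext hre (Complex.nonneg_iff.1 hnonneg).2.symm
    rw [← zero_mul (1 : ℂ)]
    refine Tendsto.mul (tendsto_zero_iff_norm_tendsto_zero.2 ?_) hinv
    simp only [Complex.norm_exp, Complex.re_ofReal_mul]
    exact Real.tendsto_exp_atBot.comp (tendsto_id.atTop_mul_const_of_neg hre)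

variable {N : Type*} [Fintype N]

-- The summand with the largest `‖a j‖` dominates along the ray on which `a j * z` is positive.
theorem eq_zero_of_sum_exp_eq_zero {a : N → ℂ} (ha : Function.Injective a) (b : N → ℂ) {c : N → ℂ}
    (h : ∀ z ≠ 0, ∑ j, c j * Complex.exp (a j * z + b j * z⁻¹) = 0) : c = 0 := by
  classical
  by_contra hc
  obtain ⟨k, hk⟩ := Function.ne_iff.1 hc
  obtain ⟨j₀, hj₀, hmax⟩ := Finset.exists_max_image (Finset.univ.filter fun j => c j ≠ 0)
    (fun j => ‖a j‖) ⟨k, by simpa using hk⟩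
  simp only [Finset.mem_filter, Finset.mem_univ, true_and] at hj₀ hmax
  obtain ⟨u, hu, hau⟩ := RCLike.exists_norm_eq_mul_self (a j₀)
  have hu0 : u ≠ 0 := norm_ne_zero_iff.1 (by rw [hu]; exact one_ne_zero)
  have hterm (j : N) : Tendsto (fun t : ℝ => c j * Complex.exp (a j * (t * u) +
      b j * (t * u)⁻¹ - t * ‖a j₀‖)) atTop (𝓝 (if j = j₀ then c j₀ else 0)) := by
    by_cases hcj : c j = 0
    · simp [hcj, show j ≠ j₀ from fun heq => hj₀ (heq ▸ hcj)]
    have hiff : a j * u = ‖a j₀‖ ↔ j = j₀ := by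
      rw [show (‖a j₀‖ : ℂ) = u * a j₀ from hau, mul_comm u, mul_left_inj' hu0, ha.eq_iff]
    have hle : ‖a j * u‖ ≤ ‖a j₀‖ := by
      rw [norm_mul, hu, mul_one]
      exact hmax j hcj
    have hlim := (tendsto_exp_mul_add_mul_inv_sub (b j) hle).const_mul (c j)
    simp only [hiff, mul_ite, mul_one, mul_zero] at hlim
    convert hlim using 3 with heq
    rw [heq]
  have hsum := tendsto_finsetSum Finset.univ fun j _ => hterm j
  rw [Finset.sum_ite_eq' Finset.univ j₀ (fun _ => c j₀), if_pos (Finset.mem_univ _)] at hsum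
  refine hj₀ (tendsto_nhds_unique hsum (tendsto_const_nhds.congr' ?_))
  filter_upwards [eventually_gt_atTop 0] with t ht
  simp only [Complex.exp_sub, ← mul_div_assoc, ← Finset.sum_div]
  rw [h _ (mul_ne_zero (by exact_mod_cast ht.ne') hu0), zero_div]

-- On the unit circle `conj z = z⁻¹`, so the sum extends analytically to the punctured plane.
theorem eq_zero_of_infinite_unitCircle_zeros {p : N → ℂ} (hp : Function.Injective p) {c : N → ℂ}
    (h : {z : ℂ | ‖z‖ = 1 ∧ ∑ j, c j * Complex.exp (Complex.I * (⟪p j, z⟫_ℝ : ℝ)) = 0}.Infinite) :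
    c = 0 := by
  set a : N → ℂ := fun j => Complex.I / 2 * conj (p j)
  set b : N → ℂ := fun j => Complex.I / 2 * p j
  have ha : Function.Injective a := fun i j hij =>
    hp ((starRingEnd ℂ).injective (mul_left_cancel₀ (by simp) hij))
  set f : ℂ → ℂ := fun z => ∑ j, c j * Complex.exp (a j * z + b j * z⁻¹)
  have hfz (z : ℂ) (hz : ‖z‖ = 1) :
      f z = ∑ j, c j * Complex.exp (Complex.I * (⟪p j, z⟫_ℝ : ℝ)) := by
    refine Finset.sum_congr rfl fun j _ => ?_
    rw [RCLike.inv_eq_conj hz, Complex.inner, Complex.re_eq_add_conj, map_mul, Complex.conj_conj]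
    simp only [a, b]
    ring_nf
  obtain ⟨z₀, hz₀, hacc⟩ := h.exists_accPt_of_subset_isCompact (isCompact_sphere (0 : ℂ) 1)
    fun z hz => mem_sphere_zero_iff_norm.2 hz.1
  have hf : AnalyticOnNhd ℂ f {0}ᶜ := by
    refine DifferentiableOn.analyticOnNhd (fun z hz => ?_) isOpen_compl_singleton
    have hz' : z ≠ 0 := hz
    refine DifferentiableAt.differentiableWithinAt ?_
    simp only [f]
    fun_prop (disch := assumption)
  have hconn : IsPreconnected ({0}ᶜ : Set ℂ) :=
    (isConnected_compl_singleton_of_one_lt_rank (by simp) 0).isPreconnected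
  have hfreq := (accPt_iff_frequently_nhdsNE.1 hacc).mono fun z hz => (hfz z hz.1).trans hz.2
  have hzero := hf.eqOn_zero_of_preconnected_of_frequently_eq_zero hconn
    (ne_zero_of_mem_unit_sphere ⟨z₀, hz₀⟩) hfreq
  exact eq_zero_of_sum_exp_eq_zero ha b fun z hz => hzero hz

theorem eq_zero_of_infinite_sphere_zeros {p : N → Plane} (hp : Function.Injective p) {c : N → ℂ}
    {x₀ : Plane} {r : ℝ} (h : ({x | ∑ j, c j * Complex.exp (Complex.I * (⟪p j, x⟫_ℝ : ℝ)) = 0} ∩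
      Metric.sphere x₀ r).Infinite) : c = 0 := by
  set φ : Plane ≃ₗᵢ[ℝ] ℂ := Complex.orthonormalBasisOneI.repr.symm
  have hr : 0 < r := by
    by_contra! hr
    exact h ((Set.finite_singleton x₀).subset fun x hx => dist_le_zero.1 (hx.2.le.trans hr))
  have hg : Function.Injective fun x => r⁻¹ • φ (x - x₀) := fun x y hxy =>
    sub_left_injective (φ.injective (smul_right_injective ℂ (inv_ne_zero hr.ne') hxy))
  have hphase (j : N) (x : Plane) : (⟪p j, x⟫_ℝ : ℝ) =
      ⟪p j, x₀⟫_ℝ + ⟪r • φ (p j), r⁻¹ • φ (x - x₀)⟫_ℝ := by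
    rw [real_inner_smul_left, real_inner_smul_right, mul_inv_cancel_left₀ hr.ne',
      φ.inner_map_map, inner_sub_right, add_sub_cancel]
  set c' : N → ℂ := fun j => c j * Complex.exp (Complex.I * (⟪p j, x₀⟫_ℝ : ℝ))
  have hc' : c' = 0 := by
    refine eq_zero_of_infinite_unitCircle_zeros (p := fun j => r • φ (p j))
      (fun i j hij => hp (φ.injective (smul_right_injective ℂ hr.ne' hij)))
      ((h.image hg.injOn).mono ?_)
    rintro _ ⟨x, ⟨hx, hxr⟩, rfl⟩
    refine ⟨?_, ?_⟩
    · simp only [norm_smul, norm_inv, Real.norm_of_nonneg hr.le, φ.norm_map,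
        mem_sphere_iff_norm.1 hxr, inv_mul_cancel₀ hr.ne']
    · refine Eq.trans (Finset.sum_congr rfl fun j _ => ?_) hx
      rw [hphase j x, Complex.ofReal_add, mul_add, Complex.exp_add, mul_assoc]
  funext j
  exact (mul_eq_zero.1 (congrFun hc' j)).resolve_right (Complex.exp_ne_zero _)

end TrigonometricPolynomials

/-! ### Square-integrable functions -/

section L2

variable {X E : Type*} [MeasurableSpace X] {μ : Measure X} [NormedAddCommGroup E]

theorem integrable_norm_mul (f g : Lp E 2 μ) : Integrable (fun x => ‖f x‖ * ‖g x‖) μ :=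
  (Lp.memLp f).norm.integrable_mul (Lp.memLp g).norm

theorem integrable_norm_sq (f : Lp E 2 μ) : Integrable (fun x => ‖f x‖ ^ 2) μ :=
  (memLp_two_iff_integrable_sq_norm (Lp.aestronglyMeasurable f)).1 (Lp.memLp f)

theorem norm_toLp_norm (f : Lp E 2 μ) : ‖(Lp.memLp f).norm.toLp‖ = ‖f‖ := by
  rw [Lp.norm_toLp, eLpNorm_norm, Lp.norm_def]

theorem inner_toLp_norm (f g : Lp E 2 μ) :
    ⟪(Lp.memLp f).norm.toLp, (Lp.memLp g).norm.toLp⟫_ℝ = ∫ x, ‖f x‖ * ‖g x‖ ∂μ := by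
  rw [L2.inner_def]
  refine integral_congr_ae ?_
  filter_upwards [(Lp.memLp f).norm.coeFn_toLp, (Lp.memLp g).norm.coeFn_toLp] with x hf hg
  rw [hf, hg, RCLike.inner_apply, conj_trivial, mul_comm]

theorem norm_sq_eq_integral (f : Lp E 2 μ) : ‖f‖ ^ 2 = ∫ x, ‖f x‖ ^ 2 ∂μ := by
  rw [← norm_toLp_norm f, ← real_inner_self_eq_norm_sq, inner_toLp_norm]
  simp only [sq]

theorem integral_norm_mul_le (f g : Lp E 2 μ) : ∫ x, ‖f x‖ * ‖g x‖ ∂μ ≤ ‖f‖ * ‖g‖ := by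
  rw [← inner_toLp_norm, ← norm_toLp_norm f, ← norm_toLp_norm g]
  exact real_inner_le_norm _ _

theorem tendsto_zero_of_dominated {f : ℕ → Lp E 2 μ} (g : X → ℝ) (hg : Integrable g μ)
    (hfg : ∀ n, ∀ᵐ x ∂μ, ‖f n x‖ ^ 2 ≤ g x)
    (hlim : ∀ᵐ x ∂μ, Tendsto (fun n => f n x) atTop (𝓝 0)) : Tendsto f atTop (𝓝 0) := by
  have hsq : Tendsto (fun n => ‖f n‖ ^ 2) atTop (𝓝 0) := by
    simp only [norm_sq_eq_integral]
    rw [← integral_zero X ℝ (μ := μ)]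
    refine tendsto_integral_of_dominated_convergence g
      (fun n => (Lp.aestronglyMeasurable (f n)).norm.pow 2) hg (fun n => ?_) ?_
    · filter_upwards [hfg n] with x hx
      rwa [Real.norm_of_nonneg (sq_nonneg _)]
    · filter_upwards [hlim] with x hx
      simpa using hx.norm.pow 2
  rw [tendsto_zero_iff_norm_tendsto_zero]
  simpa [Real.sqrt_sq] using hsq.sqrt

variable [NormedSpace ℂ E]

/-- The operator of multiplication by an essentially bounded function. -/
def mulOp {b : X → ℂ} (hb : MemLp b ∞ μ) : Lp E 2 μ →L[ℂ] Lp E 2 μ :=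
  (ContinuousLinearMap.lsmul ℂ ℂ).holderL μ ∞ 2 2 hb.toLp

theorem coeFn_mulOp {b : X → ℂ} (hb : MemLp b ∞ μ) (w : Lp E 2 μ) :
    mulOp hb w =ᵐ[μ] fun x => b x • w x := by
  filter_upwards [(ContinuousLinearMap.lsmul ℂ ℂ).coeFn_holder (r := 2) hb.toLp w,
    hb.coeFn_toLp] with x hx hbx
  exact hx.trans (by rw [hbx]; rfl)

end L2

/-! ### The Sobolev space in the Fourier representation -/

theorem H1_snd (F : H1) : (F.1.2 : Plane → C2) =ᵐ[volume]
    fun ξ => ((2 * Real.pi * ‖ξ‖ : ℝ) : ℂ) • hat F ξ := F.2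

theorem H1_ext {F G : H1} (h : hat F = hat G) : F = G := by
  have hfst : F.1.1 = G.1.1 := (Lp.fourierTransformₗᵢ Plane C2).injective h
  refine Subtype.ext (Prod.ext hfst (Lp.ext ?_))
  filter_upwards [H1_snd F, H1_snd G] with ξ hF hG
  rw [hF, hG, h]

theorem hat_sub (F G : H1) : hat (F - G) = hat F - hat G :=
  (Lp.fourierTransformₗᵢ Plane C2).map_sub F.1.1 G.1.1

theorem hat_schwartzToH1 (φ : 𝓢(Plane, C2)) : hat (schwartzToH1 φ) = (𝓕 φ).toLp 2 volume :=
  SchwartzMap.toLp_fourier_eq φ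

theorem norm_fst_eq (F : H1) : ‖F.1.1‖ = ‖hat F‖ :=
  ((Lp.fourierTransformₗᵢ Plane C2).norm_map F.1.1).symm

theorem inner_fst_eq (F G : H1) : ⟪F.1.1, G.1.1⟫_ℂ = ⟪hat F, hat G⟫_ℂ :=
  ((Lp.fourierTransformₗᵢ Plane C2).inner_map_map F.1.1 G.1.1).symm

theorem norm_H1_le (F : H1) : ‖F‖ ≤ ‖hat F‖ + ‖F.1.2‖ := by
  change ‖F.1‖ ≤ _
  rw [Prod.norm_def, norm_fst_eq]
  exact max_le (le_add_of_nonneg_right (norm_nonneg _)) (le_add_of_nonneg_left (norm_nonneg _))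

theorem norm_H1_le_of_support {F : H1} {R : ℝ} (hF : ∀ᵐ ξ, R < ‖ξ‖ → hat F ξ = 0) :
    ‖F‖ ≤ (1 + 2 * Real.pi * R) * ‖hat F‖ := by
  have hsnd : ‖F.1.2‖ ≤ (2 * Real.pi * R) * ‖hat F‖ := by
    refine Lp.norm_le_mul_norm_of_ae_le_mul ?_
    filter_upwards [H1_snd F, hF] with ξ h1 h2
    rw [h1, norm_smul, Complex.norm_real, Real.norm_of_nonneg (by positivity)]
    rcases lt_or_ge R ‖ξ‖ with h | h
    · simp [h2 h]
    · gcongr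
  linarith [norm_H1_le F]

/-- The weight `1 / (1 + 2π|ξ|)` that turns square-integrable spinors into Fourier transforms of
elements of the Sobolev space. -/
def weightInv (ξ : Plane) : ℝ := (1 + 2 * Real.pi * ‖ξ‖)⁻¹

theorem weightInv_pos (ξ : Plane) : 0 < weightInv ξ := by
  unfold weightInv; positivity

theorem memLp_weightInv : MemLp (fun ξ => (weightInv ξ : ℂ)) ∞ volume := by
  have hmeas : Measurable fun ξ => (weightInv ξ : ℂ) := by unfold weightInv; fun_prop
  refine memLp_top_of_bound hmeas.aestronglyMeasurable 1 (Eventually.of_forall fun ξ => ?_)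
  rw [Complex.norm_real, Real.norm_of_nonneg (weightInv_pos ξ).le]
  exact inv_le_one_of_one_le₀ (le_add_of_nonneg_right (by positivity))

theorem memLp_weight_mul_weightInv :
    MemLp (fun ξ => ((2 * Real.pi * ‖ξ‖ * weightInv ξ : ℝ) : ℂ)) ∞ volume := by
  have hmeas : Measurable fun ξ => ((2 * Real.pi * ‖ξ‖ * weightInv ξ : ℝ) : ℂ) := by
    unfold weightInv; fun_prop
  refine memLp_top_of_bound hmeas.aestronglyMeasurable 1 (Eventually.of_forall fun ξ => ?_)
  rw [Complex.norm_real, weightInv, ← div_eq_mul_inv, Real.norm_of_nonneg (by positivity),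
    div_le_one (by positivity)]
  linarith

/-- The operator of multiplication by `weightInv`. -/
def divWeight : Spinors →L[ℂ] Spinors := mulOp memLp_weightInv

/-- The operator of multiplication by `2π|ξ| / (1 + 2π|ξ|)`. -/
def gradWeight : Spinors →L[ℂ] Spinors := mulOp memLp_weight_mul_weightInv

theorem coeFn_divWeight (w : Spinors) : divWeight w =ᵐ[volume] fun ξ => (weightInv ξ : ℂ) • w ξ :=
  coeFn_mulOp _ _

theorem coeFn_gradWeight (w : Spinors) : gradWeight w =ᵐ[volume]
    fun ξ => ((2 * Real.pi * ‖ξ‖ * weightInv ξ : ℝ) : ℂ) • w ξ :=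
  coeFn_mulOp _ _

/-- The inverse Fourier transform on the square-integrable spinors. -/
def fourierInvCLM : Spinors →L[ℂ] Spinors :=
  (Lp.fourierTransformₗᵢ Plane C2).symm.toContinuousLinearEquiv

theorem fourier_fourierInvCLM (w : Spinors) : (𝓕 (fourierInvCLM w) : Spinors) = w :=
  (Lp.fourierTransformₗᵢ Plane C2).apply_symm_apply w

/-- The parametrization of the Sobolev space by the square-integrable spinors: `lift w` is the
element with Fourier transform `w / (1 + 2π|ξ|)`. -/
def lift : Spinors →L[ℂ] H1 :=
  ((fourierInvCLM.comp divWeight).prod gradWeight).codRestrict H1 fun w => by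
    change (gradWeight w : Plane → C2) =ᵐ[volume] fun ξ =>
      ((2 * Real.pi * ‖ξ‖ : ℝ) : ℂ) • (𝓕 (fourierInvCLM (divWeight w)) : Spinors) ξ
    rw [fourier_fourierInvCLM]
    filter_upwards [coeFn_divWeight w, coeFn_gradWeight w] with ξ hdiv hgrad
    rw [hdiv, hgrad, smul_smul, ← Complex.ofReal_mul]

theorem hat_lift (w : Spinors) : hat (lift w) = divWeight w := fourier_fourierInvCLM _

theorem lift_hat_add_snd (F : H1) : lift (hat F + F.1.2) = F := by
  refine H1_ext (Lp.ext ?_)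
  rw [hat_lift]
  filter_upwards [coeFn_divWeight (hat F + F.1.2), H1_snd F, Lp.coeFn_add (hat F) F.1.2]
    with ξ hdiv hsnd hadd
  rw [hdiv, hadd, Pi.add_apply, hsnd, ← one_smul ℂ (hat F ξ), smul_smul, ← add_smul, smul_smul,
    mul_one, ← Complex.ofReal_one, ← Complex.ofReal_add, ← Complex.ofReal_mul, weightInv,
    inv_mul_cancel₀ (by positivity)]

theorem lift_surjective : Function.Surjective lift := fun F => ⟨_, lift_hat_add_snd F⟩

theorem lift_fst_injective : Function.Injective fun w : Spinors => (lift w).1.1 := by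
  intro v w h
  have hdiv : divWeight v = divWeight w := by
    rw [← hat_lift, ← hat_lift]
    exact congrArg (fun f : Spinors => (𝓕 f : Spinors)) h
  apply Lp.ext
  filter_upwards [coeFn_divWeight v, coeFn_divWeight w] with ξ hv hw
  rw [hdiv, hw] at hv
  exact (smul_right_injective C2 (by exact_mod_cast (weightInv_pos ξ).ne') hv).symm

theorem lift_injective : Function.Injective lift := fun _ _ h =>
  lift_fst_injective (congrArg (fun F : H1 => F.1.1) h)

theorem hat_lift_add_snd (w : Spinors) : hat (lift w) + (lift w).1.2 = w :=
  lift_injective (lift_hat_add_snd (lift w))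

/-! ### Frequency cut-offs and the density of the Schwartz spinors -/

theorem memLp_indicator_closedBall (R : ℝ) :
    MemLp ((Metric.closedBall (0 : Plane) R).indicator (1 : Plane → ℂ)) ∞ volume := by
  refine memLp_top_of_bound
    (measurable_one.indicator measurableSet_closedBall).aestronglyMeasurable 1
    (Eventually.of_forall fun ξ => ?_)
  exact (norm_indicator_le_norm_self _ _).trans (by simp)

/-- The projection onto the frequencies in a ball. -/
def cutoff (R : ℝ) : Spinors →L[ℂ] Spinors := mulOp (memLp_indicator_closedBall R)

theorem coeFn_cutoff (R : ℝ) (w : Spinors) :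
    cutoff R w =ᵐ[volume] (Metric.closedBall 0 R).indicator w := by
  filter_upwards [coeFn_mulOp (memLp_indicator_closedBall R) w] with ξ hξ
  refine hξ.trans ?_
  by_cases h : ξ ∈ Metric.closedBall (0 : Plane) R <;> simp [h]

theorem hat_lift_cutoff (R : ℝ) (w : Spinors) :
    hat (lift (cutoff R w)) =ᵐ[volume] (Metric.closedBall 0 R).indicator (hat (lift w)) := by
  rw [hat_lift, hat_lift]
  filter_upwards [coeFn_divWeight (cutoff R w), coeFn_divWeight w, coeFn_cutoff R w]
    with ξ hcut hw hind
  rw [hcut, hind]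
  by_cases h : ξ ∈ Metric.closedBall (0 : Plane) R
  · rw [Set.indicator_of_mem h, Set.indicator_of_mem h, hw]
  · rw [Set.indicator_of_notMem h, Set.indicator_of_notMem h, smul_zero]

theorem hat_lift_cutoff_support (R : ℝ) (w : Spinors) :
    ∀ᵐ ξ, R < ‖ξ‖ → hat (lift (cutoff R w)) ξ = 0 := by
  filter_upwards [hat_lift_cutoff R w] with ξ hξ hR
  rw [hξ, Set.indicator_of_notMem (by simpa using hR)]

theorem tendsto_cutoff (w : Spinors) : Tendsto (fun n : ℕ => cutoff n w) atTop (𝓝 w) := by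
  have hcoe : ∀ n : ℕ, (cutoff n w - w : Spinors) =ᵐ[volume]
      fun ξ => (Metric.closedBall 0 n).indicator w ξ - w ξ := fun n => by
    filter_upwards [Lp.coeFn_sub (cutoff n w) w, coeFn_cutoff n w] with ξ hsub hcut
    rw [hsub, Pi.sub_apply, hcut]
  rw [← tendsto_sub_nhds_zero_iff]
  refine tendsto_zero_of_dominated _ (integrable_norm_sq w) (fun n => ?_) ?_
  · filter_upwards [hcoe n] with ξ hξ
    rw [hξ]
    by_cases h : ξ ∈ Metric.closedBall (0 : Plane) n <;> simp [h]
  · filter_upwards [ae_all_iff.2 hcoe] with ξ hξ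
    refine tendsto_const_nhds.congr' ?_
    filter_upwards [eventually_ge_atTop ⌈‖ξ‖⌉₊] with n hn
    rw [hξ, Set.indicator_of_mem (by simpa using Nat.ceil_le.1 hn), sub_self]

theorem norm_smul_bump_sub_le {R : ℝ} {η : ContDiffBump (0 : Plane)} (hη : η.rIn = R) {ξ : Plane}
    {u v : C2} (hv : R < ‖ξ‖ → v = 0) : ‖η ξ • u - v‖ ≤ ‖u - v‖ := by
  rcases lt_or_ge R ‖ξ‖ with h | h
  · rw [hv h, sub_zero, sub_zero, norm_smul, Real.norm_of_nonneg η.nonneg]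
    exact mul_le_of_le_one_left (norm_nonneg _) η.le_one
  · rw [η.one_of_mem_closedBall (by simpa [hη] using h), one_smul]

theorem exists_schwartz_tendsto {F : H1} {R : ℝ} (hR : 0 < R)
    (hF : ∀ᵐ ξ, R < ‖ξ‖ → hat F ξ = 0) :
    ∃ φ : ℕ → 𝓢(Plane, C2), (∀ n ξ, 2 * R < ‖ξ‖ → 𝓕 (φ n) ξ = 0) ∧
      Tendsto (fun n => schwartzToH1 (φ n)) atTop (𝓝 F) := by
  have hdense : DenseRange (SchwartzMap.toLpCLM ℝ C2 2 (volume : Measure Plane)) :=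
    SchwartzMap.denseRange_toLpCLM ENNReal.ofNat_ne_top
  obtain ⟨s, hs, hlim⟩ := mem_closure_iff_seq_limit.1 (hdense (hat F))
  choose ψ hψ using hs
  let η : ContDiffBump (0 : Plane) := ⟨R, 2 * R, hR, by linarith⟩
  have hη : Function.HasTemperateGrowth (fun ξ : Plane => η ξ) :=
    η.hasCompactSupport.hasTemperateGrowth η.contDiff
  let χ : ℕ → 𝓢(Plane, C2) := fun n => smulLeftCLM C2 (fun ξ => η ξ) (ψ n)
  have hχ : ∀ n ξ, χ n ξ = η ξ • ψ n ξ := fun n ξ => smulLeftCLM_apply_apply hη (ψ n) ξ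
  have hsupp : ∀ n ξ, 2 * R < ‖ξ‖ → χ n ξ = 0 := by
    intro n ξ h
    rw [hχ, η.zero_of_le_dist (by rw [dist_zero_right]; exact h.le), zero_smul]
  have hfour : ∀ n, 𝓕 (𝓕⁻ (χ n)) = χ n := fun n => FourierTransform.fourier_fourierInv_eq (χ n)
  refine ⟨fun n => 𝓕⁻ (χ n), fun n ξ h => by rw [hfour]; exact hsupp n ξ h, ?_⟩
  rw [tendsto_iff_norm_sub_tendsto_zero]
  have hz := (tendsto_iff_norm_sub_tendsto_zero.1 hlim).const_mul (1 + 2 * Real.pi * (2 * R))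
  rw [mul_zero] at hz
  refine squeeze_zero (fun n => norm_nonneg _) (fun n => ?_) hz
  have hcoe : hat (schwartzToH1 (𝓕⁻ (χ n)) - F) =ᵐ[volume] fun ξ => χ n ξ - hat F ξ := by
    rw [hat_sub, hat_schwartzToH1, hfour]
    filter_upwards [Lp.coeFn_sub ((χ n).toLp 2 volume) (hat F), (χ n).coeFn_toLp 2 volume]
      with ξ h1 h2
    rw [h1, Pi.sub_apply, h2]
  refine (norm_H1_le_of_support (R := 2 * R) ?_).trans
    (mul_le_mul_of_nonneg_left (Lp.norm_le_norm_of_ae_le ?_) (by positivity))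
  · filter_upwards [hcoe, hF] with ξ h1 h2 h3
    rw [h1, hsupp n ξ h3, h2 (by linarith), sub_zero]
  · filter_upwards [hcoe, hF, Lp.coeFn_sub (s n) (hat F), (ψ n).coeFn_toLp 2 volume]
      with ξ h1 h2 h3 h4
    have h5 : s n ξ = ψ n ξ := by rw [← hψ n]; exact h4
    rw [h1, h3, Pi.sub_apply, h5, hχ]
    exact norm_smul_bump_sub_le rfl h2

theorem denseRange_schwartzToH1 : DenseRange schwartzToH1 := by
  intro F
  obtain ⟨w, rfl⟩ := lift_surjective F
  have hmem : ∀ n : ℕ, lift (cutoff (n + 1 : ℕ) w) ∈ closure (Set.range schwartzToH1) := by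
    intro n
    obtain ⟨φ, -, hφ⟩ := exists_schwartz_tendsto (R := (n + 1 : ℕ)) (by positivity)
      (hat_lift_cutoff_support _ w)
    exact mem_closure_of_tendsto hφ (Eventually.of_forall fun k => ⟨φ k, rfl⟩)
  have hlim : Tendsto (fun n : ℕ => lift (cutoff (n + 1 : ℕ) w)) atTop (𝓝 (lift w)) :=
    (lift.continuous.tendsto w).comp ((tendsto_cutoff w).comp (tendsto_add_atTop_nat 1))
  exact isClosed_closure.mem_of_tendsto hlim (Eventually.of_forall hmem)

/-! ### The trace bound -/

theorem norm_sq_C2 (v : C2) : ‖v‖ ^ 2 = ‖v 0‖ ^ 2 + ‖v 1‖ ^ 2 := by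
  rw [EuclideanSpace.norm_sq_eq, Fin.sum_univ_two]

/-- The partial derivative of a Schwartz function in the direction of a coordinate axis. -/
abbrev partialDeriv {E : Type*} [NormedAddCommGroup E] [NormedSpace ℝ E] (k : Fin 2)
    (φ : 𝓢(Plane, E)) : 𝓢(Plane, E) :=
  ∂_{(EuclideanSpace.single k (1 : ℝ) : Plane)} φ

/-- A component of a Schwartz spinor. -/
def component (i : Fin 2) (φ : 𝓢(Plane, C2)) : 𝓢(Plane, ℂ) :=
  φ.postcompCLM (EuclideanSpace.proj (𝕜 := ℂ) i)

theorem component_apply (i : Fin 2) (φ : 𝓢(Plane, C2)) (x : Plane) : component i φ x = φ x i := rfl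

theorem partialDeriv_component (i k : Fin 2) (φ : 𝓢(Plane, C2)) :
    partialDeriv k (component i φ) = component i (partialDeriv k φ) := by
  ext x
  have h : HasFDerivAt (component i φ) (((EuclideanSpace.proj (𝕜 := ℂ) i :
      C2 →L[ℂ] ℂ).restrictScalars ℝ).comp (fderiv ℝ φ x)) x :=
    ((EuclideanSpace.proj (𝕜 := ℂ) i : C2 →L[ℂ] ℂ).restrictScalars ℝ).hasFDerivAt.comp x
      φ.differentiableAt.hasFDerivAt
  rw [component_apply, SchwartzMap.lineDerivOp_apply_eq_fderiv,
    SchwartzMap.lineDerivOp_apply_eq_fderiv, h.fderiv]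
  rfl

section

variable {E : Type*} [NormedAddCommGroup E] [NormedSpace ℝ E]
  (μ : Measure Plane) [μ.HasTemperateGrowth]

theorem integrable_norm_sq_schwartz (φ : 𝓢(Plane, E)) : Integrable (fun x => ‖φ x‖ ^ 2) μ :=
  (memLp_two_iff_integrable_sq_norm φ.continuous.aestronglyMeasurable).1 (φ.memLp 2 μ)

theorem norm_toLp_sq (φ : 𝓢(Plane, E)) : ‖φ.toLp 2 μ‖ ^ 2 = ∫ x, ‖φ x‖ ^ 2 ∂μ := by
  rw [norm_sq_eq_integral]
  refine integral_congr_ae ?_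
  filter_upwards [φ.coeFn_toLp 2 μ] with x hx
  rw [hx]

theorem integral_norm_sq_eq_sum_component (φ : 𝓢(Plane, C2)) :
    ∫ x, ‖φ x‖ ^ 2 ∂μ = ∑ i, ∫ x, ‖component i φ x‖ ^ 2 ∂μ := by
  rw [← integral_finsetSum _ fun i _ => integrable_norm_sq_schwartz μ (component i φ)]
  simp only [EuclideanSpace.norm_sq_eq, component_apply]

end

theorem integral_norm_sq_partialDeriv (φ : 𝓢(Plane, C2)) (k : Fin 2) :
    ∫ x, ‖partialDeriv k φ x‖ ^ 2 = ∫ ξ : Plane, (2 * Real.pi * ξ k) ^ 2 * ‖𝓕 φ ξ‖ ^ 2 := by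
  rw [← SchwartzMap.integral_norm_sq_fourier, SchwartzMap.fourier_lineDerivOp_eq]
  have hg : Function.HasTemperateGrowth
      (fun ξ : Plane => (inner ℝ ξ (EuclideanSpace.single k (1 : ℝ)) : ℝ)) :=
    ((innerSL ℝ).flip (EuclideanSpace.single k (1 : ℝ) : Plane)).hasTemperateGrowth
  refine integral_congr_ae (Eventually.of_forall fun ξ => ?_)
  have hinner : (inner ℝ ξ (EuclideanSpace.single k (1 : ℝ)) : ℝ) = ξ k := by
    simp [EuclideanSpace.inner_single_right]
  simp only [smul_apply, smulLeftCLM_apply_apply hg, norm_smul, mul_pow, hinner]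
  simp [abs_of_pos Real.pi_pos]
  ring

theorem sum_integral_norm_sq_partialDeriv (φ : 𝓢(Plane, C2)) :
    ∑ k, ∫ x, ‖partialDeriv k φ x‖ ^ 2 = ‖(schwartzToH1 φ).1.2‖ ^ 2 := by
  have hint (k : Fin 2) : Integrable fun ξ : Plane => (2 * Real.pi * ξ k) ^ 2 * ‖𝓕 φ ξ‖ ^ 2 := by
    refine Integrable.mono' ((memLp_two_iff_integrable_sq_norm
      (memLp_norm_smul (𝓕 φ)).1).1 (memLp_norm_smul (𝓕 φ)))
      (Continuous.aestronglyMeasurable (by fun_prop)) (Eventually.of_forall fun ξ => ?_)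
    have hcoord : |ξ k| ≤ ‖ξ‖ := PiLp.norm_apply_le ξ k
    rw [Real.norm_of_nonneg (by positivity), norm_smul, Complex.norm_real,
      Real.norm_of_nonneg (by positivity), mul_pow (2 * Real.pi * ‖ξ‖), mul_pow _ ‖ξ‖,
      mul_pow _ (ξ k), ← sq_abs (ξ k)]
    gcongr
  simp only [integral_norm_sq_partialDeriv]
  rw [norm_sq_eq_integral, ← integral_finsetSum _ fun k _ => hint k]
  refine integral_congr_ae ?_
  filter_upwards [H1_snd (schwartzToH1 φ), (𝓕 φ).coeFn_toLp 2 volume] with ξ hsnd hcoe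
  rw [hsnd, hat_schwartzToH1, hcoe, norm_smul, Complex.norm_real,
    Real.norm_of_nonneg (by positivity), ← Finset.sum_mul, mul_pow, mul_pow,
    EuclideanSpace.norm_sq_eq ξ, Finset.mul_sum]
  simp only [mul_pow, Real.norm_eq_abs, sq_abs]

namespace System

variable (D : System)

theorem exists_integral_norm_sq_le : ∃ b : ℝ, 0 < b ∧ ∀ f : 𝓢(Plane, ℂ),
    ∫ x, ‖f x‖ ^ 2 ∂D.m ≤ (∑ k, ∫ x, ‖partialDeriv k f x‖ ^ 2) + b * ∫ x, ‖f x‖ ^ 2 := by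
  obtain ⟨a, -, ha1, b, hb, hab⟩ := D.formBound
  obtain ⟨C, hC⟩ := D.bounded_h
  refine ⟨b, hb, fun f => ?_⟩
  have hsq := integrable_norm_sq_schwartz D.m f
  have hweight : ∫ x, ‖f x‖ ^ 2 ∂D.m ≤ ∫ x, (1 + |D.h x| ^ 2) * ‖f x‖ ^ 2 ∂D.m := by
    refine integral_mono hsq (hsq.bdd_mul (c := 1 + C ^ 2) ?_ (Eventually.of_forall fun x => ?_))
      fun x => le_mul_of_one_le_left (sq_nonneg _) (le_add_of_nonneg_right (sq_nonneg _))
    · have := D.measurable_h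
      exact (by fun_prop : Measurable fun x => 1 + |D.h x| ^ 2).aestronglyMeasurable
    · rw [Real.norm_of_nonneg (by positivity)]
      have := hC x
      gcongr
  have hgrad : ∫ x, ∑ k : Fin 2, ‖fderiv ℝ f x (EuclideanSpace.single k 1)‖ ^ 2 =
      ∑ k, ∫ x, ‖partialDeriv k f x‖ ^ 2 :=
    integral_finsetSum _ fun k _ => integrable_norm_sq_schwartz volume (partialDeriv k f)
  have hgrad0 : 0 ≤ ∑ k, ∫ x, ‖partialDeriv k f x‖ ^ 2 :=
    Finset.sum_nonneg fun k _ => integral_nonneg fun x => sq_nonneg _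
  have hf := hab f
  rw [hgrad] at hf
  nlinarith

theorem exists_norm_sq_toLp_le : ∃ b : ℝ, 0 < b ∧ ∀ φ : 𝓢(Plane, C2),
    ‖φ.toLp 2 D.m‖ ^ 2 ≤ ‖(schwartzToH1 φ).1.2‖ ^ 2 + b * ‖φ.toLp 2 volume‖ ^ 2 := by
  obtain ⟨b, hb, hle⟩ := D.exists_integral_norm_sq_le
  refine ⟨b, hb, fun φ => ?_⟩
  simp only [norm_toLp_sq, ← sum_integral_norm_sq_partialDeriv, integral_norm_sq_eq_sum_component]
  rw [Finset.sum_comm, Finset.mul_sum, ← Finset.sum_add_distrib]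
  simp only [← partialDeriv_component]
  exact Finset.sum_le_sum fun i _ => hle (component i φ)

theorem exists_trace_bound : ∃ C : ℝ, ∀ φ : 𝓢(Plane, C2),
    ‖(SchwartzMap.toLpCLM ℂ C2 2 D.m : 𝓢(Plane, C2) →L[ℂ] Lp C2 2 D.m) φ‖ ≤
      C * ‖schwartzToH1 φ‖ := by
  obtain ⟨b, hb, hle⟩ := D.exists_norm_sq_toLp_le
  refine ⟨Real.sqrt (1 + b), fun φ => le_of_sq_le_sq ?_ (by positivity)⟩
  have hsnd : ‖(schwartzToH1 φ).1.2‖ ≤ ‖schwartzToH1 φ‖ := le_max_right _ _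
  have hfst : ‖φ.toLp 2 volume‖ ≤ ‖schwartzToH1 φ‖ := le_max_left _ _
  calc ‖φ.toLp 2 D.m‖ ^ 2
    _ ≤ ‖(schwartzToH1 φ).1.2‖ ^ 2 + b * ‖φ.toLp 2 volume‖ ^ 2 := hle φ
    _ ≤ ‖schwartzToH1 φ‖ ^ 2 + b * ‖schwartzToH1 φ‖ ^ 2 := by gcongr
    _ = (Real.sqrt (1 + b) * ‖schwartzToH1 φ‖) ^ 2 := by
      rw [mul_pow, Real.sq_sqrt (by positivity), add_mul, one_mul]

theorem trace_schwartz (φ : 𝓢(Plane, C2)) : D.trace (schwartzToH1 φ) = φ.toLp 2 D.m :=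
  LinearMap.extendOfNorm_eq denseRange_schwartzToH1 D.exists_trace_bound φ

end System

/-! ### Band-limited spinors and plane waves -/

/-- A plane wave, as a function of the frequency `ξ`. -/
def wave (x ξ : Plane) : ℂ := Complex.exp (((2 * Real.pi * (inner ℝ ξ x : ℝ) : ℝ) : ℂ) * Complex.I)

theorem norm_wave (x ξ : Plane) : ‖wave x ξ‖ = 1 := Complex.norm_exp_ofReal_mul_I _

theorem continuous_wave (x : Plane) : Continuous (wave x) := by
  unfold wave; fun_prop

theorem memLp_planeWave (R : ℝ) (x : Plane) (i : Fin 2) :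
    MemLp ((Metric.closedBall (0 : Plane) R).indicator
      fun ξ => conj (wave x ξ) • (EuclideanSpace.single i 1 : C2)) 2 volume := by
  rw [memLp_indicator_iff_restrict measurableSet_closedBall]
  have : IsFiniteMeasure (volume.restrict (Metric.closedBall (0 : Plane) R)) :=
    isFiniteMeasure_restrict.2 measure_closedBall_lt_top.ne
  have := continuous_wave x
  refine MemLp.of_bound (C := 1) (Continuous.aestronglyMeasurable (by fun_prop))
    (Eventually.of_forall fun ξ => ?_)
  simp [norm_smul, norm_wave]

/-- The plane wave `ξ ↦ exp(-2πi⟨ξ, x⟩) eᵢ` truncated to a ball; it represents the evaluation of the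
`i`-th component at `x` on the spinors with frequencies in the ball. -/
def planeWave (R : ℝ) (x : Plane) (i : Fin 2) : Spinors := (memLp_planeWave R x i).toLp

theorem inner_planeWave (R : ℝ) (x : Plane) (i : Fin 2) (w : Spinors) :
    ⟪planeWave R x i, w⟫_ℂ = ∫ ξ in Metric.closedBall (0 : Plane) R, wave x ξ * w ξ i := by
  rw [L2.inner_def, ← integral_indicator measurableSet_closedBall]
  refine integral_congr_ae ?_
  filter_upwards [(memLp_planeWave R x i).coeFn_toLp] with ξ hcoe
  rw [planeWave, hcoe]
  by_cases hξ : ξ ∈ Metric.closedBall (0 : Plane) R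
  · rw [Set.indicator_of_mem hξ, Set.indicator_of_mem hξ, inner_smul_left,
      EuclideanSpace.inner_single_left]
    simp
  · rw [Set.indicator_of_notMem hξ, Set.indicator_of_notMem hξ, inner_zero_left]

theorem inner_planeWave_of_support {R : ℝ} {w : Spinors} (hw : ∀ᵐ ξ, R < ‖ξ‖ → w ξ = 0)
    (x : Plane) (i : Fin 2) : ⟪planeWave R x i, w⟫_ℂ = ∫ ξ, wave x ξ * w ξ i := by
  rw [inner_planeWave, setIntegral_eq_integral_of_ae_compl_eq_zero]
  filter_upwards [hw] with ξ hsupp hξ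
  simp [hsupp (by simpa using hξ)]

theorem norm_planeWave_le (R : ℝ) (x : Plane) (i : Fin 2) :
    ‖planeWave R x i‖ ≤ Real.sqrt (volume.real (Metric.closedBall (0 : Plane) R)) := by
  apply Real.le_sqrt_of_sq_le
  rw [norm_sq_eq_integral, ← integral_indicator_one measurableSet_closedBall]
  refine le_of_eq (integral_congr_ae ?_)
  filter_upwards [(memLp_planeWave R x i).coeFn_toLp] with ξ hcoe
  rw [planeWave, hcoe]
  by_cases hξ : ξ ∈ Metric.closedBall (0 : Plane) R <;> simp [hξ, norm_smul, norm_wave]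

theorem schwartz_eq_integral_wave (φ : 𝓢(Plane, C2)) (x : Plane) (i : Fin 2) :
    φ x i = ∫ ξ, wave x ξ * 𝓕 φ ξ i := by
  have hinv : φ x = ∫ ξ, wave x ξ • 𝓕 φ ξ := by
    have h : φ = 𝓕⁻ (𝓕 φ) := (FourierTransform.fourierInv_fourier_eq φ).symm
    conv_lhs => rw [h, SchwartzMap.fourierInv_coe, Real.fourierInv_eq']
    rfl
  have hint : Integrable fun ξ => wave x ξ • 𝓕 φ ξ :=
    ((𝓕 φ).integrable (μ := volume)).bdd_smul 1 (continuous_wave x).aestronglyMeasurable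
      (Eventually.of_forall fun ξ => (norm_wave x ξ).le)
  rw [hinv]
  exact ((EuclideanSpace.proj (𝕜 := ℂ) i : C2 →L[ℂ] ℂ).integral_comp_comm hint).symm

theorem schwartz_eq_inner_planeWave {φ : 𝓢(Plane, C2)} {R : ℝ} (hφ : ∀ ξ, R < ‖ξ‖ → 𝓕 φ ξ = 0)
    (x : Plane) (i : Fin 2) : φ x i = ⟪planeWave R x i, hat (schwartzToH1 φ)⟫_ℂ := by
  have hcoe : hat (schwartzToH1 φ) =ᵐ[volume] fun ξ => 𝓕 φ ξ := by
    rw [hat_schwartzToH1]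
    exact (𝓕 φ).coeFn_toLp 2 volume
  rw [inner_planeWave_of_support (hcoe.mono fun ξ h hR => h.trans (hφ ξ hR)),
    schwartz_eq_integral_wave]
  refine integral_congr_ae ?_
  filter_upwards [hcoe] with ξ hξ
  rw [hξ]

theorem continuous_hat : Continuous hat :=
  (Lp.fourierTransformₗᵢ Plane C2).continuous.comp (continuous_fst.comp continuous_subtype_val)

theorem System.trace_eq_integral (D : System) {F : H1} {R : ℝ} (hR : 0 < R)
    (hF : ∀ᵐ ξ, R < ‖ξ‖ → hat F ξ = 0) :
    ∀ᵐ x ∂D.m, ∀ i, D.trace F x i = ∫ ξ, wave x ξ * hat F ξ i := by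
  obtain ⟨φ, hφ, hlim⟩ := exists_schwartz_tendsto hR hF
  have htrace : Tendsto (fun n => (φ n).toLp 2 D.m) atTop (𝓝 (D.trace F)) := by
    simp only [← D.trace_schwartz]
    exact (D.trace.continuous.tendsto F).comp hlim
  have hpoint : ∀ x i, Tendsto (fun n => φ n x i) atTop (𝓝 (∫ ξ, wave x ξ * hat F ξ i)) := by
    intro x i
    rw [← inner_planeWave_of_support (R := 2 * R) (hF.mono fun ξ h h' => h (by linarith))]
    simp only [schwartz_eq_inner_planeWave (hφ _)]
    exact tendsto_const_nhds.inner ((continuous_hat.tendsto F).comp hlim)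
  obtain ⟨ns, hmono, hns⟩ := (tendstoInMeasure_of_tendsto_Lp htrace).exists_seq_tendsto_ae
  filter_upwards [hns, ae_all_iff.2 fun n => (φ (ns n)).coeFn_toLp 2 D.m] with x hx hcoe i
  have hsub : Tendsto (fun n => φ (ns n) x i) atTop (𝓝 (D.trace F x i)) := by
    simp only [← hcoe]
    exact ((EuclideanSpace.proj (𝕜 := ℂ) i : C2 →L[ℂ] ℂ).continuous.tendsto _).comp hx
  exact tendsto_nhds_unique hsub ((hpoint x i).comp hmono.tendsto_atTop)

/-! ### The symbol and the sesquilinear forms -/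

theorem inner_symbol (A : Plane → ℂ) (p : Plane) (u v : C2) :
    ⟪u, WithLp.toLp 2 ((symbol A p).mulVec v.ofLp)⟫_ℂ =
      (((‖p‖ ^ 2 : ℝ) : ℂ) * v 0 + A p * v 1) * conj (u 0) +
      (conj (A p) * v 0 + ((‖p‖ ^ 2 : ℝ) : ℂ) * v 1) * conj (u 1) := by
  rw [EuclideanSpace.inner_eq_star_dotProduct]
  simp [dotProduct, Matrix.mulVec, symbol]

theorem inner_symbol_conj (A : Plane → ℂ) (p : Plane) (u v : C2) :
    conj ⟪u, WithLp.toLp 2 ((symbol A p).mulVec v.ofLp)⟫_ℂ =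
      ⟪v, WithLp.toLp 2 ((symbol A p).mulVec u.ofLp)⟫_ℂ := by
  rw [inner_symbol, inner_symbol]
  simp only [map_add, map_mul, Complex.conj_conj, Complex.conj_ofReal]
  ring

theorem re_inner_symbol_self (A : Plane → ℂ) (p : Plane) (u : C2) :
    (⟪u, WithLp.toLp 2 ((symbol A p).mulVec u.ofLp)⟫_ℂ).re =
      ‖p‖ ^ 2 * ‖u‖ ^ 2 + 2 * (A p * u 1 * conj (u 0)).re := by
  have hsplit : ⟪u, WithLp.toLp 2 ((symbol A p).mulVec u.ofLp)⟫_ℂ =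
      ((‖p‖ ^ 2 * ‖u‖ ^ 2 : ℝ) : ℂ) +
        (A p * u 1 * conj (u 0) + conj (A p * u 1 * conj (u 0))) := by
    rw [inner_symbol, norm_sq_C2]
    push_cast
    rw [← Complex.mul_conj', ← Complex.mul_conj']
    simp only [map_mul, Complex.conj_conj]
    ring
  rw [hsplit, Complex.add_conj, Complex.add_re, Complex.ofReal_re, Complex.ofReal_re]

theorem lowerBand_mul_le (A : Plane → ℂ) (p : Plane) (u : C2) :
    lowerBand A p * ‖u‖ ^ 2 ≤ (⟪u, WithLp.toLp 2 ((symbol A p).mulVec u.ofLp)⟫_ℂ).re := by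
  have hoff : -(‖A p‖ * ‖u 1‖ * ‖u 0‖) ≤ (A p * u 1 * conj (u 0)).re := by
    have h := Complex.abs_re_le_norm (A p * u 1 * conj (u 0))
    rw [norm_mul, norm_mul, RCLike.norm_conj] at h
    exact (abs_le.1 h).1
  rw [re_inner_symbol_self, lowerBand, norm_sq_C2]
  nlinarith [mul_nonneg (norm_nonneg (A p)) (sq_nonneg (‖u 0‖ - ‖u 1‖))]

theorem norm_two_pi_smul (ξ : Plane) : ‖(2 * Real.pi) • ξ‖ = 2 * Real.pi * ‖ξ‖ := by
  rw [norm_smul, Real.norm_of_nonneg (by positivity)]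

theorem norm_snd_apply (F : H1) : ∀ᵐ ξ, ‖F.1.2 ξ‖ = 2 * Real.pi * ‖ξ‖ * ‖hat F ξ‖ := by
  filter_upwards [H1_snd F] with ξ hξ
  rw [hξ, norm_smul, Complex.norm_real, Real.norm_of_nonneg (by positivity)]

namespace System

variable (D : System)

theorem exists_norm_A_le_add_mul_sq :
    ∃ θ : ℝ, θ < 1 ∧ ∃ C : ℝ, 0 ≤ C ∧ ∀ p, ‖D.A p‖ ≤ C + θ * ‖p‖ ^ 2 := by
  obtain ⟨t, hlim, ht⟩ := exists_between D.limsup_A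
  have hev := eventually_lt_of_limsup_lt hlim
  rw [Filter.Eventually, mem_cocompact] at hev
  obtain ⟨K, hK, hs⟩ := hev
  obtain ⟨C, hC⟩ := (hK.union (isCompact_singleton (x := (0 : Plane)))).exists_bound_of_continuousOn
    D.continuous_A.continuousOn
  have htop : t ≠ ⊤ := (ht.trans ENNReal.one_lt_top).ne
  refine ⟨t.toReal, by simpa using (ENNReal.toReal_lt_toReal htop ENNReal.one_ne_top).2 ht,
    max C 0, le_max_right _ _, fun p => ?_⟩
  by_cases hp : p ∈ K ∪ {0}
  · have ht0 := mul_nonneg (ENNReal.toReal_nonneg (a := t)) (sq_nonneg ‖p‖)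
    linarith [hC p hp, le_max_left C 0]
  · rw [Set.mem_union, not_or] at hp
    have hlt : ENNReal.ofReal (‖D.A p‖ / ‖p‖ ^ 2) < t := hs hp.1
    have hp0 : 0 < ‖p‖ := norm_pos_iff.2 hp.2
    rw [ENNReal.ofReal_lt_iff_lt_toReal (by positivity) htop, div_lt_iff₀ (by positivity)] at hlt
    linarith [le_max_right C 0]

theorem kappa_le (p : Plane) : D.kappa ≤ lowerBand D.A p := by
  obtain ⟨C, hC⟩ := D.exists_norm_A_le
  refine ciInf_le ⟨-C, ?_⟩ p
  rintro _ ⟨p, rfl⟩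
  simp only [lowerBand]
  linarith [hC p]

theorem freeForm_conj (G F : H1) : conj (D.freeForm G F) = D.freeForm F G := by
  rw [freeForm, ← integral_conj]
  exact integral_congr_ae (Eventually.of_forall fun ξ => inner_symbol_conj _ _ _ _)

theorem nuForm_conj (G F : H1) : conj (D.nuForm G F) = D.nuForm F G := by
  rw [nuForm, ← integral_conj]
  refine integral_congr_ae (Eventually.of_forall fun x => ?_)
  simp only [map_mul, Complex.conj_ofReal, inner_conj_symm]

theorem form_conj (G F : H1) : conj (D.form G F) = D.form F G := by
  rw [form, map_add, freeForm_conj, nuForm_conj, form]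

theorem form_add_left (G G' F : H1) : D.form (G + G') F = D.form G F + D.form G' F := by
  rw [← D.form_conj, form_add, map_add, D.form_conj, D.form_conj]

theorem form_smul_left (k : ℂ) (G F : H1) : D.form (k • G) F = conj k * D.form G F := by
  rw [← D.form_conj, form_smul, map_mul, D.form_conj]

theorem norm_freeForm_le : ∃ M : ℝ, 0 ≤ M ∧ ∀ G F : H1, ‖D.freeForm G F‖ ≤ M * ‖G‖ * ‖F‖ := by
  obtain ⟨C, hC⟩ := D.exists_norm_A_le
  refine ⟨4 * |C| + 8, by positivity, fun G F => ?_⟩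
  have hint := (integrable_norm_mul (hat G) (hat F)).const_mul (4 * |C|)
  have hint' := (integrable_norm_mul G.1.2 F.1.2).const_mul 8
  have hle : ‖D.freeForm G F‖ ≤ ∫ ξ, (4 * |C| * (‖hat G ξ‖ * ‖hat F ξ‖) +
      8 * (‖G.1.2 ξ‖ * ‖F.1.2 ξ‖)) := by
    refine norm_integral_le_of_norm_le (hint.add hint') ?_
    filter_upwards [norm_snd_apply G, norm_snd_apply F] with ξ hG hF
    refine (D.norm_symbol_le (hC _) _ _).trans (le_of_eq ?_)
    rw [hG, hF, norm_two_pi_smul]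
    ring
  rw [integral_add hint hint', integral_const_mul, integral_const_mul] at hle
  have hhat : ‖hat G‖ * ‖hat F‖ ≤ ‖G‖ * ‖F‖ := by
    rw [← norm_fst_eq, ← norm_fst_eq]
    gcongr <;> exact le_max_left _ _
  have hsnd : ‖G.1.2‖ * ‖F.1.2‖ ≤ ‖G‖ * ‖F‖ := by
    gcongr <;> exact le_max_right _ _
  nlinarith [abs_nonneg C, integral_norm_mul_le (hat G) (hat F), integral_norm_mul_le G.1.2 F.1.2]

theorem norm_nuForm_le : ∃ M : ℝ, 0 ≤ M ∧ ∀ G F : H1,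
    ‖D.nuForm G F‖ ≤ M * ‖D.trace G‖ * ‖D.trace F‖ := by
  obtain ⟨C, hC⟩ := D.bounded_h
  have hC0 : 0 ≤ C := (abs_nonneg _).trans (hC 0)
  refine ⟨C, hC0, fun G F => ?_⟩
  have hle : ‖D.nuForm G F‖ ≤ ∫ x, C * (‖D.trace G x‖ * ‖D.trace F x‖) ∂D.m := by
    refine norm_integral_le_of_norm_le ((integrable_norm_mul _ _).const_mul _)
      (Eventually.of_forall fun x => ?_)
    rw [norm_mul, Complex.norm_real]
    exact mul_le_mul (hC x) (norm_inner_le_norm _ _) (norm_nonneg _) hC0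
  rw [integral_const_mul] at hle
  rw [mul_assoc]
  exact hle.trans (mul_le_mul_of_nonneg_left (integral_norm_mul_le _ _) hC0)

theorem norm_form_le : ∃ M : ℝ, 0 ≤ M ∧ ∀ G F : H1, ‖D.form G F‖ ≤ M * ‖G‖ * ‖F‖ := by
  obtain ⟨M, hM0, hM⟩ := D.norm_freeForm_le
  obtain ⟨M', hM'0, hM'⟩ := D.norm_nuForm_le
  refine ⟨M + M' * ‖D.trace‖ * ‖D.trace‖, by positivity, fun G F => ?_⟩
  calc ‖D.form G F‖ ≤ M * ‖G‖ * ‖F‖ + M' * ‖D.trace G‖ * ‖D.trace F‖ :=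
        (norm_add_le _ _).trans (add_le_add (hM _ _) (hM' _ _))
    _ ≤ M * ‖G‖ * ‖F‖ + M' * (‖D.trace‖ * ‖G‖) * (‖D.trace‖ * ‖F‖) := by
        gcongr <;> exact D.trace.le_opNorm _
    _ = (M + M' * ‖D.trace‖ * ‖D.trace‖) * ‖G‖ * ‖F‖ := by ring

theorem re_freeForm (F : H1) : (D.freeForm F F).re = ∫ ξ, (D.freeIntegrand F F ξ).re :=
  (integral_re (D.integrable_freeIntegrand F F)).symm

theorem integral_le_freeForm {F : H1} {f : Plane → ℝ} (hf : Integrable f)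
    (h : ∀ᵐ ξ, f ξ ≤ lowerBand D.A ((2 * Real.pi) • ξ) * ‖hat F ξ‖ ^ 2) :
    ∫ ξ, f ξ ≤ (D.freeForm F F).re := by
  rw [re_freeForm]
  exact integral_mono_ae hf (D.integrable_freeIntegrand F F).re
    (h.mono fun ξ hξ => hξ.trans (lowerBand_mul_le _ _ _))

theorem le_freeForm {F : H1} {t : ℝ}
    (h : ∀ᵐ ξ : Plane, hat F ξ ≠ 0 → t ≤ lowerBand D.A ((2 * Real.pi) • ξ)) :
    t * ‖F.1.1‖ ^ 2 ≤ (D.freeForm F F).re := by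
  rw [norm_fst_eq, norm_sq_eq_integral, ← integral_const_mul]
  refine D.integral_le_freeForm ((integrable_norm_sq _).const_mul _) ?_
  filter_upwards [h] with ξ ht
  by_cases h0 : hat F ξ = 0
  · simp [h0]
  · exact mul_le_mul_of_nonneg_right (ht h0) (by positivity)

theorem le_freeForm_coercive {θ C : ℝ} (hC : ∀ p, ‖D.A p‖ ≤ C + θ * ‖p‖ ^ 2) (F : H1) :
    (1 - θ) * ‖F.1.2‖ ^ 2 - C * ‖F.1.1‖ ^ 2 ≤ (D.freeForm F F).re := by
  have hint := (integrable_norm_sq F.1.2).const_mul (1 - θ)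
  have hint' := (integrable_norm_sq (hat F)).const_mul C
  rw [norm_fst_eq, norm_sq_eq_integral, norm_sq_eq_integral, ← integral_const_mul,
    ← integral_const_mul, ← integral_sub hint hint']
  refine D.integral_le_freeForm (hint.sub hint') ?_
  filter_upwards [norm_snd_apply F] with ξ hsnd
  have hA := mul_le_mul_of_nonneg_right (hC ((2 * Real.pi) • ξ)) (sq_nonneg ‖hat F ξ‖)
  rw [hsnd, lowerBand]
  rw [norm_two_pi_smul] at hA ⊢
  linarith

/-! ### Low frequencies have compact trace, high frequencies are harmless -/

theorem tendsto_trace_cutoff {R : ℝ} (hR : 0 < R) {w : ℕ → Spinors}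
    (hw : WeaklyTendsto ℂ w 0) :
    Tendsto (fun n => D.trace (lift (cutoff R (w n)))) atTop (𝓝 0) := by
  have hK : WeaklyTendsto ℂ (fun n => hat (lift (cutoff R (w n)))) 0 := by
    simp only [hat_lift]
    simpa using hw.map (divWeight.comp (cutoff R))
  obtain ⟨B, hB⟩ := hK.exists_norm_le
  have htrace : ∀ᵐ x ∂D.m, ∀ n i, D.trace (lift (cutoff R (w n))) x i =
      ⟪planeWave R x i, hat (lift (cutoff R (w n)))⟫_ℂ := by
    refine ae_all_iff.2 fun n => ?_
    filter_upwards [D.trace_eq_integral hR (hat_lift_cutoff_support R (w n))] with x hx i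
    rw [hx i, inner_planeWave_of_support (hat_lift_cutoff_support R (w n))]
  set M := Real.sqrt (volume.real (Metric.closedBall (0 : Plane) R)) * B
  have hbound : ∀ x i n, ‖⟪planeWave R x i, hat (lift (cutoff R (w n)))⟫_ℂ‖ ≤ M :=
    fun x i n => (norm_inner_le_norm _ _).trans
      (mul_le_mul (norm_planeWave_le R x i) (hB n) (norm_nonneg _) (Real.sqrt_nonneg _))
  refine tendsto_zero_of_dominated (fun _ => M ^ 2 + M ^ 2) (integrable_const _) (fun n => ?_) ?_
  · filter_upwards [htrace] with x hx
    rw [norm_sq_C2, hx, hx]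
    gcongr <;> apply hbound
  · filter_upwards [htrace] with x hx
    have hcomp : ∀ i, Tendsto (fun n => D.trace (lift (cutoff R (w n))) x i) atTop (𝓝 0) := by
      simpa only [hx, inner_zero_right] using fun i => hK (planeWave R x i)
    exact ((PiLp.continuous_toLp 2 fun _ : Fin 2 => ℂ).tendsto 0).comp (tendsto_pi_nhds.2 hcomp)

theorem exists_high_frequency_nonneg (hD : D.RelativelyFormBounded) :
    ∃ R : ℝ, 0 < R ∧ ∀ F : H1, (∀ᵐ ξ, ‖ξ‖ ≤ R → hat F ξ = 0) →
      D.kappa * ‖F.1.1‖ ^ 2 ≤ (D.form F F).re := by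
  obtain ⟨a, ha, b, hab⟩ := hD
  obtain ⟨θ, hθ, C, hC0, hC⟩ := D.exists_norm_A_le_add_mul_sq
  have ha' : 0 < 1 - a := sub_pos.2 ha
  have hθ' : 0 < 1 - θ := sub_pos.2 hθ
  set s := |b + D.kappa| / (1 - a)
  have hs : (1 - a) * s = |b + D.kappa| := mul_div_cancel₀ _ ha'.ne'
  set T := (s + C) / (1 - θ)
  have hT : T * (1 - θ) = s + C := div_mul_cancel₀ _ hθ'.ne'
  have hT0 : 0 ≤ T := by positivity
  refine ⟨1 + T, by positivity, fun F hF => ?_⟩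
  have hlow : ∀ᵐ ξ : Plane, hat F ξ ≠ 0 → s ≤ lowerBand D.A ((2 * Real.pi) • ξ) := by
    filter_upwards [hF] with ξ hsupp hne
    have hξ : 1 + T < ‖ξ‖ := not_le.1 fun hle => hne (hsupp hle)
    have hp : T ≤ ‖(2 * Real.pi) • ξ‖ ^ 2 := by
      rw [norm_two_pi_smul, mul_pow]
      have hpi : 1 ≤ (2 * Real.pi) ^ 2 := by nlinarith [Real.pi_gt_three]
      nlinarith [sq_nonneg ‖ξ‖]
    rw [lowerBand]
    nlinarith [hC ((2 * Real.pi) • ξ)]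
  have hfree := mul_le_mul_of_nonneg_left (D.le_freeForm hlow) ha'.le
  have hnu := (abs_le.1 ((Complex.abs_re_le_norm _).trans (hab F))).1
  have habs := mul_le_mul_of_nonneg_right (le_abs_self (b + D.kappa)) (sq_nonneg ‖F.1.1‖)
  rw [← mul_assoc, hs] at hfree
  rw [form, Complex.add_re]
  linarith

theorem freeForm_eq_zero_of_disjoint {G F : H1} (h : ∀ᵐ ξ, hat G ξ = 0 ∨ hat F ξ = 0) :
    D.freeForm G F = 0 := by
  refine integral_eq_zero_of_ae ?_
  filter_upwards [h] with ξ h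
  simp only [freeIntegrand, inner_symbol]
  rcases h with h | h <;> simp [h]

theorem re_form_add_of_disjoint {G F : H1} (h : ∀ᵐ ξ, hat G ξ = 0 ∨ hat F ξ = 0) :
    (D.form (G + F) (G + F)).re =
      (D.form G G).re + 2 * (D.nuForm G F).re + (D.form F F).re := by
  have hGF : D.form G F = D.nuForm G F := by
    rw [form, D.freeForm_eq_zero_of_disjoint h, zero_add]
  rw [form_add, form_add_left, form_add_left, ← D.form_conj G F, hGF]
  simp only [Complex.add_re, Complex.conj_re]
  ring

end System

theorem norm_sq_add_of_disjoint {G F : H1} (h : ∀ᵐ ξ, hat G ξ = 0 ∨ hat F ξ = 0) :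
    ‖(G + F).1.1‖ ^ 2 = ‖G.1.1‖ ^ 2 + ‖F.1.1‖ ^ 2 := by
  have horth : ⟪G.1.1, F.1.1⟫_ℂ = 0 := by
    rw [inner_fst_eq, L2.inner_def]
    refine integral_eq_zero_of_ae ?_
    filter_upwards [h] with ξ h
    rcases h with h | h <;> simp [h]
  change ‖G.1.1 + F.1.1‖ ^ 2 = _
  simpa only [sq] using norm_add_sq_eq_norm_sq_add_norm_sq_of_inner_eq_zero _ _ horth

theorem hat_lift_sub_cutoff_support (R : ℝ) (w : Spinors) :
    ∀ᵐ ξ, ‖ξ‖ ≤ R → hat (lift (w - cutoff R w)) ξ = 0 := by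
  rw [map_sub, hat_sub]
  filter_upwards [Lp.coeFn_sub (hat (lift w)) (hat (lift (cutoff R w))), hat_lift_cutoff R w]
    with ξ hsub hcut hξ
  rw [hsub, Pi.sub_apply, hcut, Set.indicator_of_mem (by simpa using hξ), sub_self]

namespace System

variable (D : System)

theorem neg_trace_le_form_add {M : ℝ}
    (hM : ∀ G F : H1, ‖D.nuForm G F‖ ≤ M * ‖D.trace G‖ * ‖D.trace F‖) {G F : H1}
    (hF : D.kappa * ‖F.1.1‖ ^ 2 ≤ (D.form F F).re) (h : ∀ᵐ ξ, hat G ξ = 0 ∨ hat F ξ = 0) :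
    -(M * ‖D.trace G‖ * (‖D.trace G‖ + 2 * ‖D.trace F‖)) ≤
      (D.form (G + F) (G + F)).re - D.kappa * ‖(G + F).1.1‖ ^ 2 := by
  have hfree := D.le_freeForm (F := G) (t := D.kappa) (Eventually.of_forall fun ξ _ => D.kappa_le _)
  have hGG := (abs_le.1 ((Complex.abs_re_le_norm _).trans (hM G G))).1
  have hGF := (abs_le.1 ((Complex.abs_re_le_norm _).trans (hM G F))).1
  have hform : (D.form G G).re = (D.freeForm G G).re + (D.nuForm G G).re := rfl
  rw [D.re_form_add_of_disjoint h, norm_sq_add_of_disjoint h]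
  linarith

/-- The inclusion of the form domain in the Hilbert space, in the parametrization by `lift`. -/
def domainEmbedding : Spinors →L[ℂ] Spinors :=
  (ContinuousLinearMap.fst ℂ Spinors Spinors).comp (H1.subtypeL.comp lift)

theorem domainEmbedding_apply (w : Spinors) : domainEmbedding w = (lift w).1.1 := rfl

theorem liminf_form_nonneg (hD : D.RelativelyFormBounded) {w : ℕ → Spinors}
    (hw : WeaklyTendsto ℂ w 0) {ε : ℝ} (hε : 0 < ε) :
    ∀ᶠ n in atTop, -ε ≤ (D.form (lift (w n)) (lift (w n))).re -
      D.kappa * ‖domainEmbedding (w n)‖ ^ 2 := by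
  obtain ⟨R, hR, hhigh⟩ := D.exists_high_frequency_nonneg hD
  obtain ⟨M, hM0, hM⟩ := D.norm_nuForm_le
  obtain ⟨P, hP⟩ := (hw.map (D.trace.comp (lift.comp (.id ℂ Spinors - cutoff R)))).exists_norm_le
  have hlow := (D.tendsto_trace_cutoff hR hw).norm
  have hlim : Tendsto (fun n => M * ‖D.trace (lift (cutoff R (w n)))‖ *
      (‖D.trace (lift (cutoff R (w n)))‖ + 2 * P)) atTop (𝓝 0) := by
    simpa using (hlow.const_mul M).mul (hlow.add_const (2 * P))
  filter_upwards [hlim.eventually (gt_mem_nhds hε)] with n hn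
  set G := lift (cutoff R (w n))
  set F := lift (w n - cutoff R (w n))
  have hsum : lift (w n) = G + F := by rw [← map_add, add_sub_cancel]
  have hF := hat_lift_sub_cutoff_support R (w n)
  have hdisj : ∀ᵐ ξ, hat G ξ = 0 ∨ hat F ξ = 0 := by
    filter_upwards [hat_lift_cutoff_support R (w n), hF] with ξ hGξ hFξ
    exact (lt_or_ge R ‖ξ‖).imp hGξ hFξ
  have hP' : M * ‖D.trace G‖ * (‖D.trace G‖ + 2 * ‖D.trace F‖) ≤
      M * ‖D.trace G‖ * (‖D.trace G‖ + 2 * P) := by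
    gcongr
    exact hP n
  rw [domainEmbedding_apply, hsum]
  linarith [D.neg_trace_le_form_add hM (hhigh F hF) hdisj]

/-! ### Eigenvalues of the Hamiltonian below the threshold -/

theorem coercive_form (hD : D.RelativelyFormBounded) : ∃ c > 0, ∃ E : ℝ, ∀ w,
    c * ‖w‖ ^ 2 ≤ (D.form (lift w) (lift w)).re - E * ‖domainEmbedding w‖ ^ 2 := by
  obtain ⟨a, ha, b, hab⟩ := hD
  obtain ⟨θ, hθ, C, -, hC⟩ := D.exists_norm_A_le_add_mul_sq
  have ha' : 0 < 1 - a := sub_pos.2 ha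
  have hθ' : 0 < 1 - θ := sub_pos.2 hθ
  refine ⟨(1 - a) * (1 - θ) / 2, half_pos (mul_pos ha' hθ'),
    -((1 - a) * C + b + (1 - a) * (1 - θ)),
    fun w => ?_⟩
  rw [domainEmbedding_apply]
  have hfree := mul_le_mul_of_nonneg_left (D.le_freeForm_coercive hC (lift w)) ha'.le
  have hnu := (abs_le.1 ((Complex.abs_re_le_norm _).trans (hab (lift w)))).1
  have hw : ‖w‖ ≤ ‖(lift w).1.1‖ + ‖(lift w).1.2‖ := by
    rw [norm_fst_eq]
    simpa only [hat_lift_add_snd] using norm_add_le (hat (lift w)) (lift w).1.2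
  have hsq : ‖w‖ ^ 2 ≤ 2 * ‖(lift w).1.1‖ ^ 2 + 2 * ‖(lift w).1.2‖ ^ 2 := by
    nlinarith [norm_nonneg w, sq_nonneg (‖(lift w).1.1‖ - ‖(lift w).1.2‖)]
  have hsq' := mul_le_mul_of_nonneg_left hsq (half_pos (mul_pos ha' hθ')).le
  rw [form, Complex.add_re]
  linarith

/-- The form of the Hamiltonian as a bounded sesquilinear form, in the parametrization of the form
domain by `lift`. -/
def liftedForm : Spinors →L⋆[ℂ] Spinors →L[ℂ] ℂ :=
  LinearMap.mkContinuousOfExistsBound₂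
    (LinearMap.mk₂'ₛₗ (starRingEnd ℂ) (RingHom.id ℂ) (fun u v => D.form (lift u) (lift v))
      (fun u v w => by rw [map_add, form_add_left])
      (fun k u v => by rw [map_smul, form_smul_left, smul_eq_mul])
      (fun u v w => by rw [map_add, form_add])
      (fun k u v => by rw [map_smul, form_smul, smul_eq_mul, RingHom.id_apply])) <| by
    obtain ⟨M, hM0, hM⟩ := D.norm_form_le
    refine ⟨M * ‖lift‖ * ‖lift‖, fun u v => (hM (lift u) (lift v)).trans ?_⟩
    calc M * ‖lift u‖ * ‖lift v‖ ≤ M * (‖lift‖ * ‖u‖) * (‖lift‖ * ‖v‖) := by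
          gcongr <;> exact lift.le_opNorm _
      _ = M * ‖lift‖ * ‖lift‖ * ‖u‖ * ‖v‖ := by ring

theorem liftedForm_apply (u v : Spinors) : D.liftedForm u v = D.form (lift u) (lift v) := rfl

theorem essentiallyBoundedBelow (hD : D.RelativelyFormBounded) :
    EssentiallyBoundedBelow D.liftedForm domainEmbedding D.kappa where
  conj_symm u v := D.form_conj _ _
  injective := lift_fst_injective
  coercive := by
    simp only [re_shift_self]
    exact D.coercive_form hD
  liminf_nonneg w hw ε hε := by
    simp only [re_shift_self]
    exact D.liminf_form_nonneg hD hw hε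

instance : Fact ((2 : ℝ≥0∞) ≠ ⊤) := ⟨ENNReal.ofNat_ne_top⟩

theorem eigenspace_eq (E : ℝ) : eigenspace D.hamiltonian E =
    (weakEigenspace D.liftedForm domainEmbedding E).map domainEmbedding.toLinearMap := by
  ext f
  change (f, (E : ℂ) • f) ∈ D.hamiltonian.graph ↔ _
  simp only [hamiltonian_graph, Submodule.mem_map, mem_weakEigenspace, shift_apply, sub_eq_zero]
  constructor
  · rintro ⟨F, hF, hG⟩
    obtain ⟨w, rfl⟩ := lift_surjective F
    refine ⟨w, fun g => (hG (lift g)).trans ?_, hF⟩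
    rw [inner_smul_right]
    simp only at hF
    rw [← hF]
    rfl
  · rintro ⟨w, hw, rfl⟩
    refine ⟨lift w, rfl, fun G => ?_⟩
    obtain ⟨g, rfl⟩ := lift_surjective G
    exact (hw g).trans (inner_smul_right _ _ _).symm

theorem iSup_eigenspace_eq :
    (⨆ E ∈ eigenvaluesBelow D.hamiltonian D.kappa, eigenspace D.hamiltonian E :
      Submodule ℂ Spinors) = (weakEigenspacesBelow D.liftedForm domainEmbedding D.kappa).map
        domainEmbedding.toLinearMap := by
  simp only [weakEigenspacesBelow, Submodule.map_iSup, ← eigenspace_eq]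
  refine le_antisymm (biSup_mono fun E hE => hE.1) (iSup₂_le fun E hE => ?_)
  by_cases h : eigenspace D.hamiltonian E = ⊥
  · exact h.le.trans bot_le
  · exact le_iSup₂_of_le E ⟨hE, h⟩ le_rfl

theorem countBelow_eq : countBelow D.hamiltonian D.kappa =
    Cardinal.toENat (Module.rank ℂ
      (weakEigenspacesBelow D.liftedForm domainEmbedding D.kappa)) := by
  rw [countBelow, iSup_eigenspace_eq]
  exact congrArg _ (Submodule.equivMapOfInjective domainEmbedding.toLinearMap lift_fst_injective
    _).rank_eq.symm

theorem card_le_countBelow (hD : D.RelativelyFormBounded) {N : Type*} [Fintype N] (V : N → H1)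
    (hV : ∀ c : N → ℂ, c ≠ 0 → (D.form (∑ j, c j • V j) (∑ j, c j • V j)).re <
      D.kappa * ‖(∑ j, c j • V j).1.1‖ ^ 2) :
    (Fintype.card N : ℕ∞) ≤ countBelow D.hamiltonian D.kappa := by
  choose w hw using fun j => lift_surjective (V j)
  have hlift : ∀ c : N → ℂ, lift (∑ j, c j • w j) = ∑ j, c j • V j := fun c => by
    simp only [map_sum, map_smul, hw]
  have hneg : ∀ c : N → ℂ, c ≠ 0 →
      RCLike.re (shift D.liftedForm domainEmbedding D.kappa
        (∑ j, c j • w j) (∑ j, c j • w j)) < 0 := fun c hc => by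
    rw [re_shift_self, sub_neg, liftedForm_apply, domainEmbedding_apply, hlift]
    exact hV c hc
  have hind : LinearIndependent ℂ w := by
    rw [Fintype.linearIndependent_iff]
    intro c hc
    by_contra! h
    have := hneg c (Function.ne_iff.2 h)
    simp [hc] at this
  have hrank := (D.essentiallyBoundedBelow hD).finrank_le_rank_weakEigenspacesBelow
    (V := Submodule.span ℂ (Set.range w)) fun v hv hv0 => by
      obtain ⟨c, rfl⟩ := (Submodule.mem_span_range_iff_exists_fun ℂ).1 hv
      exact hneg c fun hc => hv0 (by simp [hc])
  rw [finrank_span_eq_card hind] at hrank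
  rw [countBelow_eq]
  simpa using Cardinal.toENat.monotone' hrank

theorem infinite_eigenvaluesBelow (hD : D.RelativelyFormBounded)
    (h : countBelow D.hamiltonian D.kappa = ⊤) :
    (eigenvaluesBelow D.hamiltonian D.kappa).Infinite := by
  rw [countBelow_eq, Cardinal.toENat_eq_top] at h
  refine ((D.essentiallyBoundedBelow hD).infinite_of_aleph0_le_rank h).mono
    fun E hE => ⟨hE.1, fun hbot => hE.2 ?_⟩
  rw [eigenspace_eq, ← Submodule.map_bot domainEmbedding.toLinearMap] at hbot
  exact Submodule.map_injective_of_injective lift_fst_injective hbot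

end System

/-! ### Logarithmic profiles -/

/-- The integral of `‖ξ‖⁻²` over the annulus `e < ‖ξ‖ < d`, in closed form. It tends to infinity
with `d / e`, which is the vanishing of the capacity of points in dimension two. -/
def annulusMass (e d : ℝ) : ℝ := 2 * (volume.real (Metric.ball (0 : Plane) 1) * Real.log (d / e))

/-- The function `‖ξ‖⁻²` on the annulus `e < ‖ξ‖ < d`, normalized in `L¹`: the amplitude of the
wave packets. -/
def profile (e d : ℝ) (ξ : Plane) : ℝ :=
  (annulusMass e d)⁻¹ * (Set.Ioo e d).indicator (fun r => (r ^ 2)⁻¹) ‖ξ‖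

theorem measurable_profile (e d : ℝ) : Measurable (profile e d) := by
  unfold profile
  refine Measurable.const_mul ?_ _
  exact ((by fun_prop : Measurable fun r : ℝ => (r ^ 2)⁻¹).indicator measurableSet_Ioo).comp
    measurable_norm

theorem volume_real_ball_pos : 0 < volume.real (Metric.ball (0 : Plane) 1) :=
  ENNReal.toReal_pos (Metric.measure_ball_pos _ _ one_pos).ne' measure_ball_lt_top.ne

theorem tendsto_inv_annulusMass {ι : Type*} {l : Filter ι} {e d : ι → ℝ}
    (h : Tendsto (fun n => d n / e n) l atTop) :
    Tendsto (fun n => (annulusMass (e n) (d n))⁻¹) l (𝓝 0) :=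
  tendsto_inv_atTop_zero.comp (((Real.tendsto_log_atTop.comp h).const_mul_atTop
    volume_real_ball_pos).const_mul_atTop two_pos)

variable {e d : ℝ}

theorem annulusMass_pos (he : 0 < e) (hed : e < d) : 0 < annulusMass e d := by
  have hball := volume_real_ball_pos
  have hlog : 0 < Real.log (d / e) := Real.log_pos (by rwa [one_lt_div he])
  unfold annulusMass
  positivity

theorem profile_nonneg (he : 0 < e) (hed : e < d) (ξ : Plane) : 0 ≤ profile e d ξ :=
  mul_nonneg (inv_nonneg.2 (annulusMass_pos he hed).le)
    (Set.indicator_nonneg (fun r _ => by positivity) _)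

theorem profile_le (he : 0 < e) (hed : e < d) (ξ : Plane) :
    profile e d ξ ≤ (annulusMass e d)⁻¹ * (e ^ 2)⁻¹ := by
  refine mul_le_mul_of_nonneg_left ?_ (inv_nonneg.2 (annulusMass_pos he hed).le)
  refine Set.indicator_apply_le' (fun hr => ?_) (fun _ => by positivity)
  have := hr.1
  gcongr

theorem profile_of_le {ξ : Plane} (h : ‖ξ‖ ≤ e) : profile e d ξ = 0 := by
  rw [profile, Set.indicator_of_notMem (fun hξ => absurd hξ.1 (not_lt.2 h)), mul_zero]

theorem profile_of_ge {ξ : Plane} (h : d ≤ ‖ξ‖) : profile e d ξ = 0 := by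
  rw [profile, Set.indicator_of_notMem (fun hξ => absurd hξ.2 (not_lt.2 h)), mul_zero]

theorem integral_indicator_inv_norm_sq (he : 0 < e) (hed : e < d) :
    ∫ ξ : Plane, (Set.Ioo e d).indicator (fun r => (r ^ 2)⁻¹) ‖ξ‖ = annulusMass e d := by
  have hpolar : ∀ y ∈ Set.Ioi (0 : ℝ), y ^ (2 - 1) •
      (Set.Ioo e d).indicator (fun r => (r ^ 2)⁻¹) y =
      (Set.Ioo e d).indicator (fun r => r⁻¹) y := by
    intro y hy
    have hy0 : y ≠ 0 := (Set.mem_Ioi.1 hy).ne'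
    by_cases h : y ∈ Set.Ioo e d
    · rw [Set.indicator_of_mem h, Set.indicator_of_mem h, smul_eq_mul, pow_one]
      field_simp
    · rw [Set.indicator_of_notMem h, Set.indicator_of_notMem h, smul_zero]
  rw [integral_fun_norm_addHaar volume ((Set.Ioo e d).indicator fun r => (r ^ 2)⁻¹),
    finrank_euclideanSpace_fin, setIntegral_congr_fun measurableSet_Ioi hpolar,
    setIntegral_indicator measurableSet_Ioo, Set.inter_eq_self_of_subset_right
      (fun y (hy : y ∈ Set.Ioo e d) => Set.mem_Ioi.2 (he.trans hy.1)),
    ← integral_Ioc_eq_integral_Ioo, ← intervalIntegral.integral_of_le hed.le,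
    integral_inv_of_pos he (he.trans hed), nsmul_eq_mul, smul_eq_mul, Nat.cast_ofNat, annulusMass]

theorem integral_profile (he : 0 < e) (hed : e < d) : ∫ ξ, profile e d ξ = 1 := by
  unfold profile
  rw [integral_const_mul, integral_indicator_inv_norm_sq he hed,
    inv_mul_cancel₀ (annulusMass_pos he hed).ne']

theorem integrable_profile (he : 0 < e) (hed : e < d) : Integrable (profile e d) :=
  Integrable.of_integral_ne_zero (by rw [integral_profile he hed]; exact one_ne_zero)

theorem norm_sq_mul_profile_sq (he : 0 < e) (ξ : Plane) :
    ‖ξ‖ ^ 2 * profile e d ξ ^ 2 = (annulusMass e d)⁻¹ * profile e d ξ := by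
  unfold profile
  by_cases h : ‖ξ‖ ∈ Set.Ioo e d
  · have : ‖ξ‖ ≠ 0 := (he.trans h.1).ne'
    rw [Set.indicator_of_mem h]
    field_simp
  · rw [Set.indicator_of_notMem h, mul_zero, zero_pow two_ne_zero, mul_zero, mul_zero]

theorem integral_norm_sq_mul_profile_sq (he : 0 < e) (hed : e < d) :
    ∫ ξ, ‖ξ‖ ^ 2 * profile e d ξ ^ 2 = (annulusMass e d)⁻¹ := by
  simp only [norm_sq_mul_profile_sq he]
  rw [integral_const_mul, integral_profile he hed, mul_one]

theorem integrable_norm_sq_mul_profile_sq (he : 0 < e) (hed : e < d) :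
    Integrable fun ξ : Plane => ‖ξ‖ ^ 2 * profile e d ξ ^ 2 := by
  simp only [norm_sq_mul_profile_sq he]
  exact (integrable_profile he hed).const_mul _

/-! ### Wave packets -/

theorem norm_wave_sub_le (x ξ ξ₀ : Plane) :
    ‖wave x ξ - wave x ξ₀‖ ≤ 2 * Real.pi * (‖x‖ * ‖ξ - ξ₀‖) := by
  have hfactor : wave x ξ - wave x ξ₀ = wave x ξ₀ * (Complex.exp (Complex.I *
      ((2 * Real.pi * ⟪ξ - ξ₀, x⟫_ℝ : ℝ) : ℂ)) - 1) := by
    rw [mul_sub, mul_one, wave, wave, ← Complex.exp_add, inner_sub_left]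
    congr 2
    push_cast
    ring
  rw [hfactor, norm_mul, norm_wave, one_mul]
  refine (Real.norm_exp_I_mul_ofReal_sub_one_le).trans ?_
  rw [Real.norm_eq_abs, abs_mul, abs_of_pos (by positivity : 0 < 2 * Real.pi), mul_comm ‖x‖]
  gcongr
  exact abs_real_inner_le_norm (ξ - ξ₀) x

/-- The scalar wave packet: the inverse Fourier integral of the profile translated to `ξ₀`. -/
def packet (e d : ℝ) (ξ₀ x : Plane) : ℂ := ∫ ξ, wave x ξ * (profile e d (ξ - ξ₀) : ℂ)

theorem integrable_packet (he : 0 < e) (hed : e < d) (ξ₀ x : Plane) :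
    Integrable fun ξ => wave x ξ * (profile e d (ξ - ξ₀) : ℂ) :=
  ((integrable_profile he hed).comp_sub_right ξ₀).ofReal.bdd_mul (c := 1)
    (continuous_wave x).aestronglyMeasurable (Eventually.of_forall fun ξ => (norm_wave x ξ).le)

theorem norm_packet_le (he : 0 < e) (hed : e < d) (ξ₀ x : Plane) : ‖packet e d ξ₀ x‖ ≤ 1 := by
  rw [← integral_profile he hed, ← integral_sub_right_eq_self (profile e d) ξ₀]
  refine norm_integral_le_of_norm_le ((integrable_profile he hed).comp_sub_right ξ₀)
    (Eventually.of_forall fun ξ => ?_)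
  rw [norm_mul, norm_wave, one_mul, Complex.norm_real,
    Real.norm_of_nonneg (profile_nonneg he hed _)]

theorem packet_origin (he : 0 < e) (hed : e < d) (ξ₀ : Plane) : packet e d ξ₀ 0 = 1 := by
  have hwave (ξ : Plane) : wave 0 ξ = 1 := by simp [wave]
  simp only [packet, hwave, one_mul]
  rw [integral_complex_ofReal, integral_sub_right_eq_self (profile e d) ξ₀,
    integral_profile he hed, Complex.ofReal_one]

theorem norm_packet_sub_le (he : 0 < e) (hed : e < d) (ξ₀ x : Plane) :
    ‖packet e d ξ₀ x - wave x ξ₀‖ ≤ 2 * Real.pi * (‖x‖ * d) := by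
  have hint := (integrable_profile he hed).comp_sub_right ξ₀
  have hintC : Integrable fun ξ => wave x ξ₀ * (profile e d (ξ - ξ₀) : ℂ) :=
    hint.ofReal.const_mul _
  have hone : ∫ ξ, profile e d (ξ - ξ₀) = 1 := by
    rw [integral_sub_right_eq_self (profile e d) ξ₀, integral_profile he hed]
  have hwave : wave x ξ₀ = ∫ ξ, wave x ξ₀ * (profile e d (ξ - ξ₀) : ℂ) := by
    rw [integral_const_mul, integral_complex_ofReal, hone, Complex.ofReal_one, mul_one]
  have hdiff : packet e d ξ₀ x - wave x ξ₀ =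
      ∫ ξ, (wave x ξ - wave x ξ₀) * (profile e d (ξ - ξ₀) : ℂ) := by
    simp only [sub_mul]
    rw [integral_sub (integrable_packet he hed ξ₀ x) hintC, ← hwave, packet]
  rw [hdiff, ← mul_one (2 * Real.pi * (‖x‖ * d)), ← hone, ← integral_const_mul]
  refine norm_integral_le_of_norm_le (hint.const_mul _) (Eventually.of_forall fun ξ => ?_)
  rw [norm_mul, Complex.norm_real, Real.norm_of_nonneg (profile_nonneg he hed _)]
  rcases le_or_gt d ‖ξ - ξ₀‖ with h | h
  · rw [profile_of_ge h, mul_zero, mul_zero]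
  · refine mul_le_mul_of_nonneg_right ((norm_wave_sub_le x ξ ξ₀).trans ?_)
      (profile_nonneg he hed _)
    gcongr

theorem tendsto_packet {ι : Type*} {l : Filter ι} {e d : ι → ℝ} (he : ∀ n, 0 < e n)
    (hed : ∀ n, e n < d n) (hd : Tendsto d l (𝓝 0)) (ξ₀ x : Plane) :
    Tendsto (fun n => packet (e n) (d n) ξ₀ x) l (𝓝 (wave x ξ₀)) := by
  rw [tendsto_iff_norm_sub_tendsto_zero]
  refine squeeze_zero (fun n => norm_nonneg _)
    (fun n => norm_packet_sub_le (he n) (hed n) ξ₀ x) ?_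
  simpa using (hd.const_mul ‖x‖).const_mul (2 * Real.pi)

/-! ### The polarization of the lower band -/

/-- The polarization of the lower band: at a momentum `p` with `A p ≠ 0`, the eigenvector of
`symbol A p` for the eigenvalue `lowerBand A p` with first component `1`. Where `A p = 0` the
symbol is scalar, and the value `(1, 0)` produced by the division by zero is an eigenvector too. -/
def polarization (A : Plane → ℂ) (p : Plane) : C2 :=
  !₂[1, -conj (A p) / (‖A p‖ : ℂ)]

theorem polarization_zero (A : Plane → ℂ) (p : Plane) : polarization A p 0 = 1 := rfl

theorem polarization_one (A : Plane → ℂ) (p : Plane) :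
    polarization A p 1 = -conj (A p) / (‖A p‖ : ℂ) := rfl

theorem norm_polarization_sq_le (A : Plane → ℂ) (p : Plane) : ‖polarization A p‖ ^ 2 ≤ 2 := by
  have hone : ‖polarization A p 1‖ ≤ 1 := by
    rw [polarization_one, norm_div, norm_neg, RCLike.norm_conj, Complex.norm_real, norm_norm]
    exact div_self_le_one _
  rw [norm_sq_C2, polarization_zero, norm_one]
  nlinarith [norm_nonneg (polarization A p 1)]

theorem symbol_mulVec_polarization (A : Plane → ℂ) (p : Plane) :
    (symbol A p).mulVec (polarization A p).ofLp =
      ((lowerBand A p : ℝ) : ℂ) • (polarization A p).ofLp := by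
  have hconj : A p * conj (A p) = (‖A p‖ : ℂ) ^ 2 := Complex.mul_conj' _
  rcases eq_or_ne (A p) 0 with hA | hA
  · ext i
    fin_cases i <;> simp [symbol, polarization, lowerBand, hA, Matrix.mulVec, dotProduct]
  · have hA' : (‖A p‖ : ℂ) ≠ 0 := by simpa using hA
    ext i
    fin_cases i <;> simp only [symbol, polarization, lowerBand, Matrix.mulVec, dotProduct,
      Fin.sum_univ_two, Fin.zero_eta, Fin.mk_one, Matrix.of_apply, Matrix.cons_val',
      Matrix.cons_val_zero, Matrix.cons_val_one, Matrix.cons_val_fin_one, mul_one,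
      Complex.ofReal_sub, Complex.ofReal_pow, Pi.smul_apply, smul_eq_mul]
    · field_simp
      linear_combination -hconj
    · field_simp
      ring

theorem inner_symbol_smul_polarization (A : Plane → ℂ) (p : Plane) (z : ℂ) :
    ⟪z • polarization A p,
        WithLp.toLp 2 ((symbol A p).mulVec (z • polarization A p).ofLp)⟫_ℂ =
      ((lowerBand A p * ‖z • polarization A p‖ ^ 2 : ℝ) : ℂ) := by
  rw [WithLp.ofLp_smul, Matrix.mulVec_smul, symbol_mulVec_polarization, smul_comm,
    WithLp.toLp_smul, WithLp.toLp_smul, WithLp.toLp_ofLp, inner_smul_right,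
    inner_self_eq_norm_sq_to_K]
  push_cast
  rfl

theorem measurable_polarization {A : Plane → ℂ} (hA : Continuous A) :
    Measurable (polarization A) := by
  refine (WithLp.measurable_toLp 2 (Fin 2 → ℂ)).comp (measurable_pi_iff.2 fun i => ?_)
  fin_cases i
  · exact measurable_const
  · exact ((Complex.continuous_conj.comp hA).measurable.neg).div
      (Complex.continuous_ofReal.comp hA.norm).measurable

/-! ### Spinors with a prescribed Fourier transform -/

theorem memLp_two_of_bound {E : Type*} [NormedAddCommGroup E] {u : Plane → E}
    (hu : AEStronglyMeasurable u volume) {C R : ℝ}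
    (hC : ∀ ξ, ‖u ξ‖ ≤ C) (hR : ∀ ξ, R < ‖ξ‖ → u ξ = 0) : MemLp u 2 volume := by
  have hind : (Metric.closedBall 0 R).indicator u = u := by
    refine Set.indicator_eq_self.2 fun ξ hξ => ?_
    by_contra hball
    exact hξ (hR ξ (by simpa using hball))
  rw [← hind, memLp_indicator_iff_restrict measurableSet_closedBall]
  have : IsFiniteMeasure (volume.restrict (Metric.closedBall (0 : Plane) R)) :=
    isFiniteMeasure_restrict.2 measure_closedBall_lt_top.ne
  exact MemLp.of_bound hu.restrict C (Eventually.of_forall hC)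

theorem exists_hat_eq {u : Plane → C2} (hu : AEStronglyMeasurable u volume) {C R : ℝ}
    (hC : ∀ ξ, ‖u ξ‖ ≤ C) (hR : ∀ ξ, R < ‖ξ‖ → u ξ = 0) : ∃ F : H1, hat F =ᵐ[volume] u := by
  have hmeas : Continuous fun ξ : Plane => ((1 + 2 * Real.pi * ‖ξ‖ : ℝ) : ℂ) := by fun_prop
  have hmem : MemLp (fun ξ : Plane => ((1 + 2 * Real.pi * ‖ξ‖ : ℝ) : ℂ) • u ξ) 2 volume := by
    refine memLp_two_of_bound (hmeas.aestronglyMeasurable.smul hu) (R := R)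
      (C := (1 + 2 * Real.pi * |R|) * C) (fun ξ => ?_) fun ξ hξ => by rw [hR ξ hξ, smul_zero]
    have hC₀ : 0 ≤ C := (norm_nonneg _).trans (hC 0)
    rcases lt_or_ge R ‖ξ‖ with h | h
    · rw [hR ξ h, smul_zero, norm_zero]
      positivity
    · rw [norm_smul, Complex.norm_real, Real.norm_of_nonneg (by positivity)]
      have := h.trans (le_abs_self R)
      have := hC ξ
      gcongr
  refine ⟨lift hmem.toLp, ?_⟩
  rw [hat_lift]
  filter_upwards [coeFn_divWeight hmem.toLp, hmem.coeFn_toLp] with ξ hdiv hcoe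
  rw [hdiv, hcoe, smul_smul, ← Complex.ofReal_mul, weightInv, inv_mul_cancel₀ (by positivity),
    Complex.ofReal_one, one_smul]

theorem coeFn_hat_sum {N : Type*} [Fintype N] (c : N → ℂ) (V : N → H1) {u : N → Plane → C2}
    (hu : ∀ j, hat (V j) =ᵐ[volume] u j) :
    hat (∑ j, c j • V j) =ᵐ[volume] fun ξ => ∑ j, c j • u j ξ := by
  let hatₗ : H1 →ₗ[ℂ] Spinors := ⟨⟨hat, hat_add⟩, hat_smul⟩
  have hsum : hat (∑ j, c j • V j) = ∑ j, c j • hat (V j) := by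
    exact (map_sum hatₗ _ Finset.univ).trans
      (Finset.sum_congr rfl fun j _ => hat_smul (c j) (V j))
  rw [hsum]
  filter_upwards [Lp.coeFn_fun_finsetSum Finset.univ fun j => c j • hat (V j),
    ae_all_iff.2 hu, ae_all_iff.2 fun j => Lp.coeFn_smul (c j) (hat (V j))] with ξ hcoe huξ hsmul
  rw [hcoe]
  exact Finset.sum_congr rfl fun j _ => by rw [hsmul j, Pi.smul_apply, huξ j]

/-! ### Minima of twice differentiable functions -/

theorem exists_sub_le_mul_norm_sq_of_isLocalMin {E : Type*} [NormedAddCommGroup E] [NormedSpace ℝ E]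
    {f : E → ℝ} {p₀ : E} (hf : ContDiffAt ℝ 2 f p₀) (hmin : IsLocalMin f p₀) :
    ∃ K : NNReal, ∀ᶠ p in 𝓝 p₀, f p - f p₀ ≤ K * ‖p - p₀‖ ^ 2 := by
  obtain ⟨K, t, ht, hK⟩ :=
    (hf.fderiv_right (m := 1) (by norm_num)).exists_lipschitzOnWith
  have hdiff : ∀ᶠ p in 𝓝 p₀, DifferentiableAt ℝ f p := by
    filter_upwards [hf.eventually (by simp)] with p hp
    exact hp.differentiableAt (by norm_num)
  obtain ⟨δ, hδ, hball⟩ := Metric.mem_nhds_iff.1 (inter_mem ht hdiff)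
  refine ⟨K, Metric.eventually_nhds_iff_ball.2 ⟨δ, hδ, fun p hp => ?_⟩⟩
  have hsub : Metric.closedBall p₀ ‖p - p₀‖ ⊆ Metric.ball p₀ δ :=
    Metric.closedBall_subset_ball (mem_ball_iff_norm.1 hp)
  have hderiv : ∀ y ∈ Metric.closedBall p₀ ‖p - p₀‖, ‖fderiv ℝ f y‖ ≤ K * ‖p - p₀‖ := by
    intro y hy
    have hlip := hK.norm_sub_le (hball (hsub hy)).1 (mem_of_mem_nhds ht)
    rw [hmin.fderiv_eq_zero, sub_zero] at hlip
    exact hlip.trans (mul_le_mul_of_nonneg_left (mem_closedBall_iff_norm.1 hy) K.2)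
  have hmean := (convex_closedBall p₀ ‖p - p₀‖).norm_image_sub_le_of_norm_fderiv_le (𝕜 := ℝ)
    (fun y hy => (hball (hsub hy)).2) hderiv (Metric.mem_closedBall_self (norm_nonneg _))
    (mem_closedBall_iff_norm.2 le_rfl)
  rw [pow_two, ← mul_assoc]
  exact (le_abs_self _).trans hmean

/-! ### Superpositions of wave packets -/

theorem exists_scales : ∃ e d : ℕ → ℝ, (∀ n, 0 < e n) ∧ (∀ n, e n < d n) ∧
    Tendsto d atTop (𝓝 0) ∧ Tendsto (fun n => d n / e n) atTop atTop := by
  have hlim : Tendsto (fun n : ℕ => (n : ℝ) + 2) atTop atTop :=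
    tendsto_atTop_add_const_right _ _ tendsto_natCast_atTop_atTop
  refine ⟨fun n => (((n : ℝ) + 2) ^ 2)⁻¹, fun n => ((n : ℝ) + 2)⁻¹, fun n => by positivity,
    fun n => inv_strictAnti₀ (by positivity) (by nlinarith), tendsto_inv_atTop_zero.comp hlim,
    hlim.congr fun n => by field_simp⟩

section Superposition

variable {N : Type*} [Fintype N]

/-- The Fourier side of the superposition with coefficients `c` of wave packets at `ξ₀`. -/
def amplitude (e d : ℝ) (ξ₀ : N → Plane) (c : N → ℂ) (ξ : Plane) : ℂ :=
  ∑ j, c j * (profile e d (ξ - ξ₀ j) : ℂ)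

/-- The superposition with coefficients `c` of wave packets at `ξ₀`. -/
def superposition (e d : ℝ) (ξ₀ : N → Plane) (c : N → ℂ) (x : Plane) : ℂ :=
  ∑ j, c j * packet e d (ξ₀ j) x

theorem amplitude_eq_zero (ξ₀ : N → Plane) (c : N → ℂ) {ξ : Plane}
    (hξ : (∑ j, ‖ξ₀ j‖) + d < ‖ξ‖) : amplitude e d ξ₀ c ξ = 0 := by
  refine Finset.sum_eq_zero fun j _ => ?_
  have hsub := norm_sub_norm_le ξ (ξ₀ j)
  have hsingle := Finset.single_le_sum (f := fun j => ‖ξ₀ j‖) (fun j _ => norm_nonneg _)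
    (Finset.mem_univ j)
  rw [profile_of_ge (by linarith), Complex.ofReal_zero, mul_zero]

theorem norm_amplitude_sq_le (he : 0 < e) (hed : e < d) (ξ₀ : N → Plane) {c : N → ℂ}
    (hc : ‖c‖ ≤ 1) (ξ : Plane) :
    ‖amplitude e d ξ₀ c ξ‖ ^ 2 ≤ Fintype.card N * ∑ j, profile e d (ξ - ξ₀ j) ^ 2 := by
  have hle : ‖amplitude e d ξ₀ c ξ‖ ≤ ∑ j, profile e d (ξ - ξ₀ j) := by
    refine norm_sum_le_of_le _ fun j _ => ?_
    rw [norm_mul, Complex.norm_real, Real.norm_of_nonneg (profile_nonneg he hed _)]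
    exact mul_le_of_le_one_left (profile_nonneg he hed _) ((norm_le_pi_norm c j).trans hc)
  calc ‖amplitude e d ξ₀ c ξ‖ ^ 2 ≤ (∑ j, profile e d (ξ - ξ₀ j)) ^ 2 := by gcongr
    _ ≤ Fintype.card N * ∑ j, profile e d (ξ - ξ₀ j) ^ 2 := sq_sum_le_card_mul_sum_sq

theorem integral_wave_mul_amplitude (he : 0 < e) (hed : e < d) (ξ₀ : N → Plane) (c : N → ℂ)
    (x : Plane) : ∫ ξ, wave x ξ * amplitude e d ξ₀ c ξ = superposition e d ξ₀ c x := by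
  simp only [amplitude, Finset.mul_sum, mul_left_comm (wave x _)]
  rw [integral_finsetSum _ fun j _ => (integrable_packet he hed (ξ₀ j) x).const_mul _]
  simp only [integral_const_mul, superposition, packet]

theorem norm_superposition_le (he : 0 < e) (hed : e < d) (ξ₀ : N → Plane) {c : N → ℂ}
    (hc : ‖c‖ ≤ 1) (x : Plane) : ‖superposition e d ξ₀ c x‖ ≤ Fintype.card N := by
  refine (norm_sum_le_of_le (n := fun _ => (1 : ℝ)) _ fun j _ => ?_).trans (by simp)
  rw [norm_mul]
  exact mul_le_one₀ ((norm_le_pi_norm c j).trans hc) (norm_nonneg _)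
    (norm_packet_le he hed _ x)

theorem continuous_packet (he : 0 < e) (hed : e < d) (ξ₀ : Plane) :
    Continuous (packet e d ξ₀) := by
  refine continuous_of_dominated (fun x => (integrable_packet he hed ξ₀ x).aestronglyMeasurable)
    (fun x => Eventually.of_forall fun ξ => ?_)
    ((integrable_profile he hed).comp_sub_right ξ₀) (Eventually.of_forall fun ξ => ?_)
  · rw [norm_mul, norm_wave, one_mul, Complex.norm_real,
      Real.norm_of_nonneg (profile_nonneg he hed _)]
  · simp only [wave]
    fun_prop

theorem continuous_superposition (he : 0 < e) (hed : e < d) (ξ₀ : N → Plane) (c : N → ℂ) :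
    Continuous (superposition e d ξ₀ c) :=
  continuous_finsetSum _ fun j _ => continuous_const.mul (continuous_packet he hed (ξ₀ j))

theorem tendsto_superposition {ι : Type*} {l : Filter ι} {e d : ι → ℝ} (he : ∀ n, 0 < e n)
    (hed : ∀ n, e n < d n) (hd : Tendsto d l (𝓝 0)) (ξ₀ : N → Plane) {c : ι → N → ℂ}
    {c₀ : N → ℂ} (hc : Tendsto c l (𝓝 c₀)) (x : Plane) :
    Tendsto (fun n => superposition (e n) (d n) ξ₀ (c n) x) l
      (𝓝 (∑ j, c₀ j * wave x (ξ₀ j))) :=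
  tendsto_finsetSum _ fun j _ =>
    (tendsto_pi_nhds.1 hc j).mul (tendsto_packet he hed hd (ξ₀ j) x)

end Superposition

/-! ### Polarized spinors -/

/-- The Fourier transform of `F` lies in the lower band, with amplitude `z`. The factor `2π`
converts a frequency into a momentum. -/
def IsPolarized (A : Plane → ℂ) (z : Plane → ℂ) (F : H1) : Prop :=
  hat F =ᵐ[volume] fun ξ => z ξ • polarization A ((2 * Real.pi) • ξ)

theorem exists_isPolarized_profile {A : Plane → ℂ} (hA : Continuous A) (he : 0 < e) (hed : e < d)
    (ξ₀ : Plane) : ∃ F : H1, IsPolarized A (fun ξ => (profile e d (ξ - ξ₀) : ℂ)) F := by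
  have hpol : Measurable fun ξ : Plane => polarization A ((2 * Real.pi) • ξ) :=
    (measurable_polarization hA).comp (measurable_const_smul _)
  have hprof : Measurable fun ξ : Plane => (profile e d (ξ - ξ₀) : ℂ) :=
    Complex.measurable_ofReal.comp ((measurable_profile e d).comp (measurable_id.sub_const ξ₀))
  refine exists_hat_eq (C := (annulusMass e d)⁻¹ * (e ^ 2)⁻¹ * 2) (R := ‖ξ₀‖ + d)
    (hprof.smul hpol).aestronglyMeasurable (fun ξ => ?_) fun ξ hξ => ?_
  · have hnorm : ‖polarization A ((2 * Real.pi) • ξ)‖ ≤ 2 := by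
      nlinarith [norm_polarization_sq_le A ((2 * Real.pi) • ξ)]
    have hmass := annulusMass_pos he hed
    rw [norm_smul, Complex.norm_real, Real.norm_of_nonneg (profile_nonneg he hed _)]
    exact mul_le_mul (profile_le he hed _) hnorm (norm_nonneg _) (by positivity)
  · have hsub := norm_sub_norm_le ξ ξ₀
    have hzero : profile e d (ξ - ξ₀) = 0 := profile_of_ge (by linarith)
    simp only [hzero, Complex.ofReal_zero, zero_smul]

namespace IsPolarized

variable {A : Plane → ℂ}

theorem sum_smul {N : Type*} [Fintype N] {z : N → Plane → ℂ} {V : N → H1}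
    (hV : ∀ j, IsPolarized A (z j) (V j)) (c : N → ℂ) :
    IsPolarized A (fun ξ => ∑ j, c j * z j ξ) (∑ j, c j • V j) := by
  filter_upwards [coeFn_hat_sum c V hV] with ξ hξ
  simp only [hξ, Finset.sum_smul, smul_smul]

theorem norm_hat_sq_le {z : Plane → ℂ} {F : H1} (hF : IsPolarized A z F) :
    ∀ᵐ ξ, ‖hat F ξ‖ ^ 2 ≤ 2 * ‖z ξ‖ ^ 2 := by
  filter_upwards [hF] with ξ hξ
  rw [hξ, norm_smul, mul_pow, mul_comm]
  exact mul_le_mul_of_nonneg_right (norm_polarization_sq_le _ _) (sq_nonneg _)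

end IsPolarized

namespace System

variable (D : System)

theorem trace_eq_superposition (he : 0 < e) (hed : e < d) {N : Type*} [Fintype N]
    {ξ₀ : N → Plane} {c : N → ℂ} {F : H1} (hF : IsPolarized D.A (amplitude e d ξ₀ c) F) :
    ∀ᵐ x ∂D.m, D.trace F x 0 = superposition e d ξ₀ c x := by
  have hd : 0 < d := he.trans hed
  have hsupp : ∀ᵐ ξ, (∑ j, ‖ξ₀ j‖) + d < ‖ξ‖ → hat F ξ = 0 := by
    filter_upwards [hF] with ξ hξ hlarge
    rw [hξ, amplitude_eq_zero ξ₀ c hlarge, zero_smul]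
  filter_upwards [D.trace_eq_integral (by positivity) hsupp] with x hx
  rw [hx 0, ← integral_wave_mul_amplitude he hed]
  refine integral_congr_ae ?_
  filter_upwards [hF] with ξ hξ
  rw [hξ, PiLp.smul_apply, polarization_zero, smul_eq_mul, mul_one]

/-! ### The free energy of a wave packet -/

/-- The kinetic energy above the threshold at the frequency `ξ`, in the lower band. -/
def gap (ξ : Plane) : ℝ := lowerBand D.A ((2 * Real.pi) • ξ) - D.kappa

theorem gap_nonneg (ξ : Plane) : 0 ≤ D.gap ξ := sub_nonneg.2 (D.kappa_le _)

theorem contDiffAt_gap {ξ₀ : Plane} (hξ₀ : (2 * Real.pi) • ξ₀ ∈ minimumSet D.A) :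
    ContDiffAt ℝ 2 D.gap ξ₀ := by
  obtain ⟨U, hU, hsub, hdiff⟩ := D.contDiff_norm_A
  have hband : ContDiffAt ℝ 2 (lowerBand D.A) ((2 * Real.pi) • ξ₀) :=
    (contDiff_norm_sq ℝ).contDiffAt.sub (hdiff.contDiffAt (hU.mem_nhds (hsub hξ₀)))
  exact (hband.comp ξ₀ (contDiff_const_smul (2 * Real.pi)).contDiffAt).sub contDiffAt_const

theorem exists_gap_le {ξ₀ : Plane} (hξ₀ : (2 * Real.pi) • ξ₀ ∈ minimumSet D.A) :
    ∃ K : NNReal, ∀ᶠ ξ in 𝓝 ξ₀, D.gap ξ ≤ K * ‖ξ - ξ₀‖ ^ 2 := by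
  have hzero : D.gap ξ₀ = 0 := sub_eq_zero.2 hξ₀
  have hmin : IsLocalMin D.gap ξ₀ :=
    Eventually.of_forall fun ξ => by rw [hzero]; exact D.gap_nonneg ξ
  simpa only [hzero, sub_zero] using
    exists_sub_le_mul_norm_sq_of_isLocalMin (D.contDiffAt_gap hξ₀) hmin

theorem exists_forall_gap_le {N : Type*} [Finite N] {ξ₀ : N → Plane}
    (hξ₀ : ∀ j, (2 * Real.pi) • ξ₀ j ∈ minimumSet D.A) :
    ∃ K : NNReal, ∀ᶠ d in 𝓝 (0 : ℝ), ∀ j ξ, ‖ξ - ξ₀ j‖ < d → D.gap ξ ≤ K * ‖ξ - ξ₀ j‖ ^ 2 := by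
  choose K hK using fun j => D.exists_gap_le (hξ₀ j)
  obtain ⟨M, hM⟩ := Finite.bddAbove_range K
  refine ⟨M, eventually_all.2 fun j => ?_⟩
  obtain ⟨δ, hδ, hball⟩ := Metric.eventually_nhds_iff_ball.1 (hK j)
  filter_upwards [gt_mem_nhds hδ] with d hd ξ hξ
  refine (hball ξ (mem_ball_iff_norm.2 (hξ.trans hd))).trans ?_
  gcongr
  exact hM (Set.mem_range_self j)

/-- The quadratic form of `H - κ`. -/
def excess (F : H1) : ℝ := (D.form F F).re - D.kappa * ‖F.1.1‖ ^ 2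

theorem excess_smul (k : ℂ) (F : H1) : D.excess (k • F) = ‖k‖ ^ 2 * D.excess F := by
  have hnorm : ‖(k • F).1.1‖ = ‖k‖ * ‖F.1.1‖ := norm_smul k F.1.1
  rw [excess, excess, form_smul, form_smul_left, ← mul_assoc, Complex.mul_conj',
    ← Complex.ofReal_pow, Complex.re_ofReal_mul, hnorm]
  ring

theorem re_freeForm_sub_eq_integral_gap {z : Plane → ℂ} {F : H1} (hF : IsPolarized D.A z F) :
    (Integrable fun ξ => D.gap ξ * ‖hat F ξ‖ ^ 2) ∧
      (D.freeForm F F).re - D.kappa * ‖F.1.1‖ ^ 2 = ∫ ξ, D.gap ξ * ‖hat F ξ‖ ^ 2 := by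
  have hfree : Integrable fun ξ => (D.freeIntegrand F F ξ).re :=
    (D.integrable_freeIntegrand F F).re
  have hmass : Integrable fun ξ => D.kappa * ‖hat F ξ‖ ^ 2 :=
    (integrable_norm_sq (hat F)).const_mul _
  have hae : (fun ξ => (D.freeIntegrand F F ξ).re - D.kappa * ‖hat F ξ‖ ^ 2) =ᵐ[volume]
      fun ξ => D.gap ξ * ‖hat F ξ‖ ^ 2 := by
    filter_upwards [hF] with ξ hξ
    rw [freeIntegrand, hξ, inner_symbol_smul_polarization, Complex.ofReal_re, gap, sub_mul]
  refine ⟨(hfree.sub hmass).congr hae, ?_⟩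
  rw [re_freeForm, norm_fst_eq, norm_sq_eq_integral, ← integral_const_mul,
    ← integral_sub hfree hmass]
  exact integral_congr_ae hae

section Superposition

variable {D} {N : Type*} [Fintype N] {K : NNReal} {ξ₀ : N → Plane}

theorem gap_mul_sum_profile_sq_le (hgap : ∀ j ξ, ‖ξ - ξ₀ j‖ < d → D.gap ξ ≤ K * ‖ξ - ξ₀ j‖ ^ 2)
    (ξ : Plane) : D.gap ξ * ∑ j, profile e d (ξ - ξ₀ j) ^ 2 ≤
      ∑ j, K * (‖ξ - ξ₀ j‖ ^ 2 * profile e d (ξ - ξ₀ j) ^ 2) := by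
  rw [Finset.mul_sum]
  refine Finset.sum_le_sum fun j _ => ?_
  rcases le_or_gt d ‖ξ - ξ₀ j‖ with hj | hj
  · rw [profile_of_ge hj, zero_pow two_ne_zero, mul_zero, mul_zero, mul_zero]
  · rw [← mul_assoc]
    exact mul_le_mul_of_nonneg_right (hgap j ξ hj) (sq_nonneg _)

theorem re_freeForm_sub_le (he : 0 < e) (hed : e < d)
    (hgap : ∀ j ξ, ‖ξ - ξ₀ j‖ < d → D.gap ξ ≤ K * ‖ξ - ξ₀ j‖ ^ 2) {c : N → ℂ} (hc : ‖c‖ ≤ 1)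
    {F : H1} (hF : IsPolarized D.A (amplitude e d ξ₀ c) F) :
    (D.freeForm F F).re - D.kappa * ‖F.1.1‖ ^ 2 ≤
      2 * Fintype.card N ^ 2 * K * (annulusMass e d)⁻¹ := by
  obtain ⟨hint, heq⟩ := D.re_freeForm_sub_eq_integral_gap hF
  have hterm (j : N) :
      Integrable fun ξ => K * (‖ξ - ξ₀ j‖ ^ 2 * profile e d (ξ - ξ₀ j) ^ 2) :=
    ((integrable_norm_sq_mul_profile_sq he hed).comp_sub_right (ξ₀ j)).const_mul (K : ℝ)
  have hvalue (j : N) : ∫ ξ, K * (‖ξ - ξ₀ j‖ ^ 2 * profile e d (ξ - ξ₀ j) ^ 2) =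
      K * (annulusMass e d)⁻¹ := by
    rw [integral_const_mul, integral_sub_right_eq_self
      (fun ξ : Plane => ‖ξ‖ ^ 2 * profile e d ξ ^ 2) (ξ₀ j),
      integral_norm_sq_mul_profile_sq he hed]
  have hle : ∀ᵐ ξ, D.gap ξ * ‖hat F ξ‖ ^ 2 ≤ 2 * Fintype.card N *
      ∑ j, K * (‖ξ - ξ₀ j‖ ^ 2 * profile e d (ξ - ξ₀ j) ^ 2) := by
    filter_upwards [hF.norm_hat_sq_le] with ξ hξ
    calc D.gap ξ * ‖hat F ξ‖ ^ 2
        ≤ D.gap ξ * (2 * (Fintype.card N * ∑ j, profile e d (ξ - ξ₀ j) ^ 2)) := by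
          refine mul_le_mul_of_nonneg_left (hξ.trans ?_) (D.gap_nonneg ξ)
          gcongr
          exact norm_amplitude_sq_le he hed ξ₀ hc ξ
      _ = 2 * Fintype.card N * (D.gap ξ * ∑ j, profile e d (ξ - ξ₀ j) ^ 2) := by ring
      _ ≤ _ := by
          gcongr
          exact gap_mul_sum_profile_sq_le hgap ξ
  rw [heq]
  refine (integral_mono_ae hint ((integrable_finsetSum _ fun j _ => hterm j).const_mul _)
    hle).trans_eq ?_
  rw [integral_const_mul, integral_finsetSum _ fun j _ => hterm j]
  simp only [hvalue, Finset.sum_const, Finset.card_univ, nsmul_eq_mul]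
  ring

end Superposition

end System

theorem ae_eq_zero_of_integral_eq_zero_of_nonpos {X : Type*} [MeasurableSpace X] {μ : Measure X}
    {f : X → ℝ} (hf : ∀ᵐ x ∂μ, f x ≤ 0) (hint : Integrable f μ) (h : ∫ x, f x ∂μ = 0) :
    ∀ᵐ x ∂μ, f x = 0 := by
  have hneg : (fun x => -f x) =ᵐ[μ] 0 :=
    (integral_eq_zero_iff_of_nonneg_ae (hf.mono fun x hx => neg_nonneg.2 hx) hint.neg).1
      (by rw [integral_neg, h, neg_zero])
  exact hneg.mono fun x hx => neg_eq_zero.1 hx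

namespace System

variable (D : System)

/-! ### The energy of a wave packet -/

theorem re_nuForm_self (F : H1) :
    (D.nuForm F F).re = ∫ x, D.h x * ‖D.trace F x‖ ^ 2 ∂D.m := by
  have hre : (D.nuForm F F).re =
      ∫ x, ((D.h x : ℂ) * ⟪D.trace F x, D.trace F x⟫_ℂ).re ∂D.m :=
    (integral_re (D.integrable_nuForm F F)).symm
  rw [hre]
  congr! 2 with x
  rw [Complex.re_ofReal_mul]
  congr 1
  exact inner_self_eq_norm_sq (𝕜 := ℂ) (D.trace F x)

theorem re_nuForm_le (hneg : ∀ᵐ x ∂D.m, D.h x ≤ 0) {F : H1} {g : Plane → ℂ}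
    (hg : ∀ᵐ x ∂D.m, D.trace F x 0 = g x) :
    (D.nuForm F F).re ≤ ∫ x, D.h x * ‖g x‖ ^ 2 ∂D.m := by
  obtain ⟨C, hC⟩ := D.bounded_h
  have hle : ∀ᵐ x ∂D.m, ‖g x‖ ^ 2 ≤ ‖D.trace F x‖ ^ 2 := hg.mono fun x hx => by
    rw [← hx]
    gcongr
    exact PiLp.norm_apply_le _ _
  have htrace : Integrable (fun x => ‖D.trace F x‖ ^ 2) D.m := integrable_norm_sq _
  have hmeas : AEStronglyMeasurable g D.m :=
    ((EuclideanSpace.proj (𝕜 := ℂ) (0 : Fin 2)).continuous.comp_aestronglyMeasurable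
      (Lp.aestronglyMeasurable (D.trace F))).congr hg
  have hgsq : Integrable (fun x => ‖g x‖ ^ 2) D.m :=
    htrace.mono' (hmeas.norm.pow 2) (hle.mono fun x hx => by rwa [norm_pow, norm_norm])
  have hbdd {f : Plane → ℝ} (hf : Integrable f D.m) : Integrable (fun x => D.h x * f x) D.m :=
    hf.bdd_mul D.measurable_h.aestronglyMeasurable (Eventually.of_forall hC)
  rw [re_nuForm_self]
  refine integral_mono_ae (hbdd htrace) (hbdd hgsq) ?_
  filter_upwards [hneg, hle] with x hx hxle
  exact mul_le_mul_of_nonpos_left hxle hx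

section Superposition

variable {D} {N : Type*} [Fintype N] {ξ₀ : N → Plane}

theorem excess_le (hneg : ∀ᵐ x ∂D.m, D.h x ≤ 0) (he : 0 < e) (hed : e < d) {K : NNReal}
    (hgap : ∀ j ξ, ‖ξ - ξ₀ j‖ < d → D.gap ξ ≤ K * ‖ξ - ξ₀ j‖ ^ 2) {c : N → ℂ} (hc : ‖c‖ ≤ 1)
    {F : H1} (hF : IsPolarized D.A (amplitude e d ξ₀ c) F) :
    D.excess F ≤ 2 * Fintype.card N ^ 2 * K * (annulusMass e d)⁻¹ +
      ∫ x, D.h x * ‖superposition e d ξ₀ c x‖ ^ 2 ∂D.m := by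
  have hfree := re_freeForm_sub_le he hed hgap hc hF
  have hnu := D.re_nuForm_le hneg (D.trace_eq_superposition he hed hF)
  rw [excess, form, Complex.add_re]
  linarith

theorem tendsto_integral_superposition {e d : ℕ → ℝ} (he : ∀ n, 0 < e n)
    (hed : ∀ n, e n < d n) (hd : Tendsto d atTop (𝓝 0)) {c : ℕ → N → ℂ} {c₀ : N → ℂ}
    (hc : ∀ n, ‖c n‖ ≤ 1) (hlim : Tendsto c atTop (𝓝 c₀)) :
    Tendsto (fun n => ∫ x, D.h x * ‖superposition (e n) (d n) ξ₀ (c n) x‖ ^ 2 ∂D.m) atTop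
      (𝓝 (∫ x, D.h x * ‖∑ j, c₀ j * wave x (ξ₀ j)‖ ^ 2 ∂D.m)) := by
  obtain ⟨C, hC⟩ := D.bounded_h
  refine tendsto_integral_of_dominated_convergence (fun _ => C * (Fintype.card N : ℝ) ^ 2)
    (fun n => D.measurable_h.aestronglyMeasurable.mul
      ((continuous_superposition (he n) (hed n) ξ₀ (c n)).norm.pow 2).aestronglyMeasurable)
    (integrable_const _) (fun n => Eventually.of_forall fun x => ?_)
    (Eventually.of_forall fun x =>
      ((tendsto_superposition he hed hd ξ₀ hlim x).norm.pow 2).const_mul _)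
  rw [norm_mul, norm_pow, norm_norm]
  have hCx : ‖D.h x‖ ≤ C := hC x
  have hC₀ : 0 ≤ C := (norm_nonneg _).trans hCx
  have hx := norm_superposition_le (he n) (hed n) ξ₀ (hc n) x
  gcongr

/-! ### Negative directions from plane waves -/

theorem exists_norm_eq_one_excess_nonneg {V : N → H1}
    (h : ∃ c : N → ℂ, c ≠ 0 ∧ 0 ≤ D.excess (∑ j, c j • V j)) :
    ∃ c : N → ℂ, ‖c‖ = 1 ∧ 0 ≤ D.excess (∑ j, c j • V j) := by
  obtain ⟨c, hc, hexc⟩ := h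
  have hscale : ∑ j, ((‖c‖⁻¹ : ℂ) • c) j • V j = (‖c‖⁻¹ : ℂ) • ∑ j, c j • V j := by
    simp only [Finset.smul_sum, Pi.smul_apply, smul_assoc]
  refine ⟨(‖c‖⁻¹ : ℂ) • c, norm_smul_inv_norm hc, ?_⟩
  rw [hscale, excess_smul]
  positivity

theorem exists_excess_neg (hneg : ∀ᵐ x ∂D.m, D.h x ≤ 0)
    (hξ₀ : ∀ j, (2 * Real.pi) • ξ₀ j ∈ minimumSet D.A)
    (hindep : ∀ c : N → ℂ,
      ∫ x, D.h x * ‖∑ j, c j * wave x (ξ₀ j)‖ ^ 2 ∂D.m = 0 → c = 0) :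
    ∃ V : N → H1, ∀ c : N → ℂ, c ≠ 0 → D.excess (∑ j, c j • V j) < 0 := by
  obtain ⟨K, hK⟩ := D.exists_forall_gap_le hξ₀
  obtain ⟨e, d, he, hed, hd, hratio⟩ := exists_scales
  choose V hV using fun n j => exists_isPolarized_profile D.continuous_A (he n) (hed n) (ξ₀ j)
  by_contra! hcon
  choose c hc hexc using fun n => exists_norm_eq_one_excess_nonneg (hcon (V n))
  obtain ⟨c₀, hc₀, φ, hφ, hlim⟩ := (isCompact_sphere (0 : N → ℂ) 1).tendsto_subseq
    fun n => mem_sphere_zero_iff_norm.2 (hc n)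
  have hφ' := hφ.tendsto_atTop
  have hbound : ∀ᶠ n in atTop, 0 ≤ 2 * Fintype.card N ^ 2 * K * (annulusMass (e n) (d n))⁻¹ +
      ∫ x, D.h x * ‖superposition (e n) (d n) ξ₀ (c n) x‖ ^ 2 ∂D.m := by
    filter_upwards [hd.eventually hK] with n hn
    exact (hexc n).trans
      (excess_le hneg (he n) (hed n) hn (hc n).le (IsPolarized.sum_smul (hV n) (c n)))
  have henergy := ((tendsto_inv_annulusMass hratio).comp hφ').const_mul
    (2 * Fintype.card N ^ 2 * K : ℝ)
  have hwave := tendsto_integral_superposition (D := D) (ξ₀ := ξ₀) (fun n => he (φ n))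
    (fun n => hed (φ n)) (hd.comp hφ') (fun n => (hc (φ n)).le) hlim
  have hnonneg : 0 ≤ ∫ x, D.h x * ‖∑ j, c₀ j * wave x (ξ₀ j)‖ ^ 2 ∂D.m := by
    simpa using ge_of_tendsto (henergy.add hwave) (hφ'.eventually hbound)
  have hnonpos : ∫ x, D.h x * ‖∑ j, c₀ j * wave x (ξ₀ j)‖ ^ 2 ∂D.m ≤ 0 :=
    integral_nonpos_of_ae
      (hneg.mono fun x hx => mul_nonpos_of_nonpos_of_nonneg hx (sq_nonneg _))
  rw [hindep c₀ (le_antisymm hnonpos hnonneg), mem_sphere_zero_iff_norm, norm_zero] at hc₀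
  exact zero_ne_one hc₀

end Superposition

/-! ### The support of the perturbation -/

theorem integrable_h : Integrable D.h D.m := by
  obtain ⟨C, hC⟩ := D.bounded_h
  exact Integrable.of_bound D.measurable_h.aestronglyMeasurable C (Eventually.of_forall hC)

theorem nu_apply {s : Set Plane} (hs : MeasurableSet s) : D.nu s = ∫ x in s, D.h x ∂D.m :=
  withDensityᵥ_apply D.integrable_h hs

theorem ae_h_nonpos (hnu : D.nu ≤ 0) : ∀ᵐ x ∂D.m, D.h x ≤ 0 := by
  refine ae_le_of_forall_setIntegral_le (g := fun _ => (0 : ℝ)) D.integrable_h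
    (integrable_zero _ _ _) fun s hs _ => ?_
  rw [← D.nu_apply hs, integral_zero]
  exact hnu s hs

theorem totalVariation_eq_zero {U : Set Plane} (hU : MeasurableSet U)
    (h : ∀ᵐ x ∂D.m, x ∈ U → D.h x = 0) : D.nu.totalVariation U = 0 := by
  have hzero (s : Set Plane) (hs : MeasurableSet s) : D.nu (s ∩ U) = 0 := by
    rw [D.nu_apply (hs.inter hU)]
    exact setIntegral_eq_zero_of_ae_eq_zero (h.mono fun x hx hxs => hx hxs.2)
  obtain ⟨i, hi, _, _, hpos, hneg⟩ := D.nu.toJordanDecomposition_spec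
  rw [SignedMeasure.totalVariation, Measure.add_apply, hpos, hneg,
    SignedMeasure.toMeasureOfZeroLE_apply _ _ hi hU,
    SignedMeasure.toMeasureOfLEZero_apply _ _ hi.compl hU]
  simp [hzero i hi, hzero iᶜ hi.compl]

theorem support_subset_of_integral_eq_zero (hneg : ∀ᵐ x ∂D.m, D.h x ≤ 0) {T : Plane → ℂ}
    (hT : Continuous T) {B : ℝ} (hB : ∀ x, ‖T x‖ ≤ B)
    (h : ∫ x, D.h x * ‖T x‖ ^ 2 ∂D.m = 0) : D.nu.totalVariation.support ⊆ {x | T x = 0} := by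
  have hint : Integrable (fun x => D.h x * ‖T x‖ ^ 2) D.m := by
    refine D.integrable_h.mul_bdd (c := B ^ 2) (hT.norm.pow 2).aestronglyMeasurable
      (Eventually.of_forall fun x => ?_)
    rw [norm_pow, norm_norm]
    have := hB x
    gcongr
  have hae : ∀ᵐ x ∂D.m, D.h x * ‖T x‖ ^ 2 = 0 :=
    ae_eq_zero_of_integral_eq_zero_of_nonpos (hneg.mono fun x hx =>
      mul_nonpos_of_nonpos_of_nonneg hx (sq_nonneg _)) hint h
  have hopen : IsOpen {x | T x ≠ 0} := isOpen_ne_fun hT continuous_const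
  have hnull := D.totalVariation_eq_zero hopen.measurableSet <| hae.mono fun x hx hTx =>
    (mul_eq_zero.1 hx).resolve_right (pow_ne_zero 2 (norm_ne_zero_iff.2 hTx))
  intro x hx
  by_contra hTx
  exact ((Measure.mem_support_iff_forall x).1 hx _ (hopen.mem_nhds hTx)).ne' hnull

end System

theorem wave_inv_two_pi_smul (x p : Plane) :
    wave x ((2 * Real.pi)⁻¹ • p) = Complex.exp (Complex.I * (⟪p, x⟫_ℝ : ℝ)) := by
  rw [wave, real_inner_smul_left, mul_inv_cancel_left₀ (by positivity), mul_comm]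

namespace System

variable (D : System)

theorem eq_zero_of_integral_wave_eq_zero (hneg : ∀ᵐ x ∂D.m, D.h x ≤ 0) {x₀ : Plane} {r : ℝ}
    (hinf : (D.nu.totalVariation.support ∩ Metric.sphere x₀ r).Infinite) {N : Type*} [Fintype N]
    {p : N → Plane} (hp : Function.Injective p) {c : N → ℂ}
    (hc : ∫ x, D.h x * ‖∑ j, c j * wave x ((2 * Real.pi)⁻¹ • p j)‖ ^ 2 ∂D.m = 0) : c = 0 := by
  have hcont : Continuous fun x => ∑ j, c j * wave x ((2 * Real.pi)⁻¹ • p j) := by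
    simp only [wave]
    fun_prop
  have hbound (x : Plane) : ‖∑ j, c j * wave x ((2 * Real.pi)⁻¹ • p j)‖ ≤ ∑ j, ‖c j‖ :=
    norm_sum_le_of_le _ fun j _ => by rw [norm_mul, norm_wave, mul_one]
  have hsub := D.support_subset_of_integral_eq_zero hneg hcont hbound hc
  simp only [wave_inv_two_pi_smul] at hsub
  exact eq_zero_of_infinite_sphere_zeros hp (hinf.mono (Set.inter_subset_inter_left _ hsub))

theorem card_le_countBelow_of_subset_minimumSet (hD : D.RelativelyFormBounded)
    (hneg : ∀ᵐ x ∂D.m, D.h x ≤ 0) {x₀ : Plane} {r : ℝ}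
    (hinf : (D.nu.totalVariation.support ∩ Metric.sphere x₀ r).Infinite) {s : Finset Plane}
    (hs : (s : Set Plane) ⊆ minimumSet D.A) :
    (s.card : ℕ∞) ≤ countBelow D.hamiltonian D.kappa := by
  obtain ⟨V, hV⟩ := exists_excess_neg hneg (ξ₀ := fun j : s => (2 * Real.pi)⁻¹ • (j : Plane))
    (fun j => by rw [smul_inv_smul₀ (by positivity)]; exact hs j.2)
    fun c => D.eq_zero_of_integral_wave_eq_zero hneg hinf Subtype.val_injective
  simpa using D.card_le_countBelow hD V fun c hc => sub_neg.1 (hV c hc)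

theorem hasManyEigenvalues_of_infinite_support (hD : D.RelativelyFormBounded) (hnu : D.nu ≤ 0)
    {x₀ : Plane} {r : ℝ} (hinf : (D.nu.totalVariation.support ∩ Metric.sphere x₀ r).Infinite) :
    D.HasManyEigenvalues := by
  have hcard {s : Finset Plane} (hs : (s : Set Plane) ⊆ minimumSet D.A) :=
    D.card_le_countBelow_of_subset_minimumSet hD (D.ae_h_nonpos hnu) hinf hs
  rcases (minimumSet D.A).finite_or_infinite with hfin | hS
  · refine ⟨?_, fun hS => absurd hfin hS⟩
    rw [hfin.encard_eq_coe_toFinset_card]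
    exact hcard (by rw [hfin.coe_toFinset])
  · have htop : countBelow D.hamiltonian D.kappa = ⊤ := by
      refine ENat.eq_top_iff_forall_ge.2 fun n => ?_
      obtain ⟨s, hs, rfl⟩ := hS.exists_subset_card_eq n
      exact hcard hs
    exact ⟨htop ▸ le_top, fun _ => D.infinite_eigenvaluesBelow hD htop⟩

/-! ### Spherically symmetric perturbations -/

theorem nu_nonpos (hneg : ∀ᵐ x ∂D.m, D.h x < 0) : D.nu ≤ 0 := by
  intro s hs
  rw [D.nu_apply hs]
  exact setIntegral_nonpos_of_ae (hneg.mono fun x hx => hx.le)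

theorem measure_absolutelyContinuous_totalVariation (hneg : ∀ᵐ x ∂D.m, D.h x < 0) :
    D.m ≪ D.nu.totalVariation := by
  refine Measure.AbsolutelyContinuous.mk fun s hs hnull => ?_
  have hint : ∫ x in s, D.h x ∂D.m = 0 := by
    rw [← D.nu_apply hs]
    exact D.nu.null_of_totalVariation_zero hnull
  have hneg_s := ae_restrict_of_ae (s := s) hneg
  have hzero : ∀ᵐ x ∂D.m.restrict s, D.h x = 0 :=
    ae_eq_zero_of_integral_eq_zero_of_nonpos (hneg_s.mono fun x hx => hx.le)
      D.integrable_h.integrableOn hint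
  have hfalse : ∀ᵐ _ ∂D.m.restrict s, False := by
    filter_upwards [hneg_s, hzero] with x hx hx0
    exact hx.ne hx0
  rwa [eventually_false_iff_eq_bot, ae_eq_bot, Measure.restrict_eq_zero] at hfalse

end System

theorem norm_H1_le_norm_snd {F : H1} (hF : ∀ᵐ ξ, ‖ξ‖ ≤ 1 → hat F ξ = 0) : ‖F‖ ≤ ‖F.1.2‖ := by
  have hhat : ‖hat F‖ ≤ ‖F.1.2‖ := by
    refine Lp.norm_le_norm_of_ae_le ?_
    filter_upwards [norm_snd_apply F, hF] with ξ hsnd hsupp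
    rw [hsnd]
    rcases le_or_gt ‖ξ‖ 1 with h | h
    · rw [hsupp h, norm_zero, mul_zero]
    · exact le_mul_of_one_le_left (norm_nonneg _) (by nlinarith [Real.pi_gt_three])
  change ‖F.1‖ ≤ _
  rw [Prod.norm_def, norm_fst_eq]
  exact max_le hhat le_rfl

theorem IsPolarized.norm_sq_le {A : Plane → ℂ} (hd : 1 < d) {F : H1}
    (hF : IsPolarized A (fun ξ => (profile 1 d ξ : ℂ)) F) :
    ‖F‖ ^ 2 ≤ 2 * (2 * Real.pi) ^ 2 * (annulusMass 1 d)⁻¹ := by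
  have hsupp : ∀ᵐ ξ, ‖ξ‖ ≤ 1 → hat F ξ = 0 := by
    filter_upwards [hF] with ξ hξ hle
    rw [hξ, profile_of_le hle, Complex.ofReal_zero, zero_smul]
  have hsnd : ‖F.1.2‖ ^ 2 ≤ 2 * (2 * Real.pi) ^ 2 * (annulusMass 1 d)⁻¹ := by
    rw [← integral_norm_sq_mul_profile_sq one_pos hd, norm_sq_eq_integral,
      ← integral_const_mul]
    refine integral_mono_ae (integrable_norm_sq _)
      ((integrable_norm_sq_mul_profile_sq one_pos hd).const_mul _) ?_
    filter_upwards [norm_snd_apply F, hF.norm_hat_sq_le] with ξ hξ hle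
    rw [Complex.norm_real, Real.norm_eq_abs, sq_abs] at hle
    calc ‖F.1.2 ξ‖ ^ 2 = (2 * Real.pi * ‖ξ‖) ^ 2 * ‖hat F ξ‖ ^ 2 := by rw [hξ, mul_pow]
      _ ≤ (2 * Real.pi * ‖ξ‖) ^ 2 * (2 * profile 1 d ξ ^ 2) := by gcongr
      _ = 2 * (2 * Real.pi) ^ 2 * (‖ξ‖ ^ 2 * profile 1 d ξ ^ 2) := by ring
  exact (pow_le_pow_left₀ (norm_nonneg _) (norm_H1_le_norm_snd hsupp) 2).trans hsnd

namespace System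

variable (D : System)

theorem measureReal_univ_le_norm_trace_sq (h0 : ∀ᵐ x ∂D.m, x = 0) (hd : 1 < d) {F : H1}
    (hF : IsPolarized D.A (fun ξ => (profile 1 d ξ : ℂ)) F) :
    D.m.real Set.univ ≤ ‖D.trace F‖ ^ 2 := by
  have hamp : IsPolarized D.A (amplitude 1 d (fun _ : Unit => 0) fun _ => 1) F := by
    simpa [IsPolarized, amplitude] using hF
  rw [norm_sq_eq_integral, ← mul_one (D.m.real Set.univ), ← smul_eq_mul, ← integral_const]
  refine integral_mono_ae (integrable_const _) (integrable_norm_sq _) ?_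
  filter_upwards [h0, D.trace_eq_superposition one_pos hd hamp] with x hx htrace
  have hone : D.trace F x 0 = 1 := by
    rw [htrace, hx]
    simp [superposition, packet_origin one_pos hd]
  rw [norm_sq_C2, hone, norm_one, one_pow]
  exact le_add_of_nonneg_right (sq_nonneg _)

theorem measure_compl_origin_ne_zero (hm : D.m ≠ 0) : D.m {0}ᶜ ≠ 0 := by
  intro h0
  have hlim : Tendsto (fun n : ℕ => (annulusMass 1 ((n : ℝ) + 2))⁻¹) atTop (𝓝 0) :=
    tendsto_inv_annulusMass (e := fun _ => 1) <| by
      simpa only [div_one] using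
        tendsto_atTop_add_const_right atTop (2 : ℝ) tendsto_natCast_atTop_atTop
  have hbound (n : ℕ) : D.m.real Set.univ ≤
      ‖D.trace‖ ^ 2 * (2 * (2 * Real.pi) ^ 2) * (annulusMass 1 ((n : ℝ) + 2))⁻¹ := by
    have hn : 1 < (n : ℝ) + 2 := by linarith [n.cast_nonneg (α := ℝ)]
    obtain ⟨F, hF⟩ := exists_isPolarized_profile D.continuous_A one_pos hn 0
    simp only [sub_zero] at hF
    calc D.m.real Set.univ ≤ ‖D.trace F‖ ^ 2 := D.measureReal_univ_le_norm_trace_sq h0 hn hF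
      _ ≤ (‖D.trace‖ * ‖F‖) ^ 2 := by
          gcongr
          exact D.trace.le_opNorm F
      _ = ‖D.trace‖ ^ 2 * ‖F‖ ^ 2 := mul_pow _ _ _
      _ ≤ ‖D.trace‖ ^ 2 * (2 * (2 * Real.pi) ^ 2 * (annulusMass 1 ((n : ℝ) + 2))⁻¹) := by
          gcongr
          exact hF.norm_sq_le hn
      _ = _ := (mul_assoc _ _ _).symm
  have hle : D.m.real Set.univ ≤ 0 := by
    simpa only [mul_zero] using ge_of_tendsto' (hlim.const_mul _) hbound
  have hzero := hle.antisymm measureReal_nonneg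
  rw [measureReal_eq_zero_iff, Measure.measure_univ_eq_zero] at hzero
  exact hm hzero

theorem exists_sphere_subset_support (hm : D.m ≠ 0)
    (hR : ∀ R : Plane ≃ₗᵢ[ℝ] Plane, D.m.map R = D.m) :
    ∃ r : ℝ, 0 < r ∧ Metric.sphere 0 r ⊆ D.m.support := by
  have hne : D.m ({0}ᶜ ∩ D.m.support) ≠ 0 := by
    rw [measure_inter_conull Measure.support_mem_ae]
    exact D.measure_compl_origin_ne_zero hm
  obtain ⟨x, hx0, hx⟩ := nonempty_of_measure_ne_zero hne
  refine ⟨‖x‖, norm_pos_iff.2 hx0, fun y hy => ?_⟩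
  have hxy : ‖x‖ = ‖y‖ := (mem_sphere_zero_iff_norm.1 hy).symm
  let R : Plane ≃ₗᵢ[ℝ] Plane := Submodule.reflection (ℝ ∙ (x - y))ᗮ
  have hRx : R x = y := Submodule.reflection_sub hxy
  rw [Measure.mem_support_iff_forall] at hx ⊢
  intro U hU
  rw [← hR R]
  have hpre : R ⁻¹' U ∈ 𝓝 x := R.continuous.continuousAt (by rwa [hRx])
  exact (hx _ hpre).trans_le (Measure.le_map_apply R.continuous.measurable.aemeasurable U)

end System

theorem infinite_sphere {r : ℝ} (hr : 0 < r) : (Metric.sphere (0 : Plane) r).Infinite := by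
  have hconn : IsPreconnected (Metric.sphere (0 : Plane) r) :=
    isPreconnected_sphere (by rw [← Module.finrank_eq_rank]; simp) 0 r
  refine hconn.infinite_of_nontrivial
    ⟨EuclideanSpace.single 0 r, ?_, EuclideanSpace.single 0 (-r), ?_, fun h => ?_⟩
  · simp [abs_of_pos hr]
  · simp [abs_of_pos hr]
  · have hr' : r = -r := by simpa using congrArg (fun v : Plane => v 0) h
    linarith

end SpinOrbit

end

theorem corollary2 (D : SpinOrbit.System) (hD : D.RelativelyFormBounded) :
    (D.nu ≤ 0 →
      (∃ (c : SpinOrbit.Plane) (r : ℝ),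
        (D.nu.totalVariation.support ∩ Metric.sphere c r).Infinite) →
      D.HasManyEigenvalues) ∧
    (D.m ≠ 0 →
      (∀ R : SpinOrbit.Plane ≃ₗᵢ[ℝ] SpinOrbit.Plane, D.m.map R = D.m) →
      (∀ᵐ x ∂D.m, D.h x < 0) →
      D.HasManyEigenvalues) := by
  refine ⟨fun hnu ⟨c, r, hinf⟩ => D.hasManyEigenvalues_of_infinite_support hD hnu hinf,
    fun hm hR hneg => ?_⟩
  obtain ⟨r, hr, hsub⟩ := D.exists_sphere_subset_support hm hR
  refine D.hasManyEigenvalues_of_infinite_support hD (D.nu_nonpos hneg) (x₀ := 0) (r := r) ?_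
  refine (SpinOrbit.infinite_sphere hr).mono fun x hx => ⟨?_, hx⟩
  exact (D.measure_absolutelyContinuous_totalVariation hneg).support_mono (hsub hx)
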